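/- **Setting.** Let $\Omega=(a,b)$ be a bounded interval with $a<b$, let $1<\alpha\le 2$, $0\le p\le 1$, $\lambda\ge 0$, and let $m\in C^1(\overline\Omega)$, $c\in C(\overline\Omega)$ be real functions with $c(x)-\tfrac12 m'(x)>0$ for all $x\in\Omega$. All functions are real-valued and $(\cdot,\cdot)$ is the inner product of $L^2(\Omega)$. For $s\ge 0$ put $|w|_{H^s(\mathbb R)}^2=\int_{\mathbb R}|\omega|^{2s}|\hat w(\omega)|^2\,d\omega$ for $w\in L^2(\mathbb R)$, where $\hat w(\omega)=\int_{\mathbb R} e^{-i\omega x}w(x)\,dx$ (extended to $L^2(\mathbb R)$). For $u\in L^2(\Omega)$ put $|u|_{H^s(\Omega)}=\inf\{|w|_{H^s(\mathbb R)}: w\in L^2(\mathbb R),\ w|_\Omega=u\}$ and $\|u\|_{H^s(\Omega)}^2=\|u\|_{L^2(\Omega)}^2+|u|_{H^s(\Omega)}^2$. Let $H^s(\Omega)$ be the set of $u\in L^2(\Omega)$ for which this is finite, let $H_0^s(\Omega)$ be the closure of $C_0^\infty(\Omega)$ in $H^s(\Omega)$, and let $H^{-s}(\Omega)$ be the dual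 of $H_0^s(\Omega)$ with the dual norm. For $\mu\ge0$ with $n-1\le\mu<n$, $n\in\mathbb N^+$, and $\lambda\ge 0$, define for $u\in C_0^\infty(\Omega)$ $${}_a\mathbb D_x^{\mu,\lambda}u(x)=\frac{e^{-\lambda x}}{\Gamma(n-\mu)}\frac{d^n}{dx^n}\int_a^x\frac{e^{\lambda\xi}u(\xi)}{(x-\xi)^{\mu-n+1}}\,d\xi,\qquad {}_x\mathbb D_b^{\mu,\lambda}u(x)=\frac{(-1)^n e^{\lambda x}}{\Gamma(n-\mu)}\frac{d^n}{dx^n}\int_x^b\frac{e^{-\lambda\xi}u(\xi)}{(\xi-x)^{\mu-n+1}}\,d\xi .$$ For $\mu\in[0,1]$, $\mu\neq\frac12$, the same symbols denote the extensions by continuity of these operators to $H_0^\mu(\Omega)\to L^2(\Omega)$. Note that $H_0^{\alpha/2}(\Omega)\subset H_0^{1-\alpha/2}(\Omega)$ and that $mv\in H_0^{\alpha/2}(\Omega)$ for $v\in H_0^{\alpha/2}(\Omega)$. For $u,v\in H_0^{\alpha/2}(\Omega)$ put $$\begin{aligned}A(u,v)={}&-(1-p)\big({}_a\mathbb D_x^{\frac\alpha2,\lambda}u,\,{}_x\mathbb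 D_b^{\frac\alpha2,\lambda}v\big)-p\big({}_x\mathbb D_b^{\frac\alpha2,\lambda}u,\,{}_a\mathbb D_x^{\frac\alpha2,\lambda}v\big)+(1-p)\lambda^\alpha(u,v)+p\lambda^\alpha(u,v)\\&+\alpha(1-2p)\lambda^{\alpha-1}\big({}_a\mathbb D_x^{\frac\alpha2,0}u,\,{}_x\mathbb D_b^{1-\frac\alpha2,0}v\big)+\big({}_a\mathbb D_x^{\frac\alpha2,0}u,\,{}_x\mathbb D_b^{1-\frac\alpha2,0}(mv)\big)+(cu,v).\end{aligned}$$ This is the bilinear form of the Galerkin weak formulation of the two-sided space tempered fractional advection–dispersion problem $-(1-p)\,{}_aD_x^{\alpha,\lambda}u-p\,{}_xD_b^{\alpha,\lambda}u+mu'+cu=f$, $u(a)=u(b)=0$, where ${}_aD_x^{\alpha,\lambda}u={}_a\mathbb D_x^{\alpha,\lambda}u-\lambda^\alpha u-\alpha\lambda^{\alpha-1}u'$ and ${}_xD_b^{\alpha,\lambda}u={}_x\mathbb D_b^{\alpha,\lambda}u-\lambda^\alpha u+\alpha\lambda^{\alpha-1}u'$. **Theorem.** There is a constant $C$, depending only on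 $a,b,\alpha,p,\lambda,m,c$, such that for every $f\in H^{-\alpha/2}(\Omega)$ there is exactly one $u\in H_0^{\alpha/2}(\Omega)$ with $$A(u,v)=\langle f,v\rangle\qquad\text{for all } v\in H_0^{\alpha/2}(\Omega),$$ and this $u$ satisfies $\|u\|_{H^{\alpha/2}(\Omega)}\le C\,\|f\|_{H^{-\alpha/2}(\Omega)}$. -/

import Mathlib

noncomputable section

namespace TemperedFractional

open MeasureTheory Set Filter Topology
open scoped ENNReal FourierTransform Distributions

/-! ### The spaces `L²(Ω)` and `C₀^∞(Ω)` for `Ω = (a, b)` -/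

/-- The real Hilbert space `L²(a, b)`. -/
abbrev L2 (a b : ℝ) : Type := Lp ℝ 2 ((volume : Measure ℝ).restrict (Ioo a b))

/-- The open interval `Ω = (a, b)`. -/
def interval (a b : ℝ) : TopologicalSpace.Opens ℝ := ⟨Ioo a b, isOpen_Ioo⟩

/-- `C₀^∞(a, b)`: smooth functions with compact support inside `(a, b)`. -/
abbrev Test (a b : ℝ) : Type := 𝓓(interval a b, ℝ)

open scoped Classical in
/-- The class in `L²(a, b)` of a function that is square integrable on `(a, b)`
(and `0` for other functions). -/
def toL2 (a b : ℝ) (g : ℝ → ℝ) : L2 a b :=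
  if h : MemLp g 2 ((volume : Measure ℝ).restrict (Ioo a b)) then h.toLp g else 0

/-! ### Fractional Sobolev spaces -/

/-- The Fourier transform `∫ e^{-iωx} u(x) dx` of a real function `u ∈ L²(ℝ)`. Mathlib's transform
has the kernel `e^{-2πiξx}`, so it is evaluated at `ξ = ω / (2π)`. -/
def fourierL2 (u : Lp ℝ 2 (volume : Measure ℝ)) (ω : ℝ) : ℂ :=
  (𝓕 (Complex.ofRealCLM.compLp u : Lp ℂ 2 (volume : Measure ℝ)) : Lp ℂ 2 (volume : Measure ℝ))
    (ω / (2 * Real.pi))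

/-- The seminorm `|u|_{H^s(ℝ)} = (∫ |ω|^{2s} |û(ω)|² dω)^{1/2}`, as an extended real;
`u ∈ L²(ℝ)` belongs to `H^s(ℝ)` when it is finite. -/
def sobolevSeminormR (s : ℝ) (u : Lp ℝ 2 (volume : Measure ℝ)) : ℝ≥0∞ :=
  eLpNorm (fun ω : ℝ => ((|ω| ^ s : ℝ) : ℂ) * fourierL2 u ω) 2 volume

/-- The seminorm `|u|_{H^s(Ω)} = inf |w|_{H^s(ℝ)}` over all extensions `w` of `u` to `ℝ`. -/
def sobolevSeminorm (a b s : ℝ) (u : L2 a b) : ℝ≥0∞ :=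
  ⨅ (w : Lp ℝ 2 (volume : Measure ℝ))
    (_ : ∀ᵐ x ∂((volume : Measure ℝ).restrict (Ioo a b)), w x = u x), sobolevSeminormR s w

/-- The norm `‖u‖_{H^s(Ω)} = (‖u‖²_{L²(Ω)} + |u|²_{H^s(Ω)})^{1/2}`, as an extended real;
`u ∈ L²(Ω)` belongs to `H^s(Ω)` when it is finite. -/
def sobolevENorm (a b s : ℝ) (u : L2 a b) : ℝ≥0∞ :=
  (‖u‖ₑ ^ 2 + sobolevSeminorm a b s u ^ 2) ^ (1 / 2 : ℝ)

theorem fourierL2_add (u v : Lp ℝ 2 (volume : Measure ℝ)) :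
    fourierL2 (u + v) =ᵐ[volume] fun ω => fourierL2 u ω + fourierL2 v ω := by
  have hq : Measure.QuasiMeasurePreserving (fun ω : ℝ => ω / (2 * Real.pi)) volume volume := by
    refine ⟨by fun_prop, ?_⟩
    have h0 : (2 * Real.pi)⁻¹ ≠ 0 := by positivity
    simp only [div_eq_mul_inv]
    rw [Real.map_volume_mul_right h0]
    exact Measure.smul_absolutelyContinuous
  have h1 : (Complex.ofRealCLM.compLp (u + v) : Lp ℂ 2 (volume : Measure ℝ))
      = Complex.ofRealCLM.compLp u + Complex.ofRealCLM.compLp v := by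
    exact (Complex.ofRealCLM.compLpₗ (𝕜' := ℝ) (p := 2) (μ := (volume : Measure ℝ))).map_add u v
  have h2 := Lp.coeFn_add (𝓕 (Complex.ofRealCLM.compLp u : Lp ℂ 2 (volume : Measure ℝ)))
    (𝓕 (Complex.ofRealCLM.compLp v : Lp ℂ 2 (volume : Measure ℝ)))
  have h3 := hq.ae_eq_comp h2
  unfold fourierL2
  rw [h1, FourierTransform.fourier_add]
  exact h3

theorem fourierL2_smul (r : ℝ) (u : Lp ℝ 2 (volume : Measure ℝ)) :
    fourierL2 (r • u) =ᵐ[volume] fun ω => (r : ℂ) * fourierL2 u ω := by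
  have hq : Measure.QuasiMeasurePreserving (fun ω : ℝ => ω / (2 * Real.pi)) volume volume := by
    refine ⟨by fun_prop, ?_⟩
    have h0 : (2 * Real.pi)⁻¹ ≠ 0 := by positivity
    simp only [div_eq_mul_inv]
    rw [Real.map_volume_mul_right h0]
    exact Measure.smul_absolutelyContinuous
  have h1 : (Complex.ofRealCLM.compLp (r • u) : Lp ℂ 2 (volume : Measure ℝ))
      = (r : ℂ) • (Complex.ofRealCLM.compLp u : Lp ℂ 2 (volume : Measure ℝ)) := by
    apply Lp.ext
    filter_upwards [Complex.ofRealCLM.coeFn_compLp (r • u), Complex.ofRealCLM.coeFn_compLp u,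
      Lp.coeFn_smul r u,
      Lp.coeFn_smul (r : ℂ) (Complex.ofRealCLM.compLp u : Lp ℂ 2 (volume : Measure ℝ))]
      with x e1 e2 e3 e4
    rw [e1, e4, e3, Pi.smul_apply, Pi.smul_apply, e2]
    simp
  have h2 := Lp.coeFn_smul (r : ℂ) (𝓕 (Complex.ofRealCLM.compLp u : Lp ℂ 2 (volume : Measure ℝ)))
  have h3 := hq.ae_eq_comp h2
  unfold fourierL2
  rw [h1, FourierTransform.fourier_smul]
  exact h3

theorem aestronglyMeasurable_fourierL2 (u : Lp ℝ 2 (volume : Measure ℝ)) :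
    AEStronglyMeasurable (fourierL2 u) volume := by
  have hm := Lp.stronglyMeasurable (𝓕 (Complex.ofRealCLM.compLp u : Lp ℂ 2 (volume : Measure ℝ)))
  exact (hm.comp_measurable (by fun_prop : Measurable fun ω : ℝ => ω / (2 * Real.pi))).aestronglyMeasurable

theorem sobolevSeminormR_add_le (s : ℝ) (u v : Lp ℝ 2 (volume : Measure ℝ)) :
    sobolevSeminormR s (u + v) ≤ sobolevSeminormR s u + sobolevSeminormR s v := by
  have hw : AEStronglyMeasurable (fun ω : ℝ => ((|ω| ^ s : ℝ) : ℂ)) volume := by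
    have : Measurable (fun ω : ℝ => ((|ω| ^ s : ℝ) : ℂ)) := by fun_prop
    exact this.aestronglyMeasurable
  unfold sobolevSeminormR
  refine le_trans (le_of_eq (eLpNorm_congr_ae ?_))
    (eLpNorm_add_le (hw.mul (aestronglyMeasurable_fourierL2 u))
      (hw.mul (aestronglyMeasurable_fourierL2 v)) (by norm_num))
  filter_upwards [fourierL2_add u v] with ω h
  simp [h, mul_add]

theorem sobolevSeminormR_smul_le (s r : ℝ) (u : Lp ℝ 2 (volume : Measure ℝ)) :
    sobolevSeminormR s (r • u) ≤ ‖r‖ₑ * sobolevSeminormR s u := by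
  unfold sobolevSeminormR
  have h : (fun ω : ℝ => ((|ω| ^ s : ℝ) : ℂ) * fourierL2 (r • u) ω) =ᵐ[volume]
      (r : ℂ) • (fun ω : ℝ => ((|ω| ^ s : ℝ) : ℂ) * fourierL2 u ω) := by
    filter_upwards [fourierL2_smul r u] with ω h
    simp only [h, Pi.smul_apply, smul_eq_mul]
    ring
  rw [eLpNorm_congr_ae h, eLpNorm_const_smul]
  have hr : ‖(r : ℂ)‖ₑ = ‖r‖ₑ := by simp [enorm_eq_nnnorm]
  rw [hr]

theorem sobolevSeminorm_add_le (a b s : ℝ) (u v : L2 a b) :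
    sobolevSeminorm a b s (u + v) ≤ sobolevSeminorm a b s u + sobolevSeminorm a b s v := by
  conv_rhs => unfold sobolevSeminorm
  simp only [ENNReal.iInf_add, ENNReal.add_iInf]
  refine le_iInf fun z => le_iInf fun hz => le_iInf fun w => le_iInf fun hw => ?_
  refine (iInf₂_le (w + z) ?_).trans (sobolevSeminormR_add_le s w z)
  filter_upwards [hw, hz, Lp.coeFn_add u v, ae_restrict_of_ae (Lp.coeFn_add w z)]
    with x h1 h2 h3 h4
  rw [h3, h4, Pi.add_apply, Pi.add_apply, h1, h2]

theorem sobolevSeminorm_smul_le (a b s r : ℝ) (u : L2 a b) :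
    sobolevSeminorm a b s (r • u) ≤ ‖r‖ₑ * sobolevSeminorm a b s u := by
  conv_rhs => unfold sobolevSeminorm
  by_cases hr : r = 0
  · subst hr
    refine (iInf₂_le (0 : Lp ℝ 2 (volume : Measure ℝ)) ?_).trans ?_
    · filter_upwards [Lp.coeFn_zero ℝ 2 ((volume : Measure ℝ).restrict (Ioo a b)),
        ae_restrict_of_ae (Lp.coeFn_zero ℝ 2 (volume : Measure ℝ))] with x h1 h2
      rw [zero_smul, h1, h2]
    · have := sobolevSeminormR_smul_le s 0 0
      simpa using this
  have hr0 : ‖r‖ₑ ≠ 0 := by simpa using hr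
  rw [ENNReal.mul_iInf_of_ne hr0 enorm_ne_top]
  refine le_iInf fun w => ?_
  rw [ENNReal.mul_iInf_of_ne hr0 enorm_ne_top]
  refine le_iInf fun hw => ?_
  refine (iInf₂_le (r • w) ?_).trans (sobolevSeminormR_smul_le s r w)
  filter_upwards [hw, Lp.coeFn_smul r u, ae_restrict_of_ae (Lp.coeFn_smul r w)]
    with x h1 h3 h4
  simp [h1, h3, h4]

theorem sobolevENorm_add_le (a b s : ℝ) (u v : L2 a b) :
    sobolevENorm a b s (u + v) ≤ sobolevENorm a b s u + sobolevENorm a b s v := by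
  have h := ENNReal.Lp_add_le (Finset.univ : Finset (Fin 2)) ![‖u‖ₑ, sobolevSeminorm a b s u]
    ![‖v‖ₑ, sobolevSeminorm a b s v] (p := 2) (by norm_num)
  simp only [Fin.sum_univ_two, Matrix.cons_val_zero, Matrix.cons_val_one, ENNReal.rpow_ofNat] at h
  refine le_trans ?_ h
  unfold sobolevENorm
  gcongr
  · exact enorm_add_le u v
  · exact sobolevSeminorm_add_le a b s u v

theorem sobolevENorm_smul_le (a b s r : ℝ) (u : L2 a b) :
    sobolevENorm a b s (r • u) ≤ ‖r‖ₑ * sobolevENorm a b s u := by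
  unfold sobolevENorm
  have h : ‖r‖ₑ = (‖r‖ₑ ^ 2) ^ (1 / 2 : ℝ) := by
    rw [← ENNReal.rpow_ofNat, ← ENNReal.rpow_mul]
    norm_num
  conv_rhs => rw [h]
  rw [← ENNReal.mul_rpow_of_nonneg _ _ (by norm_num : (0 : ℝ) ≤ 1 / 2), mul_add, ← mul_pow,
    ← mul_pow]
  gcongr
  · rw [enorm_smul]
  · exact sobolevSeminorm_smul_le a b s r u

theorem sobolevENorm_zero (a b s : ℝ) : sobolevENorm a b s 0 = 0 := by
  have := sobolevENorm_smul_le a b s 0 0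
  simpa using this

theorem enorm_le_sobolevENorm (a b s : ℝ) (u : L2 a b) : ‖u‖ₑ ≤ sobolevENorm a b s u := by
  have h : ‖u‖ₑ = (‖u‖ₑ ^ 2) ^ (1 / 2 : ℝ) := by
    rw [← ENNReal.rpow_ofNat, ← ENNReal.rpow_mul]
    norm_num
  unfold sobolevENorm
  conv_lhs => rw [h]
  gcongr
  exact le_self_add

theorem memLp_test (a b : ℝ) (φ : Test a b) :
    MemLp φ 2 ((volume : Measure ℝ).restrict (Ioo a b)) :=
  (φ.continuous.memLp_of_hasCompactSupport φ.hasCompactSupport).mono_measure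
    Measure.restrict_le_self

theorem toL2_add_test (a b : ℝ) (φ ψ : Test a b) :
    toL2 a b (φ + ψ : Test a b) = toL2 a b φ + toL2 a b ψ := by
  unfold toL2
  rw [dif_pos (memLp_test a b _), dif_pos (memLp_test a b _), dif_pos (memLp_test a b _),
    ← MemLp.toLp_add]
  rfl

theorem toL2_smul_test (a b r : ℝ) (φ : Test a b) :
    toL2 a b (r • φ : Test a b) = r • toL2 a b φ := by
  unfold toL2
  rw [dif_pos (memLp_test a b _), dif_pos (memLp_test a b _), ← MemLp.toLp_const_smul]
  rfl

/-- `H₀^s(Ω)`: the closure of `C₀^∞(Ω)` in `H^s(Ω)` with respect to `‖·‖_{H^s(Ω)}`, as a linear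
subspace of `L²(Ω)`. -/
def sobolevZero (a b s : ℝ) : Submodule ℝ (L2 a b) where
  carrier := {u | sobolevENorm a b s u < ∞ ∧
    ∀ ε : ℝ≥0∞, 0 < ε → ∃ φ : Test a b, sobolevENorm a b s (u - toL2 a b φ) < ε}
  zero_mem' := by
    refine ⟨by simp [sobolevENorm_zero], fun ε hε => ⟨0, ?_⟩⟩
    have h : toL2 a b (0 : Test a b) = 0 := by
      simpa using toL2_smul_test a b 0 0
    rw [h, sub_zero, sobolevENorm_zero]
    exact hε
  add_mem' := by
    rintro u v ⟨hu, hu'⟩ ⟨hv, hv'⟩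
    refine ⟨(sobolevENorm_add_le a b s u v).trans_lt (ENNReal.add_lt_top.2 ⟨hu, hv⟩),
      fun ε hε => ?_⟩
    have hε2 : 0 < ε / 2 := ENNReal.half_pos hε.ne'
    obtain ⟨φ, hφ⟩ := hu' _ hε2
    obtain ⟨ψ, hψ⟩ := hv' _ hε2
    refine ⟨φ + ψ, ?_⟩
    rw [toL2_add_test, add_sub_add_comm]
    refine (sobolevENorm_add_le a b s _ _).trans_lt ?_
    calc _ < ε / 2 + ε / 2 := ENNReal.add_lt_add hφ hψ
      _ = ε := ENNReal.add_halves ε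
  smul_mem' := by
    rintro r u ⟨hu, hu'⟩
    refine ⟨(sobolevENorm_smul_le a b s r u).trans_lt (ENNReal.mul_lt_top enorm_lt_top hu),
      fun ε hε => ?_⟩
    have hr : (0 : ℝ≥0∞) < ‖r‖ₑ + 1 := by positivity
    have hr' : ‖r‖ₑ + 1 ≠ ∞ := by simp
    obtain ⟨φ, hφ⟩ := hu' (ε / (‖r‖ₑ + 1)) (ENNReal.div_pos hε.ne' hr')
    refine ⟨r • φ, ?_⟩
    rw [toL2_smul_test, ← smul_sub]
    refine (sobolevENorm_smul_le a b s r _).trans_lt ?_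
    refine lt_of_le_of_lt (mul_le_mul_left (le_self_add : ‖r‖ₑ ≤ ‖r‖ₑ + 1) _) ?_
    rw [mul_comm]
    exact (ENNReal.lt_div_iff_mul_lt (Or.inl hr.ne') (Or.inl hr')).1 hφ

/-- The space `H₀^s(Ω)` as a type of its own, so that it carries the norm `‖·‖_{H^s(Ω)}` and not
the norm of `L²(Ω)`. -/
def HZero (a b s : ℝ) : Type := ↥(sobolevZero a b s)

instance (a b s : ℝ) : AddCommGroup (HZero a b s) := inferInstanceAs (AddCommGroup (sobolevZero a b s))

instance (a b s : ℝ) : Module ℝ (HZero a b s) := inferInstanceAs (Module ℝ (sobolevZero a b s))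

/-- The inclusion `H₀^s(Ω) → L²(Ω)`. -/
def HZero.val {a b s : ℝ} : HZero a b s →ₗ[ℝ] L2 a b := (sobolevZero a b s).subtype

theorem HZero.sobolevENorm_ne_top {a b s : ℝ} (u : HZero a b s) :
    sobolevENorm a b s u.val ≠ ∞ := (show ↥(sobolevZero a b s) from u).2.1.ne

theorem HZero.norm_smul_le_aux {a b s : ℝ} (r : ℝ) (u : HZero a b s) :
    (sobolevENorm a b s (HZero.val (r • u))).toReal ≤ ‖r‖ * (sobolevENorm a b s u.val).toReal := by
  rw [map_smul]
  have h := ENNReal.toReal_mono (ENNReal.mul_ne_top enorm_ne_top u.sobolevENorm_ne_top)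
    (sobolevENorm_smul_le a b s r u.val)
  simpa using h

/-- The norm of `H₀^s(Ω)` is `‖·‖_{H^s(Ω)}`. -/
instance (a b s : ℝ) : NormedAddCommGroup (HZero a b s) :=
  AddGroupNorm.toNormedAddCommGroup
    { toFun := fun u => (sobolevENorm a b s u.val).toReal
      map_zero' := by simp [sobolevENorm_zero]
      add_le' := fun u v => by
        rw [← ENNReal.toReal_add u.sobolevENorm_ne_top v.sobolevENorm_ne_top, map_add]
        exact ENNReal.toReal_mono
          (ENNReal.add_ne_top.2 ⟨u.sobolevENorm_ne_top, v.sobolevENorm_ne_top⟩)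
          (sobolevENorm_add_le a b s _ _)
      neg' := fun u => by
        have h1 := HZero.norm_smul_le_aux (-1) u
        have h2 := HZero.norm_smul_le_aux (-1) (-u)
        simp only [neg_smul, one_smul, neg_neg, norm_neg, norm_one, one_mul] at h1 h2
        exact le_antisymm h1 h2
      eq_zero_of_map_eq_zero' := fun u hu => by
        have h0 : sobolevENorm a b s u.val = 0 :=
          ((ENNReal.toReal_eq_zero_iff _).1 hu).resolve_right u.sobolevENorm_ne_top
        have h1 : ‖u.val‖ₑ = 0 := le_antisymm (h0 ▸ enorm_le_sobolevENorm a b s u.val) zero_le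
        exact Subtype.ext (enorm_eq_zero.1 h1) }

instance (a b s : ℝ) : NormedSpace ℝ (HZero a b s) where
  norm_smul_le r u := HZero.norm_smul_le_aux r u

theorem HZero.norm_def {a b s : ℝ} (u : HZero a b s) :
    ‖u‖ = (sobolevENorm a b s u.val).toReal := rfl

/-- `H^{-s}(Ω)`: the dual space of `H₀^s(Ω)` with the dual norm. -/
abbrev HNeg (a b s : ℝ) : Type := StrongDual ℝ (HZero a b s)

/-! ### Tempered fractional derivatives -/

/-- The left tempered fractional derivative
`e^{-λx} / Γ(n-μ) · dⁿ/dxⁿ ∫_a^x e^{λξ} u(ξ) (x-ξ)^{n-μ-1} dξ`, where `n - 1 ≤ μ < n`. -/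
def leftDeriv (a μ lam : ℝ) (u : ℝ → ℝ) (x : ℝ) : ℝ :=
  let n : ℕ := ⌊μ⌋₊ + 1
  Real.exp (-lam * x) / Real.Gamma (n - μ) *
    iteratedDeriv n
      (fun y => ∫ ξ in a..y, Real.exp (lam * ξ) * u ξ * (y - ξ) ^ ((n : ℝ) - μ - 1)) x

/-- The right tempered fractional derivative
`e^{λx} / Γ(n-μ) · (-1)ⁿ dⁿ/dxⁿ ∫_x^b e^{-λξ} u(ξ) (ξ-x)^{n-μ-1} dξ`, where `n - 1 ≤ μ < n`. -/
def rightDeriv (b μ lam : ℝ) (u : ℝ → ℝ) (x : ℝ) : ℝ :=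
  let n : ℕ := ⌊μ⌋₊ + 1
  Real.exp (lam * x) / Real.Gamma (n - μ) *
    ((-1) ^ n * iteratedDeriv n
      (fun y => ∫ ξ in y..b, Real.exp (-lam * ξ) * u ξ * (ξ - y) ^ ((n : ℝ) - μ - 1)) x)

/-- The filter on `C₀^∞(Ω)` of test functions `φ` with `‖u - φ‖_{H^μ(Ω)} → 0`. -/
def approx (a b μ : ℝ) (u : L2 a b) : Filter (Test a b) :=
  (𝓝 0).comap fun φ : Test a b => sobolevENorm a b μ (u - toL2 a b φ)

/-- The extension by continuity of the left tempered fractional derivative of order `μ` from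
`C₀^∞(Ω)` to an operator `H₀^μ(Ω) → L²(Ω)`: the limit in `L²(Ω)` of the derivatives of test
functions that tend to `u` in `H^μ(Ω)`. -/
def leftOp (a b μ lam : ℝ) (u : L2 a b) : L2 a b :=
  limUnder (approx a b μ u) fun φ => toL2 a b (leftDeriv a μ lam φ)

/-- The extension by continuity of the right tempered fractional derivative of order `μ` from
`C₀^∞(Ω)` to an operator `H₀^μ(Ω) → L²(Ω)`. -/
def rightOp (a b μ lam : ℝ) (u : L2 a b) : L2 a b :=
  limUnder (approx a b μ u) fun φ => toL2 a b (rightDeriv b μ lam φ)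

/-! ### The weak form -/

/-- The product `g u` in `L²(Ω)` of a function `g` that is continuous on `[a, b]` and
`u ∈ L²(Ω)`. -/
def mulL2 {a b : ℝ} (g : ℝ → ℝ) (u : L2 a b) : L2 a b := toL2 a b fun x => g x * u x

/-- The bilinear form of the Galerkin weak formulation of
`-(1-p) ₐD_x^{α,λ} u - p ₓD_b^{α,λ} u + m u' + c u = f`, `u(a) = u(b) = 0`. -/
def galerkinForm {a b : ℝ} (α lam p : ℝ) (m c : ℝ → ℝ) (u v : L2 a b) : ℝ :=
  -(1 - p) * inner ℝ (leftOp a b (α / 2) lam u) (rightOp a b (α / 2) lam v)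
    - p * inner ℝ (rightOp a b (α / 2) lam u) (leftOp a b (α / 2) lam v)
    + (1 - p) * lam ^ α * inner ℝ u v
    + p * lam ^ α * inner ℝ u v
    + α * (1 - 2 * p) * lam ^ (α - 1)
      * inner ℝ (leftOp a b (α / 2) 0 u) (rightOp a b (1 - α / 2) 0 v)
    + inner ℝ (leftOp a b (α / 2) 0 u) (rightOp a b (1 - α / 2) 0 (mulL2 m v))
    + inner ℝ (mulL2 c u) v

end TemperedFractional

end

noncomputable section
namespace TemperedFractional
open MeasureTheory Set Filter Topology
open scoped ENNReal FourierTransform Distributions NNReal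

/-! ### The Gagliardo energy and a Hardy inequality -/

/-! The result is Lax–Milgram on `HZero a b (α / 2)`. The work lies in proving boundedness,
coercivity and completeness for a norm defined by an infimum over extensions, and for operators
defined as limits.

On test functions everything becomes Fourier analysis. The left and right derivatives are the
multipliers `(λ ± 2πiξ)^μ` (`leftDeriv_eq_fourierInv`, `rightDeriv_eq_fourierInv`). The left
derivative vanishes to the left of `a` and the right one to the right of `b`, so their product over
`(a, b)` is an integral over the line. Plancherel then gives `(D_left φ, D_right ψ) = ∫ (λ +
iω)^(μ+ν) φ̂ conj ψ̂`, with `ω = 2πξ` (`inner_leftDeriv_rightDeriv`).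

Coercivity. For `u = v = φ` the weights `1 - p` and `p` add up to one, and the diffusion and `λ^α`
terms together equal `∫ (λ^α - Re (λ + iω)^α) |φ̂|²`. Since `d/dω Re (λ + iω)^α = -α Im (λ +
iω)^(α-1)`, the bracket is nonnegative and dominates a multiple of `|ω|^α` away from `ω = 0`
(`exists_cpow_re_le`). Near `ω = 0` the bounded interval helps: `|φ̂|² ≤ (b - a) ‖φ‖²`, so a narrow
frequency band carries little mass and can be absorbed (`exists_coercive_test`). The first-order
terms have complementary orders, so they become `∫ φ' φ = 0` and `∫ φ' m φ = -½ ∫ m' φ²`; the latter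
together with the reaction term is nonnegative because `c - m'/2 > 0`
(`advection_add_reaction_nonneg`). As `m` is only `C¹`, it is first replaced by smooth functions
close to it in `C¹`.

From test functions to the whole space. The derivatives are bounded by the norm of the zero
extension on the line, whereas the norm of the space is an infimum over all extensions. The two are
comparable on test functions for orders in `[0, 1]` other than `1/2` (`exists_zeroExt_energy_le`).
Strictly between 0 and 1 this is a Hardy inequality for the Gagliardo seminorm, which fails to be
uniform exactly at `1/2`; at order 1 it is a difference quotient argument. The orders needed, `α/2 >
1/2` and `1 - α/2 < 1/2`, avoid the exception. The same comparison, with lower semicontinuity of the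
Fourier seminorm, yields completeness (`HZero.completeSpace`).

The space carries no inner product, so Lax–Milgram is applied on its image under `u ↦ (u, D_left u)`
in `L² × L²`, which is closed by the coercivity estimate itself (`exists_galerkinForm_eq`,
`exists_eq_of_coercive`). -/

theorem lintegral_comp_mul_left_real (g : ℝ → ℝ≥0∞) {t : ℝ} (ht : t ≠ 0) :
    ∫⁻ x, g (t * x) = ENNReal.ofReal |t⁻¹| * ∫⁻ x, g x := by
  have h := lintegral_map_equiv (μ := volume) g (Homeomorph.mulLeft₀ t ht).toMeasurableEquiv
  change ∫⁻ a, g a ∂(Measure.map (t * ·) volume) = ∫⁻ x, g (t * x) at h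
  rw [← h]
  rw [Real.map_volume_mul_left ht, lintegral_smul_measure, smul_eq_mul]

theorem lintegral_comp_neg_real (g : ℝ → ℝ≥0∞) : ∫⁻ x, g (-x) = ∫⁻ x, g x := by
  have := lintegral_comp_mul_left_real g (t := -1) (by norm_num)
  simpa using this

theorem eLpNorm_two_sq {X E : Type*} [MeasurableSpace X] [NormedAddCommGroup E] (f : X → E)
    (ν : Measure X) : eLpNorm f 2 ν ^ 2 = ∫⁻ x, ‖f x‖ₑ ^ 2 ∂ν := by
  have := eLpNorm_nnreal_pow_eq_lintegral (f := f) (μ := ν) (p := 2) (by norm_num)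
  simpa using this

/-- The square of the Gagliardo seminorm of order `μ` on the line. -/
def gagliardo (μ : ℝ) (f : ℝ → ℝ) : ℝ≥0∞ :=
  ∫⁻ x, ∫⁻ y, ENNReal.ofReal (|x - y| ^ (-1 - 2 * μ)) * ‖f x - f y‖ₑ ^ 2

/-- The weight `x ^ (-2μ)` on the half line `x > 0`. -/
def hardyWeight (μ : ℝ) : ℝ → ℝ≥0∞ := (Ioi 0).indicator fun x => ENNReal.ofReal (x ^ (-2 * μ))

theorem measurable_hardyWeight (μ : ℝ) : Measurable (hardyWeight μ) :=
  Measurable.indicator (by fun_prop) measurableSet_Ioi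

theorem hardyWeight_of_pos {μ x : ℝ} (hx : 0 < x) :
    hardyWeight μ x = ENNReal.ofReal (x ^ (-2 * μ)) := indicator_of_mem (by exact hx) _

theorem hardyWeight_of_nonpos {μ x : ℝ} (hx : x ≤ 0) : hardyWeight μ x = 0 :=
  indicator_of_notMem (by simpa using hx) _

theorem hardyWeight_mul {μ t : ℝ} (ht : 0 < t) (x : ℝ) :
    hardyWeight μ (t * x) = ENNReal.ofReal (t ^ (-2 * μ)) * hardyWeight μ x := by
  rcases le_or_gt x 0 with hx | hx
  · rw [hardyWeight_of_nonpos hx, hardyWeight_of_nonpos (mul_nonpos_of_nonneg_of_nonpos ht.le hx),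
      mul_zero]
  · rw [hardyWeight_of_pos hx, hardyWeight_of_pos (mul_pos ht hx), ← ENNReal.ofReal_mul (by positivity),
      Real.mul_rpow ht.le hx.le]

theorem lintegral_hardyWeight_dilate {μ t : ℝ} (ht : 0 < t) (f : ℝ → ℝ) :
    ∫⁻ x, hardyWeight μ x * ‖f (t * x)‖ₑ ^ 2
      = ENNReal.ofReal (t ^ (2 * μ - 1)) * ∫⁻ x, hardyWeight μ x * ‖f x‖ₑ ^ 2 := by
  have h := lintegral_comp_mul_left_real (fun x => hardyWeight μ x * ‖f x‖ₑ ^ 2) ht.ne'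
  simp only [hardyWeight_mul ht, mul_assoc] at h
  rw [lintegral_const_mul' _ _ ENNReal.ofReal_ne_top, abs_of_pos (inv_pos.2 ht)] at h
  calc _ = ENNReal.ofReal (t ^ (2 * μ)) * (ENNReal.ofReal (t ^ (-2 * μ)) *
        ∫⁻ x, hardyWeight μ x * ‖f (t * x)‖ₑ ^ 2) := by
        rw [← mul_assoc, ← ENNReal.ofReal_mul (by positivity), ← Real.rpow_add ht]
        simp
    _ = _ := by
        rw [h, ← mul_assoc, ← ENNReal.ofReal_mul (by positivity), Real.rpow_sub_one ht.ne']
        rfl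

/-- In `L²` with weight `x^(-2μ)` a dilation by `t` multiplies norms by `t^(μ - 1/2)`, so the
reverse triangle inequality bounds `‖f - f(t·)‖` below by `|1 - t^(μ - 1/2)| ‖f‖`. This degenerates
only at `μ = 1/2`. Finiteness of the weighted norm is what permits the subtraction. -/
theorem hardy_dilate {μ t : ℝ} (ht : t ∈ Icc (2 : ℝ) 3) {f : ℝ → ℝ} (hf : Measurable f)
    (hN : ∫⁻ x, hardyWeight μ x * ‖f x‖ₑ ^ 2 ≠ ∞) :
    ENNReal.ofReal ((1 - 2 ^ (μ - 1 / 2 : ℝ)) ^ 2) * ∫⁻ x, hardyWeight μ x * ‖f x‖ₑ ^ 2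
      ≤ ∫⁻ x, hardyWeight μ x * ‖f x - f (t * x)‖ₑ ^ 2 := by
  have ht0 : 0 < t := by linarith [ht.1]
  set ν := (volume : Measure ℝ).withDensity (hardyWeight μ)
  have hν : ∀ g : ℝ → ℝ, Measurable g →
      eLpNorm g 2 ν ^ 2 = ∫⁻ x, hardyWeight μ x * ‖g x‖ₑ ^ 2 := fun g hg => by
    rw [eLpNorm_two_sq, lintegral_withDensity_eq_lintegral_mul _ (measurable_hardyWeight μ)
      (by fun_prop)]
    rfl
  have hft : Measurable fun x => f (t * x) := by fun_prop
  have hd := lintegral_hardyWeight_dilate (μ := μ) ht0 f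
  rw [← hν f hf, ← hν (fun x => f x - f (t * x)) (by fun_prop)]
  rw [← hν f hf, ← hν _ hft] at hd
  rw [← hν f hf] at hN
  have hn : eLpNorm f 2 ν ≠ ∞ := by
    intro h; simp [h] at hN
  have hnt : eLpNorm (fun x => f (t * x)) 2 ν ≠ ∞ := by
    intro h
    rw [h] at hd
    exact ENNReal.mul_ne_top ENNReal.ofReal_ne_top hN (by rw [← hd]; simp)
  have h1 : eLpNorm f 2 ν ≤ eLpNorm (fun x => f x - f (t * x)) 2 ν
      + eLpNorm (fun x => f (t * x)) 2 ν := by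
    have := eLpNorm_add_le (f := fun x => f x - f (t * x)) (g := fun x => f (t * x)) (μ := ν)
      (p := 2) (hf.sub hft).aestronglyMeasurable hft.aestronglyMeasurable (by norm_num)
    refine le_trans (le_of_eq ?_) this
    congr 1
    ext x; simp
  have h2 : eLpNorm (fun x => f (t * x)) 2 ν ≤ eLpNorm f 2 ν +
      eLpNorm (fun x => f x - f (t * x)) 2 ν := by
    have := eLpNorm_sub_le (f := f) (g := fun x => f x - f (t * x)) (μ := ν)
      (p := 2) hf.aestronglyMeasurable (hf.sub hft).aestronglyMeasurable (by norm_num)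
    refine le_trans (le_of_eq ?_) this
    congr 1
    ext x; simp
  by_cases he : eLpNorm (fun x => f x - f (t * x)) 2 ν = ∞
  · simp [he]
  generalize eLpNorm (fun x => f x - f (t * x)) 2 ν = e at *
  generalize eLpNorm (fun x => f (t * x)) 2 ν = n' at *
  generalize eLpNorm f 2 ν = n at *
  lift e to ℝ≥0 using he
  lift n' to ℝ≥0 using hnt
  lift n to ℝ≥0 using hn
  rw [ENNReal.ofReal] at hd ⊢
  norm_cast at h1 h2 hd ⊢
  rw [← NNReal.coe_le_coe] at h1 h2 ⊢
  rw [← NNReal.coe_inj] at hd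
  push_cast at h1 h2 hd ⊢
  rw [Real.coe_toNNReal _ (by positivity)] at hd ⊢
  have hsq : t ^ (2 * μ - 1) = (t ^ (μ - 1 / 2)) ^ 2 := by
    rw [← Real.rpow_natCast, ← Real.rpow_mul ht0.le]; congr 1; push_cast; ring
  rw [hsq, ← mul_pow] at hd
  have hd' : (n' : ℝ) = t ^ (μ - 1 / 2) * n := by
    have := (pow_left_inj₀ (by positivity) (by positivity) (by norm_num)).1 hd
    exact this
  rw [← mul_pow]
  have hn0 : (0 : ℝ) ≤ (n : ℝ) := n.2
  have he0 : (0 : ℝ) ≤ (e : ℝ) := e.2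
  have habs : |(1 - (2 : ℝ) ^ (μ - 1 / 2 : ℝ)) * (n : ℝ)| ≤ |(e : ℝ)| := by
    rw [abs_mul, abs_of_nonneg hn0, abs_of_nonneg he0]
    -- On either side of `1/2`, the number `t^(μ - 1/2)` is at least as far from 1 for `t ≥ 2` as it
    -- is for `t = 2`.
    rcases le_total μ (1 / 2) with hμ | hμ
    · have a1 : t ^ (μ - 1 / 2) ≤ 2 ^ (μ - 1 / 2 : ℝ) :=
        Real.rpow_le_rpow_of_nonpos (by norm_num) ht.1 (by linarith)
      have a2 : (2 : ℝ) ^ (μ - 1 / 2 : ℝ) ≤ 1 :=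
        Real.rpow_le_one_of_one_le_of_nonpos (by norm_num) (by linarith)
      rw [abs_of_nonneg (by linarith)]
      nlinarith
    · have a1 : 2 ^ (μ - 1 / 2 : ℝ) ≤ t ^ (μ - 1 / 2) :=
        Real.rpow_le_rpow (by norm_num) ht.1 (by linarith)
      have a2 : 1 ≤ (2 : ℝ) ^ (μ - 1 / 2 : ℝ) :=
        Real.one_le_rpow (by norm_num) (by linarith)
      rw [abs_of_nonpos (by linarith)]
      nlinarith
  exact sq_le_sq.2 habs

/-- The constant of the fractional Hardy inequality. -/
def hardyConst (μ : ℝ) : ℝ≥0∞ :=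
  (ENNReal.ofReal ((1 - 2 ^ (μ - 1 / 2 : ℝ)) ^ 2))⁻¹ * ENNReal.ofReal (2 ^ (1 + 2 * μ))

theorem hardyConst_ne_top {μ : ℝ} (hμ : μ ≠ 1 / 2) : hardyConst μ ≠ ∞ := by
  refine ENNReal.mul_ne_top (ENNReal.inv_ne_top.2 ?_) ENNReal.ofReal_ne_top
  have h : (1 - 2 ^ (μ - 1 / 2 : ℝ) : ℝ) ≠ 0 := by
    intro h
    have h1 : (2 : ℝ) ^ (μ - 1 / 2 : ℝ) = 1 := by linarith
    have h2 := congrArg Real.log h1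
    rw [Real.log_rpow (by norm_num), Real.log_one, mul_eq_zero] at h2
    rcases h2 with h2 | h2
    · exact hμ (by linarith)
    · exact (Real.log_pos (by norm_num : (1 : ℝ) < 2)).ne' h2
  simpa using h

/-- Average the dilation bound over `t ∈ [2, 3]` and substitute `y = t x`. Then `|x - y|` lies
between `x` and `2x` and `dy = x dt`, so the averaged right-hand side is at most `2^(1+2μ)` times a
part of the Gagliardo integral. -/
theorem hardy {μ : ℝ} (hμ0 : 0 < μ) (hμ : μ ≠ 1 / 2) {f : ℝ → ℝ} (hf : Measurable f)
    (hN : ∫⁻ x, hardyWeight μ x * ‖f x‖ₑ ^ 2 ≠ ∞) :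
    ∫⁻ x, hardyWeight μ x * ‖f x‖ₑ ^ 2 ≤ hardyConst μ * gagliardo μ f := by
  set N := ∫⁻ x, hardyWeight μ x * ‖f x‖ₑ ^ 2
  set c := ENNReal.ofReal ((1 - 2 ^ (μ - 1 / 2 : ℝ)) ^ 2)
  -- Were `c` zero, its inverse would make `hardyConst μ` infinite.
  have hc0 : c ≠ 0 := by
    intro h
    have := hardyConst_ne_top hμ
    unfold hardyConst at this
    change c⁻¹ * _ ≠ _ at this
    rw [h, ENNReal.inv_zero, ENNReal.top_mul (by simp; positivity)] at this
    exact this rfl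
  have hcN : c * N ≤ ENNReal.ofReal (2 ^ (1 + 2 * μ)) * gagliardo μ f := by
    have hw := measurable_hardyWeight μ
    calc c * N = ∫⁻ t in Icc (2 : ℝ) 3, c * N := by
          rw [setLIntegral_const, Real.volume_Icc]; norm_num
      _ ≤ ∫⁻ t in Icc (2 : ℝ) 3, ∫⁻ x, hardyWeight μ x * ‖f x - f (t * x)‖ₑ ^ 2 :=
          setLIntegral_mono' measurableSet_Icc fun t ht => hardy_dilate ht hf hN
      _ = ∫⁻ x, ∫⁻ t in Icc (2 : ℝ) 3, hardyWeight μ x * ‖f x - f (t * x)‖ₑ ^ 2 := by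
          rw [lintegral_lintegral_swap]
          refine Measurable.aemeasurable ?_
          refine (hw.comp measurable_snd).mul ?_
          have h1 : Measurable fun p : ℝ × ℝ => f p.2 := hf.comp measurable_snd
          have h2 : Measurable fun p : ℝ × ℝ => f (p.1 * p.2) :=
            hf.comp (measurable_fst.mul measurable_snd)
          exact ((h1.sub h2).enorm).pow_const 2
      _ ≤ ∫⁻ x, ENNReal.ofReal (2 ^ (1 + 2 * μ)) *
            ∫⁻ y, ENNReal.ofReal (|x - y| ^ (-1 - 2 * μ)) * ‖f x - f y‖ₑ ^ 2 := by
          refine lintegral_mono fun x => ?_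
          rcases le_or_gt x 0 with hx | hx
          · simp [hardyWeight_of_nonpos hx]
          have hg := lintegral_comp_mul_left_real
            (fun y => ENNReal.ofReal (|x - y| ^ (-1 - 2 * μ)) * ‖f x - f y‖ₑ ^ 2) hx.ne'
          have hg' : ∫⁻ y, ENNReal.ofReal (|x - y| ^ (-1 - 2 * μ)) * ‖f x - f y‖ₑ ^ 2
              = ENNReal.ofReal x *
                ∫⁻ t, ENNReal.ofReal (|x - x * t| ^ (-1 - 2 * μ)) * ‖f x - f (x * t)‖ₑ ^ 2 := by
            rw [hg, ← mul_assoc, ← ENNReal.ofReal_mul hx.le, abs_of_pos (inv_pos.2 hx),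
              mul_inv_cancel₀ hx.ne', ENNReal.ofReal_one, one_mul]
          rw [hg', ← mul_assoc, ← ENNReal.ofReal_mul (by positivity),
            ← lintegral_const_mul' _ _ ENNReal.ofReal_ne_top]
          refine le_trans ?_ (setLIntegral_le_lintegral (Icc (2 : ℝ) 3) _)
          refine setLIntegral_mono' measurableSet_Icc fun t ht => ?_
          rw [← mul_assoc, mul_comm t x]
          gcongr
          rw [hardyWeight_of_pos hx, ← ENNReal.ofReal_mul (by positivity)]
          apply ENNReal.ofReal_le_ofReal
          have e1 : |x - x * t| = x * (t - 1) := by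
            rw [abs_of_nonpos (by nlinarith [ht.1])]; ring
          have e2 : (2 * x) ^ (-1 - 2 * μ) ≤ |x - x * t| ^ (-1 - 2 * μ) := by
            rw [e1]
            apply Real.rpow_le_rpow_of_nonpos
            · nlinarith [ht.1]
            · nlinarith [ht.2]
            · linarith
          refine le_trans (le_of_eq ?_) (mul_le_mul_of_nonneg_left e2 (by positivity))
          rw [Real.mul_rpow (by norm_num) hx.le]
          have e3 : (2 : ℝ) ^ (1 + 2 * μ) * 2 ^ (-1 - 2 * μ) = 1 := by
            rw [← Real.rpow_add (by norm_num)]; ring_nf; simp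
          have e4 : x * x ^ (-1 - 2 * μ) = x ^ (-2 * μ) := by
            rw [← Real.rpow_one_add' hx.le (by linarith)]; ring_nf
          rw [← e4]
          linear_combination (-x * x ^ (-1 - 2 * μ)) * e3
      _ = _ := by rw [lintegral_const_mul' _ _ ENNReal.ofReal_ne_top]; rfl
  unfold hardyConst
  change N ≤ c⁻¹ * _ * _
  rw [mul_assoc, ← ENNReal.div_eq_inv_mul, ENNReal.le_div_iff_mul_le (Or.inl hc0)
    (Or.inl ENNReal.ofReal_ne_top), mul_comm]
  exact hcN

/-! ### Symmetries of the Gagliardo seminorm and restriction to half lines -/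

theorem gagliardo_congr_ae {μ : ℝ} {f g : ℝ → ℝ} (h : f =ᵐ[volume] g) :
    gagliardo μ f = gagliardo μ g := by
  unfold gagliardo
  refine lintegral_congr_ae ?_
  filter_upwards [h] with x hx
  refine lintegral_congr_ae ?_
  filter_upwards [h] with y hy
  rw [hx, hy]

theorem gagliardo_comp_add {μ : ℝ} (f : ℝ → ℝ) (a : ℝ) :
    gagliardo μ (fun x => f (x + a)) = gagliardo μ f := by
  unfold gagliardo
  conv_rhs => rw [← lintegral_add_right_eq_self _ a]
  refine lintegral_congr fun x => ?_
  conv_rhs => rw [← lintegral_add_right_eq_self _ a]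
  simp

theorem gagliardo_comp_neg {μ : ℝ} (f : ℝ → ℝ) :
    gagliardo μ (fun x => f (-x)) = gagliardo μ f := by
  unfold gagliardo
  rw [← lintegral_comp_neg_real]
  refine lintegral_congr fun x => ?_
  rw [← lintegral_comp_neg_real]
  refine lintegral_congr fun y => ?_
  simp only [neg_neg, neg_sub_neg, abs_sub_comm]

/-- This tail integral is the source of the Hardy weight: it is the cost, per unit of `f(x)²`, of
cutting `f` off on the negative half line. -/
theorem lintegral_Iic_kernel {μ x : ℝ} (hμ : 0 < μ) (hx : 0 < x) :
    ∫⁻ y in Iic 0, ENNReal.ofReal (|x - y| ^ (-1 - 2 * μ))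
      = ENNReal.ofReal ((2 * μ)⁻¹) * hardyWeight μ x := by
  have h1 : ∫⁻ y in Iic 0, ENNReal.ofReal (|x - y| ^ (-1 - 2 * μ))
      = ∫⁻ u in Ici x, ENNReal.ofReal (u ^ (-1 - 2 * μ)) := by
    rw [← lintegral_indicator measurableSet_Iic, ← lintegral_indicator measurableSet_Ici,
      ← lintegral_sub_left_eq_self _ x]
    refine lintegral_congr fun u => ?_
    by_cases hu : x ≤ u
    · rw [indicator_of_mem (by simpa using hu), indicator_of_mem (by exact hu), sub_sub_cancel,
        abs_of_pos (hx.trans_le hu)]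
    · rw [indicator_of_notMem (by simpa using hu), indicator_of_notMem (by exact hu)]
  rw [h1, setLIntegral_congr Ioi_ae_eq_Ici.symm, hardyWeight_of_pos hx,
    ← ENNReal.ofReal_mul (by positivity), ← ofReal_integral_eq_lintegral_ofReal
      (integrableOn_Ioi_rpow_of_lt (by linarith) hx)
      ((ae_restrict_mem measurableSet_Ioi).mono fun u hu =>
        Real.rpow_nonneg (hx.trans hu).le _),
    integral_Ioi_rpow_of_lt (by linarith) hx]
  congr 1
  have : -1 - 2 * μ + 1 = -(2 * μ) := by ring
  rw [this, neg_div_neg_eq]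
  ring_nf

/-- The constant in the bound for restriction to a half line. -/
def cutConst (μ : ℝ) : ℝ≥0∞ := 1 + 2 * (ENNReal.ofReal ((2 * μ)⁻¹) * hardyConst μ)

theorem cutConst_ne_top {μ : ℝ} (hμ : μ ≠ 1 / 2) : cutConst μ ≠ ∞ :=
  ENNReal.add_ne_top.2 ⟨by simp, ENNReal.mul_ne_top (by simp)
    (ENNReal.mul_ne_top ENNReal.ofReal_ne_top (hardyConst_ne_top hμ))⟩

theorem lintegral_lintegral_add_symm {F G : ℝ → ℝ → ℝ≥0∞} (hF : Measurable (Function.uncurry F))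
    (hG : Measurable (Function.uncurry G)) :
    ∫⁻ x, ∫⁻ y, (F x y + (G x y + G y x)) = (∫⁻ x, ∫⁻ y, F x y) + 2 * ∫⁻ x, ∫⁻ y, G x y := by
  have hG2 : Measurable (Function.uncurry fun x y => G y x) := hG.comp measurable_swap
  have i1 : ∀ x, ∫⁻ y, (F x y + (G x y + G y x))
      = (∫⁻ y, F x y) + ((∫⁻ y, G x y) + ∫⁻ y, G y x) := fun x => by
    rw [lintegral_add_left hF.of_uncurry_left, lintegral_add_left hG.of_uncurry_left]
  simp only [i1]
  rw [lintegral_add_left hF.lintegral_prod_right, lintegral_add_left hG.lintegral_prod_right,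
    lintegral_lintegral_swap (f := fun x y => G y x) hG2.aemeasurable, two_mul]

/-- Cutting at 0 alters the double integral only for pairs on opposite sides of 0. Each of the two
cross terms is at most the weighted norm of `f` divided by `2μ`, which Hardy's inequality returns to
the seminorm of `f`. Vanishing on `(0, ε)` serves only to make the weighted norm finite; `ε` does
not enter the constant. -/
theorem gagliardo_indicator_Ioi_zero_le {μ : ℝ} (hμ0 : 0 < μ) (hμ : μ ≠ 1 / 2) {f : ℝ → ℝ}
    (hf : Measurable f) (hf2 : ∫⁻ x, ‖f x‖ₑ ^ 2 ≠ ∞) {ε : ℝ} (hε : 0 < ε)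
    (hfε : ∀ x ∈ Ioo 0 ε, f x = 0) :
    gagliardo μ ((Ioi 0).indicator f) ≤ cutConst μ * gagliardo μ f := by
  set k : ℝ → ℝ → ℝ≥0∞ := fun x y => ENNReal.ofReal (|x - y| ^ (-1 - 2 * μ)) with hk
  have hkm : Measurable (Function.uncurry k) := by
    apply ENNReal.measurable_ofReal.comp
    exact (((measurable_fst.sub measurable_snd).abs).pow_const _)
  have hksymm : ∀ x y, k x y = k y x := fun x y => by simp [hk, abs_sub_comm]
  set N := ∫⁻ x, hardyWeight μ x * ‖f x‖ₑ ^ 2 with hN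
  have hNtop : N ≠ ∞ := by
    have : N ≤ ∫⁻ x, ENNReal.ofReal (ε ^ (-2 * μ)) * ‖f x‖ₑ ^ 2 := by
      refine lintegral_mono fun x => ?_
      rcases le_or_gt x 0 with hx | hx
      · simp [hardyWeight_of_nonpos hx]
      rcases lt_or_ge x ε with hxε | hxε
      · simp [hfε x ⟨hx, hxε⟩]
      rw [hardyWeight_of_pos hx]
      gcongr ENNReal.ofReal ?_ * _
      exact Real.rpow_le_rpow_of_nonpos hε hxε (by linarith)
    refine ne_top_of_le_ne_top ?_ this
    rw [lintegral_const_mul' _ _ ENNReal.ofReal_ne_top]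
    exact ENNReal.mul_ne_top ENNReal.ofReal_ne_top hf2
  set g : ℝ → ℝ → ℝ≥0∞ := fun x y =>
    (Ioi (0 : ℝ)).indicator (fun x => (Iic (0 : ℝ)).indicator (fun y => k x y) y * ‖f x‖ₑ ^ 2) x
    with hg
  have hgm : Measurable (Function.uncurry g) := by
    have h1 : Function.uncurry g = (Prod.fst ⁻¹' Ioi (0 : ℝ)).indicator
        (fun p => (Prod.snd ⁻¹' Iic (0 : ℝ)).indicator (Function.uncurry k) p * ‖f p.1‖ₑ ^ 2) := by
      ext ⟨x, y⟩
      simp only [Function.uncurry, hg, indicator, mem_preimage]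
    rw [h1]
    refine Measurable.indicator ?_ (measurable_fst measurableSet_Ioi)
    refine (hkm.indicator (measurable_snd measurableSet_Iic)).mul ?_
    exact ((hf.comp measurable_fst).enorm).pow_const 2
  have hgint : ∫⁻ x, ∫⁻ y, g x y = ENNReal.ofReal ((2 * μ)⁻¹) * N := by
    rw [hN, ← lintegral_const_mul' _ _ ENNReal.ofReal_ne_top]
    refine lintegral_congr fun x => ?_
    rcases le_or_gt x 0 with hx | hx
    · simp [hg, hardyWeight_of_nonpos hx, hx]
    · simp only [hg, indicator_of_mem (show x ∈ Ioi (0 : ℝ) from hx)]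
      rw [lintegral_mul_const' _ _ (by simp), lintegral_indicator measurableSet_Iic,
        lintegral_Iic_kernel hμ0 hx, mul_assoc]
  -- `g x y` is the cross term with `x > 0 ≥ y`; `g y x` covers the opposite configuration.
  have hle : ∀ x y, k x y * ‖(Ioi 0).indicator f x - (Ioi 0).indicator f y‖ₑ ^ 2
      ≤ k x y * ‖f x - f y‖ₑ ^ 2 + (g x y + g y x) := by
    intro x y
    rcases le_or_gt x 0 with hx | hx <;> rcases le_or_gt y 0 with hy | hy
    · simp [indicator_of_notMem (show x ∉ Ioi (0 : ℝ) by simpa using hx),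
        indicator_of_notMem (show y ∉ Ioi (0 : ℝ) by simpa using hy)]
    · refine le_add_left (le_add_left ?_)
      simp [hg, hy, hx, hksymm x y]
    · refine le_add_left (le_add_right ?_)
      simp [hg, hy, hx]
    · refine le_add_right ?_
      simp [hy, hx]
  have hkf : Measurable (Function.uncurry fun x y => k x y * ‖f x - f y‖ₑ ^ 2) :=
    hkm.mul ((((hf.comp measurable_fst).sub (hf.comp measurable_snd)).enorm).pow_const 2)
  calc gagliardo μ ((Ioi 0).indicator f)
      ≤ ∫⁻ x, ∫⁻ y, (k x y * ‖f x - f y‖ₑ ^ 2 + (g x y + g y x)) :=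
        lintegral_mono fun x => lintegral_mono fun y => hle x y
    _ = gagliardo μ f + 2 * (ENNReal.ofReal ((2 * μ)⁻¹) * N) := by
        rw [← hgint]
        exact lintegral_lintegral_add_symm hkf hgm
    _ ≤ gagliardo μ f + 2 * (ENNReal.ofReal ((2 * μ)⁻¹) * (hardyConst μ * gagliardo μ f)) := by
        gcongr
        exact hardy hμ0 hμ hf hNtop
    _ = cutConst μ * gagliardo μ f := by
        unfold cutConst
        ring

theorem gagliardo_indicator_Ioi_le {μ : ℝ} (hμ0 : 0 < μ) (hμ : μ ≠ 1 / 2) {f : ℝ → ℝ}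
    (hf : Measurable f) (hf2 : ∫⁻ x, ‖f x‖ₑ ^ 2 ≠ ∞) {a d : ℝ} (had : a < d)
    (hfd : ∀ x ∈ Ioo a d, f x = 0) :
    gagliardo μ ((Ioi a).indicator f) ≤ cutConst μ * gagliardo μ f := by
  have h := gagliardo_indicator_Ioi_zero_le hμ0 hμ (f := fun x => f (x + a)) (ε := d - a)
    (by fun_prop) (by rwa [lintegral_add_right_eq_self (fun x => ‖f x‖ₑ ^ 2)]) (by linarith)
    (fun x hx => hfd _ ⟨by linarith [hx.1], by linarith [hx.2]⟩)
  rw [gagliardo_comp_add] at h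
  refine le_trans (le_of_eq ?_) h
  rw [← gagliardo_comp_add _ a]
  congr 1
  ext x
  simp [indicator]

theorem gagliardo_indicator_Iio_le {μ : ℝ} (hμ0 : 0 < μ) (hμ : μ ≠ 1 / 2) {f : ℝ → ℝ}
    (hf : Measurable f) (hf2 : ∫⁻ x, ‖f x‖ₑ ^ 2 ≠ ∞) {b d : ℝ} (hdb : d < b)
    (hfd : ∀ x ∈ Ioo d b, f x = 0) :
    gagliardo μ ((Iio b).indicator f) ≤ cutConst μ * gagliardo μ f := by
  have h := gagliardo_indicator_Ioi_le hμ0 hμ (f := fun x => f (-x)) (a := -b) (d := -d)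
    (by fun_prop) (by rwa [lintegral_comp_neg_real (fun x => ‖f x‖ₑ ^ 2)]) (by linarith)
    (fun x hx => hfd _ ⟨by linarith [hx.2], by linarith [hx.1]⟩)
  rw [gagliardo_comp_neg] at h
  refine le_trans (le_of_eq ?_) h
  rw [← gagliardo_comp_neg]
  congr 1
  ext x
  simp [indicator, neg_lt]

/-- Extension by zero of a function vanishing near the end points of `(a, b)` is bounded by any
other square integrable extension in the Gagliardo seminorm of order `μ ≠ 1/2`. -/
theorem gagliardo_le_of_eq_on {μ : ℝ} (hμ0 : 0 < μ) (hμ : μ ≠ 1 / 2) {f w : ℝ → ℝ} {a b : ℝ}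
    (hw : Measurable w) (hw2 : ∫⁻ x, ‖w x‖ₑ ^ 2 ≠ ∞) (hfw : ∀ x ∈ Ioo a b, w x = f x)
    {a' b' : ℝ} (ha : a < a') (hab' : a' ≤ b') (hb : b' < b)
    (hf : ∀ x, x ∉ Icc a' b' → f x = 0) :
    gagliardo μ f ≤ cutConst μ * (cutConst μ * gagliardo μ w) := by
  -- `w` is cut first at `a`, where it vanishes on `(a, a')`, and then at `b`, where it vanishes on
  -- `(b', b)`; each cut costs one factor `cutConst μ`.
  have h1 := gagliardo_indicator_Ioi_le hμ0 hμ hw hw2 ha fun x hx => by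
    rw [hfw x ⟨hx.1, by linarith [hx.2]⟩]
    exact hf x fun h => by linarith [h.1, hx.2]
  have hi : ∫⁻ x, ‖(Ioi a).indicator w x‖ₑ ^ 2 ≠ ∞ := by
    refine ne_top_of_le_ne_top hw2 (lintegral_mono fun x => ?_)
    by_cases hx : x ∈ Ioi a <;> simp [indicator, hx]
  have h2 := gagliardo_indicator_Iio_le hμ0 hμ (hw.indicator measurableSet_Ioi) hi hb fun x hx => by
    rw [indicator_of_mem (show x ∈ Ioi a by simp; linarith [hx.1]),
      hfw x ⟨by linarith [hx.1], hx.2⟩]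
    exact hf x fun h => by linarith [h.2, hx.1]
  have h3 : (Iio b).indicator ((Ioi a).indicator w) = f := by
    ext x
    by_cases hxa : a < x <;> by_cases hxb : x < b
    · simp [indicator, hxa, hxb, hfw x ⟨hxa, hxb⟩]
    · simp [indicator, hxb, hf x fun h => hxb (by linarith [h.2])]
    · simp [indicator, hxa, hxb, hf x fun h => hxa (by linarith [h.1])]
    · simp [indicator, hxb, hf x fun h => hxa (by linarith [h.1])]
  rw [h3] at h2
  exact h2.trans (by gcongr)

end TemperedFractional
end

noncomputable section
namespace TemperedFractional
open MeasureTheory Set Filter Topology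
open scoped ENNReal FourierTransform Distributions NNReal SchwartzMap ContDiff

/-! ### The Fourier transform on `L²(ℝ)` -/

theorem enorm_complex_ofReal (r : ℝ) : ‖(r : ℂ)‖ₑ = ‖r‖ₑ := by simp [enorm_eq_nnnorm]

/-- The complex space `L²(ℝ; ℂ)`. -/
abbrev L2C : Type := Lp ℂ 2 (volume : Measure ℝ)

/-- The `L²` transform is compatible with the distributional one, so it can be computed by moving
the transform onto a Schwartz function. The identities for it below are proved in this weak form. -/
theorem integral_fourier_mul_L2 (v : L2C) (θ : 𝓢(ℝ, ℂ)) :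
    ∫ x, 𝓕 (θ : ℝ → ℂ) x * v x = ∫ x, θ x * (𝓕 v : L2C) x := by
  have h := DFunLike.congr_fun (Lp.fourier_toTemperedDistribution_eq v) θ
  rw [TemperedDistribution.fourier_apply, Lp.toTemperedDistribution_apply,
    Lp.toTemperedDistribution_apply] at h
  simpa [SchwartzMap.fourier_coe] using h

theorem integral_fourierInv_mul_L2 (v : L2C) (θ : 𝓢(ℝ, ℂ)) :
    ∫ x, 𝓕⁻ (θ : ℝ → ℂ) x * v x = ∫ x, θ x * (𝓕⁻ v : L2C) x := by
  have h := DFunLike.congr_fun (Lp.fourierInv_toTemperedDistribution_eq v) θ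
  rw [TemperedDistribution.fourierInv_apply, Lp.toTemperedDistribution_apply,
    Lp.toTemperedDistribution_apply] at h
  simpa [SchwartzMap.fourierInv_coe] using h

theorem locallyIntegrable_L2 (v : L2C) : LocallyIntegrable v volume :=
  (Lp.memLp v).locallyIntegrable (by norm_num)

/-- The Schwartz function given by a complex valued smooth function with compact support. -/
def schwartzOf (g : ℝ → ℂ) (hg : ContDiff ℝ ∞ g) (hc : HasCompactSupport g) : 𝓢(ℝ, ℂ) :=
  hc.toSchwartzMap hg

theorem schwartzOf_apply (g : ℝ → ℂ) (hg : ContDiff ℝ ∞ g) (hc : HasCompactSupport g) (x : ℝ) :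
    schwartzOf g hg hc x = g x := rfl

theorem ae_eq_of_integral_schwartz_mul {f g : ℝ → ℂ} (hf : LocallyIntegrable f volume)
    (hg : LocallyIntegrable g volume)
    (h : ∀ θ : ℝ → ℂ, ContDiff ℝ ∞ θ → HasCompactSupport θ →
      ∫ x, θ x * f x = ∫ x, θ x * g x) : f =ᵐ[volume] g := by
  refine ae_eq_of_integral_contDiff_smul_eq hf hg fun θ hθ hθc => ?_
  have := h (fun x => (θ x : ℂ)) (Complex.ofRealCLM.contDiff.comp hθ)
    (hθc.comp_left (g := Complex.ofReal) rfl)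
  simpa using this

theorem integral_fourier_mul_eq_flip {f g : ℝ → ℂ} (hf : Integrable f) (hg : Integrable g) :
    ∫ x, 𝓕 f x * g x = ∫ x, f x * 𝓕 g x := by
  have := VectorFourier.integral_fourierIntegral_smul_eq_flip (L := innerₗ ℝ) (μ := volume)
    (ν := volume) Real.continuous_fourierChar continuous_inner hf hg
  simpa [Real.fourier_eq, VectorFourier.fourierIntegral, real_inner_comm] using! this

/-- On `L¹ ∩ L²` the transform by isometric extension and the transform by an absolutely convergent
integral have equal pairings with every smooth compactly supported function. -/
theorem fourierInv_toLp_ae_eq {F : ℝ → ℂ} (h1 : Integrable F) (h2 : MemLp F 2) :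
    (𝓕⁻ (h2.toLp F) : L2C) =ᵐ[volume] 𝓕⁻ F := by
  have hcont : Continuous (𝓕⁻ F) := by
    rw [Real.fourierInv_eq_fourier_comp_neg]
    exact VectorFourier.fourierIntegral_continuous Real.continuous_fourierChar continuous_inner
      h1.comp_neg
  refine ae_eq_of_integral_schwartz_mul (locallyIntegrable_L2 _) hcont.locallyIntegrable
    fun θ hθ hc => ?_
  have h := integral_fourierInv_mul_L2 (h2.toLp F) (schwartzOf θ hθ hc)
  have e1 : ∫ x, θ x * (𝓕⁻ (h2.toLp F) : L2C) x = ∫ x, 𝓕⁻ θ x * F x := by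
    refine h.symm.trans (integral_congr_ae ?_)
    filter_upwards [h2.coeFn_toLp] with x hx
    rw [hx]; rfl
  rw [e1, Real.fourierInv_eq_fourier_comp_neg, Real.fourierInv_eq_fourier_comp_neg]
  have hθi := hθ.continuous.integrable_of_hasCompactSupport (μ := volume) hc
  rw [integral_fourier_mul_eq_flip hθi.comp_neg h1, ← integral_neg_eq_self]
  refine integral_congr_ae (.of_forall fun x => ?_)
  simp only [neg_neg]
  rw [← Real.fourierInv_eq_fourier_neg, Real.fourierInv_eq_fourier_comp_neg]

/-! ### Translations and the Fourier form of the Gagliardo seminorm -/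

/-- Translation on `L²(ℝ; ℂ)`. -/
def translateC (h : ℝ) (v : L2C) : L2C :=
  Lp.compMeasurePreserving (fun x => x + h) (measurePreserving_add_right volume h) v

theorem translateC_ae_eq (h : ℝ) (v : L2C) : translateC h v =ᵐ[volume] fun x => v (x + h) :=
  Lp.coeFn_compMeasurePreserving _ _

/-- Weakly: the transform of `θ` shifted by `h` is the transform of `θ` times a character. The
character is smooth, so the product is again an admissible test function. -/
theorem fourier_translateC (h : ℝ) (v : L2C) : (𝓕 (translateC h v) : L2C) =ᵐ[volume]
    fun ξ => Complex.exp ((2 * Real.pi * (h * ξ) : ℝ) * Complex.I) * (𝓕 v : L2C) ξ := by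
  have he : Continuous fun ξ : ℝ => Complex.exp ((2 * Real.pi * (h * ξ) : ℝ) * Complex.I) := by
    fun_prop
  refine ae_eq_of_integral_schwartz_mul (locallyIntegrable_L2 _) ?_ fun θ hθ hc => ?_
  · refine MemLp.locallyIntegrable (p := 2) (MemLp.of_le (Lp.memLp (𝓕 v : L2C))
      (he.aestronglyMeasurable.mul (Lp.aestronglyMeasurable _)) (.of_forall fun ξ => ?_))
      (by norm_num)
    rw [norm_mul, Complex.norm_exp_ofReal_mul_I, one_mul]
  have hθ' : ContDiff ℝ ∞ fun ξ : ℝ =>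
      Complex.exp ((2 * Real.pi * (h * ξ) : ℝ) * Complex.I) * θ ξ := by
    refine ContDiff.mul ?_ hθ
    refine ContDiff.cexp ?_
    exact ((Complex.ofRealCLM.contDiff.comp
      (contDiff_const.mul (contDiff_const.mul contDiff_id))).mul contDiff_const)
  have hc' : HasCompactSupport fun ξ : ℝ =>
      Complex.exp ((2 * Real.pi * (h * ξ) : ℝ) * Complex.I) * θ ξ := hc.mul_left
  have h1 := integral_fourier_mul_L2 (translateC h v) (schwartzOf θ hθ hc)
  have h2 := integral_fourier_mul_L2 v (schwartzOf _ hθ' hc')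
  simp only [schwartzOf_apply] at h1 h2
  rw [← h1]
  calc _ = ∫ x, 𝓕 (schwartzOf θ hθ hc : ℝ → ℂ) x * v (x + h) := by
        refine integral_congr_ae ?_
        filter_upwards [translateC_ae_eq h v] with x hx
        rw [hx]
    _ = ∫ x, 𝓕 (schwartzOf θ hθ hc : ℝ → ℂ) (x - h) * v x := by
        conv_rhs => rw [← integral_add_right_eq_self _ h]
        simp
    _ = ∫ x, 𝓕 (schwartzOf _ hθ' hc' : ℝ → ℂ) x * v x := by
        congr 1; ext x; congr 1
        rw [Real.fourier_real_eq_integral_exp_smul, Real.fourier_real_eq_integral_exp_smul]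
        congr 1; ext y
        simp only [schwartzOf_apply, smul_eq_mul]
        rw [← mul_assoc, ← Complex.exp_add]
        congr 2; push_cast; ring
    _ = _ := by
        rw [h2]; congr 1; ext x; ring

/-- The Fourier transform of a real function in `L²(ℝ)`, with the kernel `e^{-2πiξx}`. -/
def cF (w : Lp ℝ 2 (volume : Measure ℝ)) : L2C := 𝓕 (Complex.ofRealCLM.compLp w : L2C)

/-- Plancherel for `w(· + h) - w`, whose transform is the transform of `w` times `e^(2πihξ) - 1`.
Both the Gagliardo identity and the difference quotient argument at order 1 rest on it. -/
theorem lintegral_translate_sub (w : Lp ℝ 2 (volume : Measure ℝ)) (h : ℝ) :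
    ∫⁻ x, ‖w (x + h) - w x‖ₑ ^ 2 = ∫⁻ ξ,
      ‖Complex.exp ((2 * Real.pi * (h * ξ) : ℝ) * Complex.I) - 1‖ₑ ^ 2 * ‖cF w ξ‖ₑ ^ 2 := by
  set v : L2C := Complex.ofRealCLM.compLp w
  have hv : v =ᵐ[volume] fun x => (w x : ℂ) := Complex.ofRealCLM.coeFn_compLp w
  have hvh : ∀ᵐ x, v (x + h) = w (x + h) :=
    (measurePreserving_add_right volume h).quasiMeasurePreserving.ae hv
  have e1 : ∫⁻ x, ‖w (x + h) - w x‖ₑ ^ 2 = ‖translateC h v - v‖ₑ ^ 2 := by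
    rw [Lp.enorm_def, eLpNorm_two_sq]
    refine lintegral_congr_ae ?_
    filter_upwards [hv, hvh, translateC_ae_eq h v, Lp.coeFn_sub (translateC h v) v] with x a1 a2 a3 a4
    rw [a4, Pi.sub_apply, a3, a1, a2, ← Complex.ofReal_sub, enorm_complex_ofReal]
  have e2 : ‖translateC h v - v‖ₑ = ‖(𝓕 (translateC h v) - 𝓕 v : L2C)‖ₑ := by
    have : (𝓕 (translateC h v) - 𝓕 v : L2C) = 𝓕 (translateC h v - v) :=
      ((Lp.fourierTransformₗᵢ ℝ ℂ).map_sub _ _).symm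
    rw [this, ← ofReal_norm, ← ofReal_norm, Lp.norm_fourier_eq]
  rw [e1, e2, Lp.enorm_def, eLpNorm_two_sq]
  refine lintegral_congr_ae ?_
  filter_upwards [fourier_translateC h v, Lp.coeFn_sub (𝓕 (translateC h v) : L2C) (𝓕 v : L2C)]
    with ξ a1 a2
  rw [a2, Pi.sub_apply, a1, ← mul_pow, ← enorm_mul, sub_mul, one_mul]
  rfl

/-- The Fourier energy `∫ |2πξ|^{2s} |ŵ(ξ)|² dξ`. -/
def energy (s : ℝ) (w : Lp ℝ 2 (volume : Measure ℝ)) : ℝ≥0∞ :=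
  ∫⁻ ξ, ENNReal.ofReal (|2 * Real.pi * ξ| ^ (2 * s)) * ‖cF w ξ‖ₑ ^ 2

/-- The factor `2π` is the Jacobian of `ω = 2πξ`, which connects the two normalisations of the
transform. -/
theorem sobolevSeminormR_sq (s : ℝ) (w : Lp ℝ 2 (volume : Measure ℝ)) :
    sobolevSeminormR s w ^ 2 = ENNReal.ofReal (2 * Real.pi) * energy s w := by
  have hpi : (0 : ℝ) < 2 * Real.pi := by positivity
  unfold sobolevSeminormR energy
  rw [eLpNorm_two_sq]
  have h := lintegral_comp_mul_left_real (fun x => ‖((|x| ^ s : ℝ) : ℂ) * fourierL2 w x‖ₑ ^ 2)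
    hpi.ne'
  have h' : ∫⁻ x, ‖((|x| ^ s : ℝ) : ℂ) * fourierL2 w x‖ₑ ^ 2 = ENNReal.ofReal (2 * Real.pi) *
      ∫⁻ ξ, ‖((|2 * Real.pi * ξ| ^ s : ℝ) : ℂ) * fourierL2 w (2 * Real.pi * ξ)‖ₑ ^ 2 := by
    rw [h, ← mul_assoc, ← ENNReal.ofReal_mul hpi.le, abs_of_pos (inv_pos.2 hpi),
      mul_inv_cancel₀ hpi.ne', ENNReal.ofReal_one, one_mul]
  rw [h']
  congr 1
  refine lintegral_congr fun ξ => ?_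
  have e : fourierL2 w (2 * Real.pi * ξ) = cF w ξ := by
    unfold fourierL2 cF
    rw [mul_div_cancel_left₀ _ hpi.ne']
  rw [e, enorm_mul, mul_pow]
  congr 1
  rw [← ofReal_norm, ← ENNReal.ofReal_pow (norm_nonneg _), Complex.norm_real, Real.norm_eq_abs,
    sq_abs, ← Real.rpow_natCast, ← Real.rpow_mul (abs_nonneg _)]
  congr 2
  push_cast; ring

/-- The constant relating the Gagliardo energy to the Fourier energy. -/
def gagliardoConst (μ : ℝ) : ℝ≥0∞ :=
  ∫⁻ h, ENNReal.ofReal (|h| ^ (-1 - 2 * μ)) * ‖Complex.exp ((h : ℝ) * Complex.I) - 1‖ₑ ^ 2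

/-- Put `y = x + h`, apply Plancherel in `x` for fixed `h`, and exchange the integrals. For `ξ ≠ 0`,
rescaling `h` by `2πξ` leaves a fixed integral times `|2πξ|^(2μ)`. The identity holds in extended
reals; it becomes informative once the constant is known to be finite and nonzero. -/
theorem gagliardo_eq_energy {μ : ℝ} (w : Lp ℝ 2 (volume : Measure ℝ)) :
    gagliardo μ w = gagliardoConst μ * energy μ w := by
  have hwm : Measurable w := (Lp.stronglyMeasurable w).measurable
  have hcm : Measurable (cF w) := (Lp.stronglyMeasurable (cF w)).measurable
  have s1 : gagliardo μ w
      = ∫⁻ h, ENNReal.ofReal (|h| ^ (-1 - 2 * μ)) * ∫⁻ x, ‖w (x + h) - w x‖ₑ ^ 2 := by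
    unfold gagliardo
    have : ∀ x, ∫⁻ y, ENNReal.ofReal (|x - y| ^ (-1 - 2 * μ)) * ‖w x - w y‖ₑ ^ 2
        = ∫⁻ h, ENNReal.ofReal (|h| ^ (-1 - 2 * μ)) * ‖w (x + h) - w x‖ₑ ^ 2 := fun x => by
      rw [← lintegral_add_left_eq_self _ x]
      refine lintegral_congr fun h => ?_
      rw [enorm_sub_rev, sub_add_cancel_left, abs_neg]
    simp only [this]
    rw [lintegral_lintegral_swap]
    · simp_rw [lintegral_const_mul' _ _ ENNReal.ofReal_ne_top]
    · refine Measurable.aemeasurable ?_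
      have m1 : Measurable fun p : ℝ × ℝ => ENNReal.ofReal (|p.2| ^ (-1 - 2 * μ)) := by fun_prop
      have m2 : Measurable fun p : ℝ × ℝ => ‖w (p.1 + p.2) - w p.1‖ₑ ^ 2 :=
        (((hwm.comp (measurable_fst.add measurable_snd)).sub
          (hwm.comp measurable_fst)).enorm).pow_const 2
      exact m1.mul m2
  rw [s1]
  simp only [lintegral_translate_sub]
  simp_rw [← lintegral_const_mul' _ _ ENNReal.ofReal_ne_top]
  rw [lintegral_lintegral_swap]
  swap
  · refine Measurable.aemeasurable ?_
    have : Measurable fun p : ℝ × ℝ => ‖cF w p.2‖ₑ ^ 2 := ((hcm.comp measurable_snd).enorm).pow_const 2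
    have m1 : Measurable fun p : ℝ × ℝ => ENNReal.ofReal (|p.1| ^ (-1 - 2 * μ)) := by fun_prop
    have m2 : Measurable fun p : ℝ × ℝ =>
        ‖Complex.exp ((2 * Real.pi * (p.1 * p.2) : ℝ) * Complex.I) - 1‖ₑ ^ 2 := by fun_prop
    exact m1.mul (m2.mul this)
  unfold energy
  have m3 : Measurable fun ξ : ℝ => ENNReal.ofReal (|2 * Real.pi * ξ| ^ (2 * μ)) * ‖cF w ξ‖ₑ ^ 2 :=
    Measurable.mul (by fun_prop) (hcm.enorm.pow_const 2)
  rw [← lintegral_const_mul _ m3]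
  refine lintegral_congr_ae ?_
  filter_upwards [compl_mem_ae_iff.2 (measure_singleton (0 : ℝ))] with ξ hξ
  have hξ0 : ξ ≠ 0 := hξ
  simp_rw [← mul_assoc]
  rw [lintegral_mul_const' _ _ (by simp)]
  congr 1
  have ht : 2 * Real.pi * ξ ≠ 0 := by positivity
  have hs := lintegral_comp_mul_left_real (fun h : ℝ => ENNReal.ofReal (|h| ^ (-1 - 2 * μ)) *
    ‖Complex.exp ((h : ℝ) * Complex.I) - 1‖ₑ ^ 2) ht
  have ht' : 0 < |2 * Real.pi * ξ| := abs_pos.2 ht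
  have e1 : ∀ h : ℝ, ENNReal.ofReal (|h| ^ (-1 - 2 * μ)) *
      ‖Complex.exp ((2 * Real.pi * h * ξ : ℝ) * Complex.I) - 1‖ₑ ^ 2
      = ENNReal.ofReal (|2 * Real.pi * ξ| ^ (1 + 2 * μ)) *
        (ENNReal.ofReal (|2 * Real.pi * ξ * h| ^ (-1 - 2 * μ)) *
        ‖Complex.exp ((2 * Real.pi * ξ * h : ℝ) * Complex.I) - 1‖ₑ ^ 2) := fun h => by
    rw [← mul_assoc (ENNReal.ofReal _), ← ENNReal.ofReal_mul (by positivity), abs_mul (2 * Real.pi * ξ) h,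
      Real.mul_rpow (abs_nonneg _) (abs_nonneg _), ← mul_assoc, ← Real.rpow_add ht']
    congr 2
    · simp
    · congr 4; ring_nf
  simp only [e1]
  rw [lintegral_const_mul' _ _ ENNReal.ofReal_ne_top, hs, ← mul_assoc, abs_inv,
    ← ENNReal.ofReal_mul (by positivity), mul_comm (gagliardoConst μ)]
  congr 2
  rw [Real.rpow_add ht', Real.rpow_one]
  field_simp

end TemperedFractional
end

/-! ### The Gagliardo constant and lower semicontinuity of the Fourier seminorm -/

noncomputable section
namespace TemperedFractional
open MeasureTheory Set Filter Topology
open scoped ENNReal FourierTransform Distributions NNReal SchwartzMap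

/-- Near 0 the integrand behaves like `|h|^(1 - 2μ)`, which needs `μ < 1`; at infinity like `|h|^(-1
- 2μ)`, which needs `μ > 0`. The integral bounds the Gagliardo constant, since `|e^(ih) - 1| ≤ min
|h| 2`, and later the error in multiplying by a bounded Lipschitz function. -/
theorem lintegral_rpow_mul_min_lt_top {μ : ℝ} (hμ0 : 0 < μ) (hμ1 : μ < 1) :
    ∫⁻ h : ℝ, ENNReal.ofReal (|h| ^ (-1 - 2 * μ)) * ENNReal.ofReal (min |h| 2) ^ 2 < ∞ := by
  set G : ℝ → ℝ≥0∞ := fun h =>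
    ENNReal.ofReal (|h| ^ (-1 - 2 * μ)) * ENNReal.ofReal (min |h| 2) ^ 2 with hG
  have hneg : ∀ h, G (-h) = G h := fun h => by simp only [hG, abs_neg]
  have hle1 : ∀ h, 0 < h → G h ≤ ENNReal.ofReal (h ^ (1 - 2 * μ)) := fun h hh => by
    calc G h ≤ ENNReal.ofReal (h ^ (-1 - 2 * μ)) * ENNReal.ofReal h ^ 2 := by
          simp only [hG, abs_of_pos hh]
          gcongr
          exact min_le_left _ _
      _ = _ := by
          rw [← ENNReal.ofReal_pow hh.le, ← ENNReal.ofReal_mul (by positivity), ← Real.rpow_natCast,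
            ← Real.rpow_add hh]
          congr 2; push_cast; ring
  have hle2 : ∀ h, 0 < h → G h ≤ ENNReal.ofReal (4 * h ^ (-1 - 2 * μ)) := fun h hh => by
    calc G h ≤ ENNReal.ofReal (h ^ (-1 - 2 * μ)) * ENNReal.ofReal 2 ^ 2 := by
          simp only [hG, abs_of_pos hh]
          gcongr
          exact min_le_right _ _
      _ = _ := by
          rw [← ENNReal.ofReal_pow (by norm_num), ← ENNReal.ofReal_mul (by positivity)]
          congr 1; ring
  have hA : ∫⁻ h in Ioc 0 1, G h < ∞ := by
    have hi : IntegrableOn (fun h : ℝ => h ^ (1 - 2 * μ)) (Ioc 0 1) :=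
      (intervalIntegrable_iff_integrableOn_Ioc_of_le zero_le_one).1
        (intervalIntegral.intervalIntegrable_rpow' (by linarith))
    refine lt_of_le_of_lt (setLIntegral_mono' measurableSet_Ioc fun h hh => hle1 h hh.1) ?_
    exact hi.lintegral_lt_top
  have hB : ∫⁻ h in Ioi 1, G h < ∞ := by
    have hi : IntegrableOn (fun h : ℝ => 4 * h ^ (-1 - 2 * μ)) (Ioi 1) :=
      (integrableOn_Ioi_rpow_of_lt (by linarith) one_pos).const_mul 4
    refine lt_of_le_of_lt (setLIntegral_mono' measurableSet_Ioi fun h hh =>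
      hle2 h (one_pos.trans hh)) ?_
    exact hi.lintegral_lt_top
  have hC : ∫⁻ h in Ioi 0, G h < ∞ := by
    rw [← Ioc_union_Ioi_eq_Ioi (zero_le_one (α := ℝ))]
    exact (lintegral_union_le _ _ _).trans_lt (ENNReal.add_lt_top.2 ⟨hA, hB⟩)
  have hD : ∫⁻ h in Iio 0, G h < ∞ := by
    refine lt_of_le_of_lt (le_of_eq ?_) hC
    rw [← lintegral_indicator measurableSet_Iio, ← lintegral_indicator measurableSet_Ioi,
      ← lintegral_comp_neg_real]
    refine lintegral_congr fun h => ?_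
    by_cases hh : 0 < h <;> simp [indicator, hh, hneg]
  rw [← setLIntegral_univ, ← Iio_union_Ici (a := (0 : ℝ))]
  refine (lintegral_union_le _ _ _).trans_lt (ENNReal.add_lt_top.2 ⟨hD, ?_⟩)
  rwa [setLIntegral_congr Ioi_ae_eq_Ici.symm]

theorem gagliardoConst_ne_top {μ : ℝ} (hμ0 : 0 < μ) (hμ1 : μ < 1) : gagliardoConst μ ≠ ∞ := by
  refine ((lintegral_mono fun h => ?_).trans_lt (lintegral_rpow_mul_min_lt_top hμ0 hμ1)).ne
  gcongr
  rw [← ofReal_norm]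
  refine ENNReal.ofReal_le_ofReal (le_min ?_ ?_)
  · rw [mul_comm]
    exact Real.norm_exp_I_mul_ofReal_sub_one_le
  · refine (norm_sub_le _ _).trans ?_
    rw [Complex.norm_exp_ofReal_mul_I]; norm_num

/-- On `(0, 1)` the integrand is positive, because `e^(ix) = 1` would force `x` to be a multiple of
`2π`. -/
theorem gagliardoConst_ne_zero (μ : ℝ) : gagliardoConst μ ≠ 0 := by
  intro h
  unfold gagliardoConst at h
  rw [lintegral_eq_zero_iff (by fun_prop)] at h
  have hpos : (volume.restrict (Ioo (0 : ℝ) 1)) ≠ 0 := by simp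
  have : (ae ((volume : Measure ℝ).restrict (Ioo (0 : ℝ) 1))).NeBot := ae_neBot.2 hpos
  obtain ⟨x, hx, hx'⟩ := ((ae_restrict_of_ae (s := Ioo (0 : ℝ) 1) h).and
    (ae_restrict_mem measurableSet_Ioo)).exists
  simp only [Pi.zero_apply, mul_eq_zero, ENNReal.ofReal_eq_zero] at hx
  rcases hx with hx | hx
  · exact absurd hx (not_le.2 (Real.rpow_pos_of_pos (abs_pos.2 hx'.1.ne') _))
  · have h1 : Complex.exp ((x : ℝ) * Complex.I) = 1 := by
      have := pow_eq_zero_iff (two_ne_zero) |>.1 hx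
      exact sub_eq_zero.1 (enorm_eq_zero.1 this)
    rw [Complex.exp_eq_one_iff] at h1
    obtain ⟨n, hn⟩ := h1
    have h2 : (x : ℂ) = (n * (2 * Real.pi) : ℝ) := by
      have hI := Complex.I_ne_zero
      apply mul_right_cancel₀ hI
      rw [hn]; push_cast; ring
    have h3 : x = n * (2 * Real.pi) := by exact_mod_cast h2
    have hp := Real.pi_gt_three
    rcases lt_trichotomy n 0 with hn0 | hn0 | hn0
    · have : (n : ℝ) < 0 := by exact_mod_cast hn0
      nlinarith [hx'.1]
    · subst hn0
      simp at h3
      exact hx'.1.ne' h3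
    · have : (1 : ℝ) ≤ n := by exact_mod_cast hn0
      nlinarith [hx'.2]

theorem norm_cF (w : Lp ℝ 2 (volume : Measure ℝ)) : ‖cF w‖ = ‖w‖ := by
  unfold cF
  rw [Lp.norm_fourier_eq, Lp.norm_def, Lp.norm_def]
  congr 1
  refine eLpNorm_congr_norm_ae ?_
  filter_upwards [Complex.ofRealCLM.coeFn_compLp w] with x hx
  rw [hx]; simp

theorem continuous_cF : Continuous cF :=
  (Lp.fourierTransformₗᵢ ℝ ℂ).continuous.comp (Complex.ofRealCLM.compLpL 2 volume).continuous

theorem energy_zero (w : Lp ℝ 2 (volume : Measure ℝ)) : energy 0 w = ‖w‖ₑ ^ 2 := by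
  have : ‖w‖ₑ = ‖cF w‖ₑ := by rw [← ofReal_norm, ← ofReal_norm, norm_cF]
  rw [this, Lp.enorm_def, eLpNorm_two_sq]
  simp [energy]

/-- The seminorm of `H^s(ℝ)` is lower semicontinuous on `L²(ℝ)`. -/
theorem isClosed_sobolevSeminormR_le (s : ℝ) (C : ℝ≥0∞) :
    IsClosed {w : Lp ℝ 2 (volume : Measure ℝ) | sobolevSeminormR s w ≤ C} := by
  have hset : {w : Lp ℝ 2 (volume : Measure ℝ) | sobolevSeminormR s w ≤ C}
      = {w | ENNReal.ofReal (2 * Real.pi) * energy s w ≤ C ^ 2} := by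
    ext w
    simp only [mem_ofPred_eq]
    rw [← sobolevSeminormR_sq]
    exact (ENNReal.pow_right_strictMono two_ne_zero).le_iff_le.symm
  rw [hset]
  refine IsSeqClosed.isClosed fun w w₀ hw hlim => ?_
  have hlim' : Tendsto (fun n => cF (w n)) atTop (𝓝 (cF w₀)) :=
    (continuous_cF.tendsto _).comp hlim
  -- The energy need not be continuous in `L²`, but an almost everywhere convergent subsequence of
  -- the transforms suffices for Fatou's lemma.
  obtain ⟨ns, hns, hae⟩ := (tendstoInMeasure_of_tendsto_Lp hlim').exists_seq_tendsto_ae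
  have hF : energy s w₀ ≤ liminf (fun i => energy s (w (ns i))) atTop := by
    unfold energy
    refine le_trans (lintegral_mono_ae ?_) (lintegral_liminf_le' fun i => ?_)
    · filter_upwards [hae] with ξ hξ
      refine le_of_eq (Tendsto.liminf_eq ?_).symm
      refine ENNReal.Tendsto.const_mul ?_ (Or.inr ENNReal.ofReal_ne_top)
      exact ((ENNReal.continuous_pow 2).tendsto _).comp hξ.enorm
    · have := (Lp.stronglyMeasurable (cF (w (ns i)))).measurable
      exact (Measurable.mul (by fun_prop) (this.enorm.pow_const 2)).aemeasurable
  have hpi : ENNReal.ofReal (2 * Real.pi) ≠ 0 := by simp; positivity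
  simp only [mem_ofPred_eq]
  rw [mul_comm, ← ENNReal.le_div_iff_mul_le (Or.inl hpi) (Or.inl ENNReal.ofReal_ne_top)]
  refine hF.trans ((liminf_le_liminf (v := fun _ => C ^ 2 / ENNReal.ofReal (2 * Real.pi))
    (.of_forall fun i => ?_)).trans (by simp))
  rw [ENNReal.le_div_iff_mul_le (Or.inl hpi) (Or.inl ENNReal.ofReal_ne_top), mul_comm]
  exact hw (ns i)

/-! ### Extension by zero -/

theorem memLp_indicator_L2 {a b : ℝ} (u : L2 a b) :
    MemLp ((Ioo a b).indicator u) 2 volume :=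
  (memLp_indicator_iff_restrict measurableSet_Ioo).2 (Lp.memLp u)

/-- Extension by zero from `L²(a, b)` to `L²(ℝ)`. -/
def zeroExt (a b : ℝ) : L2 a b →ₗᵢ[ℝ] Lp ℝ 2 (volume : Measure ℝ) where
  toFun u := (memLp_indicator_L2 u).toLp _
  map_add' u v := by
    rw [← MemLp.toLp_add]
    refine MemLp.toLp_congr _ _ ?_
    have h := (ae_restrict_iff' measurableSet_Ioo).1 (Lp.coeFn_add u v)
    filter_upwards [h] with x hx
    by_cases hx' : x ∈ Ioo a b
    · rw [Pi.add_apply, indicator_of_mem hx', indicator_of_mem hx', indicator_of_mem hx', hx hx',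
        Pi.add_apply]
    · rw [Pi.add_apply, indicator_of_notMem hx', indicator_of_notMem hx', indicator_of_notMem hx',
        add_zero]
  map_smul' r u := by
    rw [RingHom.id_apply, ← MemLp.toLp_const_smul]
    refine MemLp.toLp_congr _ _ ?_
    have h := (ae_restrict_iff' measurableSet_Ioo).1 (Lp.coeFn_smul r u)
    filter_upwards [h] with x hx
    by_cases hx' : x ∈ Ioo a b
    · rw [Pi.smul_apply, indicator_of_mem hx', indicator_of_mem hx', hx hx', Pi.smul_apply]
    · rw [Pi.smul_apply, indicator_of_notMem hx', indicator_of_notMem hx', smul_zero]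
  norm_map' u := by
    change ‖(memLp_indicator_L2 u).toLp _‖ = ‖u‖
    rw [Lp.norm_toLp, eLpNorm_indicator_eq_eLpNorm_restrict measurableSet_Ioo, Lp.norm_def]

theorem zeroExt_ae_eq {a b : ℝ} (u : L2 a b) :
    zeroExt a b u =ᵐ[volume] (Ioo a b).indicator u :=
  MemLp.coeFn_toLp (memLp_indicator_L2 u)

theorem zeroExt_ae_eq_restrict {a b : ℝ} (u : L2 a b) :
    ∀ᵐ x ∂((volume : Measure ℝ).restrict (Ioo a b)), zeroExt a b u x = u x := by
  filter_upwards [ae_restrict_of_ae (zeroExt_ae_eq u), ae_restrict_mem measurableSet_Ioo] with x h1 h2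
  rw [h1, indicator_of_mem h2]

theorem sobolevSeminorm_le_zeroExt {a b : ℝ} (s : ℝ) (u : L2 a b) :
    sobolevSeminorm a b s u ≤ sobolevSeminormR s (zeroExt a b u) :=
  iInf₂_le (zeroExt a b u) (zeroExt_ae_eq_restrict u)

theorem toL2_test_ae_eq {a b : ℝ} (φ : Test a b) :
    ∀ᵐ x ∂((volume : Measure ℝ).restrict (Ioo a b)), toL2 a b φ x = φ x := by
  unfold toL2
  rw [dif_pos (memLp_test a b φ)]
  exact MemLp.coeFn_toLp _

theorem test_eq_zero_of_notMem {a b : ℝ} (φ : Test a b) {x : ℝ} (hx : x ∉ Ioo a b) : φ x = 0 :=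
  image_eq_zero_of_notMem_tsupport fun h => hx (φ.tsupport_subset h)

theorem zeroExt_test_ae_eq {a b : ℝ} (φ : Test a b) :
    zeroExt a b (toL2 a b φ) =ᵐ[volume] φ := by
  filter_upwards [zeroExt_ae_eq (toL2 a b φ),
    (ae_restrict_iff' measurableSet_Ioo).1 (toL2_test_ae_eq φ)] with x h1 h2
  rw [h1]
  by_cases hx : x ∈ Ioo a b
  · rw [indicator_of_mem hx, h2 hx]
  · rw [indicator_of_notMem hx, test_eq_zero_of_notMem φ hx]

/-- A test function on `(a, b)` vanishes outside a compact subinterval. -/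
theorem exists_Icc_test {a b : ℝ} (hab : a < b) (φ : Test a b) :
    ∃ a' b', a < a' ∧ a' ≤ b' ∧ b' < b ∧ ∀ x, x ∉ Icc a' b' → φ x = 0 := by
  have hsub : tsupport φ ⊆ Ioo a b := φ.tsupport_subset
  rcases (tsupport φ).eq_empty_or_nonempty with h | h
  · refine ⟨(a + b) / 2, (a + b) / 2, by linarith, le_rfl, by linarith, fun x _ => ?_⟩
    exact image_eq_zero_of_notMem_tsupport (by rw [h]; simp)
  · have hK : IsCompact (tsupport φ) := φ.hasCompactSupport
    have h1 := hK.sInf_mem h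
    have h2 := hK.sSup_mem h
    refine ⟨sInf (tsupport φ), sSup (tsupport φ), (hsub h1).1,
      (csInf_le hK.bddBelow h2), (hsub h2).2, fun x hx => ?_⟩
    refine image_eq_zero_of_notMem_tsupport fun hx' => hx ⟨csInf_le hK.bddBelow hx', le_csSup hK.bddAbove hx'⟩

/-- For `0 < μ < 1` both energies are Gagliardo seminorms up to the same constant, and the Gagliardo
seminorm controls cutting off at the endpoints. -/
theorem energy_le_of_ae_eq_of_mem_Ioo {μ : ℝ} (hμ0 : 0 < μ) (hμ1 : μ < 1) (hμ : μ ≠ 1 / 2) {a b : ℝ}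
    (hab : a < b) (φ : Test a b) (w : Lp ℝ 2 (volume : Measure ℝ))
    (hw : ∀ᵐ x ∂((volume : Measure ℝ).restrict (Ioo a b)), w x = φ x) :
    energy μ (zeroExt a b (toL2 a b φ)) ≤ cutConst μ ^ 2 * energy μ w := by
  obtain ⟨a', b', ha, hab', hb, hφ⟩ := exists_Icc_test hab φ
  classical
  -- A representative of `w` that equals `φ` at every point of `(a, b)`, as the cut-off lemmas
  -- require vanishing everywhere near the endpoints.
  set w' : ℝ → ℝ := (Ioo a b).piecewise φ w
  have hw' : w' =ᵐ[volume] w := by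
    filter_upwards [(ae_restrict_iff' measurableSet_Ioo).1 hw] with x hx
    by_cases hx' : x ∈ Ioo a b
    · simp only [w', piecewise_eq_of_mem _ _ _ hx', hx hx']
    · simp only [w', piecewise_eq_of_notMem _ _ _ hx']
  have hm : Measurable w' := Measurable.piecewise measurableSet_Ioo φ.continuous.measurable
    (Lp.stronglyMeasurable w).measurable
  have h2 : ∫⁻ x, ‖w' x‖ₑ ^ 2 ≠ ∞ := by
    rw [← eLpNorm_two_sq, eLpNorm_congr_ae hw']
    exact ENNReal.pow_ne_top (Lp.eLpNorm_ne_top w)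
  have h := gagliardo_le_of_eq_on hμ0 hμ (f := φ) hm h2
    (fun x hx => by simp only [w', piecewise_eq_of_mem _ _ _ hx]) ha hab' hb hφ
  rw [gagliardo_congr_ae hw', gagliardo_congr_ae (zeroExt_test_ae_eq φ).symm, gagliardo_eq_energy,
    gagliardo_eq_energy] at h
  have h' : gagliardoConst μ * energy μ (zeroExt a b (toL2 a b φ))
      ≤ gagliardoConst μ * (cutConst μ ^ 2 * energy μ w) := by
    refine h.trans (le_of_eq (by ring))
  exact (ENNReal.mul_le_mul_iff_right (gagliardoConst_ne_zero μ) (gagliardoConst_ne_top hμ0 hμ1)).1 h'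

/-- At order 1 the Gagliardo constant is infinite, so difference quotients replace it. For steps
shorter than the distance from the support of `φ` to the endpoints, differences of the zero
extension are dominated by those of `w`. Dividing by `h²` and letting `h → 0` with Fatou's lemma
gives constant 1. -/
theorem energy_one_le_of_ae_eq {a b : ℝ}
    (hab : a < b) (φ : Test a b) (w : Lp ℝ 2 (volume : Measure ℝ))
    (hw : ∀ᵐ x ∂((volume : Measure ℝ).restrict (Ioo a b)), w x = φ x) :
    energy 1 (zeroExt a b (toL2 a b φ)) ≤ energy 1 w := by
  obtain ⟨a', b', ha, hab', hb, hφ⟩ := exists_Icc_test hab φ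
  set z := zeroExt a b (toL2 a b φ)
  have hz : z =ᵐ[volume] φ := zeroExt_test_ae_eq φ
  have hw0 := (ae_restrict_iff' measurableSet_Ioo).1 hw
  have hT : ∀ h, 0 < h → h < a' - a → h < b - b' →
      ∫⁻ x, ‖z (x + h) - z x‖ₑ ^ 2 ≤ ENNReal.ofReal (h ^ 2) * energy 1 w := by
    intro h h0 h1 h2
    calc ∫⁻ x, ‖z (x + h) - z x‖ₑ ^ 2 ≤ ∫⁻ x, ‖w (x + h) - w x‖ₑ ^ 2 := by
          have hq := (measurePreserving_add_right volume h).quasiMeasurePreserving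
          refine lintegral_mono_ae ?_
          filter_upwards [hz, hq.ae hz, hw0, hq.ae hw0] with x e1 e2 e3 e4
          rw [e1, e2]
          by_cases hx : x ∈ Ioo a b ∧ x + h ∈ Ioo a b
          · rw [e3 hx.1, e4 hx.2]
          -- If `x` and `x + h` are not both in `(a, b)`, neither can be in `[a', b']`, because `h`
          -- is smaller than both gaps.
          · have hx1 : φ x = 0 := hφ x fun hx' => hx
              ⟨⟨by linarith [hx'.1], by linarith [hx'.2]⟩, ⟨by linarith [hx'.1], by linarith [hx'.2]⟩⟩
            have hx2 : φ (x + h) = 0 := hφ _ fun hx' => hx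
              ⟨⟨by linarith [hx'.1], by linarith [hx'.2]⟩, ⟨by linarith [hx'.1], by linarith [hx'.2]⟩⟩
            simp [hx1, hx2]
      _ ≤ _ := by
          rw [lintegral_translate_sub]
          unfold energy
          rw [← lintegral_const_mul' _ _ ENNReal.ofReal_ne_top]
          refine lintegral_mono fun ξ => ?_
          simp only
          rw [← mul_assoc (ENNReal.ofReal _), ← ENNReal.ofReal_mul (by positivity)]
          gcongr
          rw [mul_comm _ Complex.I]
          calc _ ≤ ‖(2 * Real.pi * (h * ξ) : ℝ)‖ₑ ^ 2 := by
                gcongr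
                exact Real.enorm_exp_I_mul_ofReal_sub_one_le
            _ = _ := by
                rw [← ofReal_norm, ← ENNReal.ofReal_pow (norm_nonneg _), Real.norm_eq_abs]
                congr 1
                have : (2 * 1 : ℝ) = (2 : ℕ) := by norm_num
                rw [this, Real.rpow_natCast, sq_abs, sq_abs]
                ring
  set h : ℕ → ℝ := fun n => ((n : ℝ) + 1)⁻¹
  have hh : Tendsto h atTop (𝓝 0) := tendsto_inv_atTop_zero.comp
    (tendsto_atTop_add_const_right _ _ tendsto_natCast_atTop_atTop)
  have hpos : ∀ n, 0 < h n := fun n => by positivity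
  have hlim : ∀ ξ : ℝ, Tendsto (fun n => ‖(Complex.exp ((2 * Real.pi * (h n * ξ) : ℝ) * Complex.I) - 1)
      / (h n : ℂ)‖ₑ ^ 2) atTop (𝓝 (ENNReal.ofReal (|2 * Real.pi * ξ| ^ (2 * 1 : ℝ)))) := by
    intro ξ
    have hd : HasDerivAt (fun t : ℝ => Complex.exp ((2 * Real.pi * (t * ξ) : ℝ) * Complex.I))
        ((2 * Real.pi * ξ : ℝ) * Complex.I) 0 := by
      have h1 : HasDerivAt (fun t : ℝ => (((2 * Real.pi * (t * ξ) : ℝ) : ℂ) * Complex.I))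
          ((2 * Real.pi * ξ : ℝ) * Complex.I) 0 := by
        have h0 : HasDerivAt (fun t : ℝ => 2 * Real.pi * (t * ξ)) (2 * Real.pi * ξ) 0 := by
          simpa using ((hasDerivAt_id (0 : ℝ)).mul_const ξ).const_mul (2 * Real.pi)
        exact h0.ofReal_comp.mul_const _
      simpa using h1.cexp
    have hs := hd.tendsto_slope_zero
    have hs2 := hs.comp (tendsto_nhdsWithin_iff.2 ⟨hh, .of_forall fun n => (hpos n).ne'⟩)
    have hs3 := ((ENNReal.continuous_pow 2).tendsto _).comp hs2.enorm
    refine (hs3.congr fun n => ?_).trans (le_of_eq ?_)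
    · simp only [Function.comp, zero_add, zero_mul, mul_zero, Complex.ofReal_zero, Complex.exp_zero]
      congr 2
      rw [Complex.real_smul, div_eq_inv_mul]; push_cast; rfl
    · congr 1
      rw [← ofReal_norm, ← ENNReal.ofReal_pow (norm_nonneg _)]
      congr 1
      have : (2 * 1 : ℝ) = (2 : ℕ) := by norm_num
      rw [this, Real.rpow_natCast, norm_mul, Complex.norm_I, mul_one, Complex.norm_real,
        Real.norm_eq_abs]
  have hcm : Measurable (cF z) := (Lp.stronglyMeasurable (cF z)).measurable
  calc energy 1 z = ∫⁻ ξ, liminf (fun n => ‖(Complex.exp ((2 * Real.pi * (h n * ξ) : ℝ) * Complex.I)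
        - 1) / (h n : ℂ)‖ₑ ^ 2 * ‖cF z ξ‖ₑ ^ 2) atTop := by
        refine lintegral_congr fun ξ => ?_
        refine (Tendsto.liminf_eq ?_).symm
        exact ENNReal.Tendsto.mul_const (hlim ξ) (Or.inr (by simp))
    _ ≤ liminf (fun n => ∫⁻ ξ, ‖(Complex.exp ((2 * Real.pi * (h n * ξ) : ℝ) * Complex.I)
        - 1) / (h n : ℂ)‖ₑ ^ 2 * ‖cF z ξ‖ₑ ^ 2) atTop := by
        refine lintegral_liminf_le fun n => ?_
        exact Measurable.mul (by fun_prop) (hcm.enorm.pow_const 2)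
    _ ≤ liminf (fun _ : ℕ => energy 1 w) atTop := by
        refine liminf_le_liminf ?_
        filter_upwards [hh.eventually (gt_mem_nhds (show 0 < a' - a by linarith)),
          hh.eventually (gt_mem_nhds (show 0 < b - b' by linarith))] with n h1 h2
        have h3 := hT (h n) (hpos n) h1 h2
        rw [lintegral_translate_sub] at h3
        have h4 : ∀ ξ : ℝ, ‖(Complex.exp ((2 * Real.pi * (h n * ξ) : ℝ) * Complex.I)
            - 1) / (h n : ℂ)‖ₑ ^ 2 * ‖cF z ξ‖ₑ ^ 2 = ENNReal.ofReal ((h n ^ 2)⁻¹) *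
            (‖Complex.exp ((2 * Real.pi * (h n * ξ) : ℝ) * Complex.I) - 1‖ₑ ^ 2 * ‖cF z ξ‖ₑ ^ 2) := by
          intro ξ
          rw [← mul_assoc (ENNReal.ofReal _)]
          congr 1
          rw [div_eq_inv_mul, enorm_mul, mul_pow]
          congr 1
          rw [← Complex.ofReal_inv, enorm_complex_ofReal, Real.enorm_of_nonneg (by positivity),
            ← ENNReal.ofReal_pow (by positivity), inv_pow]
        simp only [h4]
        rw [lintegral_const_mul' _ _ ENNReal.ofReal_ne_top]
        refine (mul_le_mul_right h3 _).trans (le_of_eq ?_)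
        rw [← mul_assoc, ← ENNReal.ofReal_mul (by positivity), inv_mul_cancel₀ (by positivity),
          ENNReal.ofReal_one, one_mul]
    _ = energy 1 w := by simp

/-! ### Boundedness of the extension by zero and completeness of `H₀^s(Ω)` -/

theorem sobolevSeminorm_le_sobolevENorm (a b s : ℝ) (u : L2 a b) :
    sobolevSeminorm a b s u ≤ sobolevENorm a b s u := by
  have h : sobolevSeminorm a b s u = (sobolevSeminorm a b s u ^ 2) ^ (1 / 2 : ℝ) := by
    rw [← ENNReal.rpow_ofNat, ← ENNReal.rpow_mul]
    norm_num
  unfold sobolevENorm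
  conv_lhs => rw [h]
  gcongr
  exact le_add_self

theorem sobolevENorm_le_add (a b s : ℝ) (u : L2 a b) :
    sobolevENorm a b s u ≤ ‖u‖ₑ + sobolevSeminorm a b s u := by
  have h : ∀ x : ℝ≥0∞, x = (x ^ 2) ^ (1 / 2 : ℝ) := fun x => by
    rw [← ENNReal.rpow_ofNat, ← ENNReal.rpow_mul]
    norm_num
  rw [h (‖u‖ₑ + sobolevSeminorm a b s u)]
  unfold sobolevENorm
  gcongr
  rw [add_sq]
  gcongr
  exact le_self_add

/-- Three regimes: order 0 is monotonicity of the `L²` norm in the domain, order 1 uses difference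
quotients, and the orders between use the two half-line cuts. -/
theorem exists_zeroExt_energy_le {μ : ℝ} (hμ0 : 0 ≤ μ) (hμ1 : μ ≤ 1) (hμ : μ ≠ 1 / 2) {a b : ℝ}
    (hab : a < b) : ∃ D : ℝ≥0, ∀ (φ : Test a b) (w : Lp ℝ 2 (volume : Measure ℝ)),
      (∀ᵐ x ∂((volume : Measure ℝ).restrict (Ioo a b)), w x = φ x) →
      energy μ (zeroExt a b (toL2 a b φ)) ≤ D * energy μ w := by
  rcases hμ0.eq_or_lt with rfl | hμ0
  · refine ⟨1, fun φ w hw => ?_⟩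
    rw [energy_zero, energy_zero, ENNReal.coe_one, one_mul]
    gcongr
    have h1 : ‖zeroExt a b (toL2 a b φ)‖ₑ = ‖toL2 a b φ‖ₑ := by
      rw [← ofReal_norm, ← ofReal_norm, LinearIsometry.norm_map]
    rw [h1, Lp.enorm_def, Lp.enorm_def]
    have h2 : eLpNorm (toL2 a b φ) 2 (volume.restrict (Ioo a b))
        = eLpNorm w 2 (volume.restrict (Ioo a b)) := by
      refine eLpNorm_congr_ae ?_
      filter_upwards [hw, toL2_test_ae_eq φ] with x e1 e2
      rw [e1, e2]
    rw [h2]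
    exact eLpNorm_mono_measure _ Measure.restrict_le_self
  · rcases hμ1.eq_or_lt with rfl | hμ1
    · exact ⟨1, fun φ w hw => by simpa using energy_one_le_of_ae_eq hab φ w hw⟩
    · lift cutConst μ to ℝ≥0 using cutConst_ne_top hμ with C hC
      refine ⟨C ^ 2, fun φ w hw => ?_⟩
      push_cast
      rw [hC]
      exact energy_le_of_ae_eq_of_mem_Ioo hμ0 hμ1 hμ hab φ w hw

theorem exists_zeroExt_test_le {μ : ℝ} (hμ0 : 0 ≤ μ) (hμ1 : μ ≤ 1) (hμ : μ ≠ 1 / 2) {a b : ℝ}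
    (hab : a < b) : ∃ C : ℝ≥0, ∀ φ : Test a b,
      sobolevSeminormR μ (zeroExt a b (toL2 a b φ)) ≤ C * sobolevSeminorm a b μ (toL2 a b φ) := by
  obtain ⟨D, hD⟩ := exists_zeroExt_energy_le hμ0 hμ1 hμ hab
  -- `D + 1` is nonzero, as needed to move it inside the infimum, and its square exceeds `D`, so
  -- square roots are avoided.
  refine ⟨D + 1, fun φ => ?_⟩
  have h0 : ((D + 1 : ℝ≥0) : ℝ≥0∞) ≠ 0 := by simp
  unfold sobolevSeminorm
  rw [ENNReal.mul_iInf_of_ne h0 ENNReal.coe_ne_top]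
  refine le_iInf fun w => ?_
  rw [ENNReal.mul_iInf_of_ne h0 ENNReal.coe_ne_top]
  refine le_iInf fun hw => ?_
  rw [← ENNReal.pow_le_pow_left_iff two_ne_zero, mul_pow, sobolevSeminormR_sq, sobolevSeminormR_sq]
  have hw' : ∀ᵐ x ∂((volume : Measure ℝ).restrict (Ioo a b)), w x = φ x := by
    filter_upwards [hw, toL2_test_ae_eq φ] with x e1 e2
    rw [e1, e2]
  have hDD : (D : ℝ≥0∞) ≤ ((D + 1 : ℝ≥0) : ℝ≥0∞) ^ 2 := by
    norm_cast
    rw [← NNReal.coe_le_coe]; push_cast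
    nlinarith [D.2, show (0 : ℝ) ≤ D from D.2]
  calc _ ≤ ENNReal.ofReal (2 * Real.pi) * (((D + 1 : ℝ≥0) : ℝ≥0∞) ^ 2 * energy μ w) := by
        gcongr
        exact (hD φ w hw').trans (by gcongr)
    _ = _ := by ring

/-- Extension by zero is bounded from `H₀^μ(Ω)` to `H^μ(ℝ)` for `μ ∈ [0, 1]`, `μ ≠ 1/2`. -/
theorem exists_zeroExt_le {μ : ℝ} (hμ0 : 0 ≤ μ) (hμ1 : μ ≤ 1) (hμ : μ ≠ 1 / 2) {a b : ℝ}
    (hab : a < b) : ∃ C : ℝ≥0, ∀ u ∈ sobolevZero a b μ,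
      sobolevSeminormR μ (zeroExt a b u) ≤ C * sobolevSeminorm a b μ u := by
  obtain ⟨C, hC⟩ := exists_zeroExt_test_le hμ0 hμ1 hμ hab
  refine ⟨C, fun u hu => ?_⟩
  have key : ∀ ε : ℝ≥0, 0 < ε →
      sobolevSeminormR μ (zeroExt a b u) ≤ C * (sobolevSeminorm a b μ u + ε) := by
    intro ε hε
    -- The sublevel set is closed in `L²` and contains zero extensions of test functions arbitrarily
    -- near `u`, hence that of `u`.
    have hcl := (isClosed_sobolevSeminormR_le μ (C * (sobolevSeminorm a b μ u + ε))).preimage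
      (zeroExt a b).continuous
    refine hcl.closure_subset (Metric.mem_closure_iff.2 ?_)
    intro δ hδ
    obtain ⟨φ, hφ⟩ := hu.2 (min ε (ENNReal.ofReal δ)) (lt_min (by simpa using hε) (by simpa using hδ))
    refine ⟨toL2 a b φ, ?_, ?_⟩
    · refine (hC φ).trans ?_
      gcongr
      have : toL2 a b φ = u + (-1 : ℝ) • (u - toL2 a b φ) := by simp
      rw [this]
      refine (sobolevSeminorm_add_le a b μ _ _).trans ?_
      gcongr
      refine (sobolevSeminorm_smul_le a b μ _ _).trans ?_
      simp only [enorm_neg, enorm_one, one_mul]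
      exact (sobolevSeminorm_le_sobolevENorm a b μ _).trans (hφ.le.trans (min_le_left _ _))
    · have := (enorm_le_sobolevENorm a b μ _).trans_lt (hφ.trans_le (min_le_right _ _))
      rw [← ofReal_norm] at this
      rw [dist_eq_norm]
      exact (ENNReal.ofReal_lt_ofReal_iff hδ).1 this
  have hfin : sobolevSeminorm a b μ u ≠ ∞ :=
    ((sobolevSeminorm_le_sobolevENorm a b μ u).trans_lt hu.1).ne
  refine ENNReal.le_of_forall_pos_le_add fun ε hε _ => ?_
  have h := key (ε / (C + 1)) (by positivity)
  refine h.trans ?_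
  rw [mul_add]
  gcongr
  norm_cast
  rw [← NNReal.coe_le_coe]
  push_cast
  have hC0 : (0 : ℝ) ≤ C := C.2
  have hε0 : (0 : ℝ) < ε := hε
  rw [mul_div_assoc', div_le_iff₀ (by positivity)]
  nlinarith

theorem HZero.enorm_eq {a b s : ℝ} (u : HZero a b s) : ‖u‖ₑ = sobolevENorm a b s u.val := by
  rw [← ofReal_norm, HZero.norm_def, ENNReal.ofReal_toReal u.sobolevENorm_ne_top]

theorem HZero.norm_val_le {a b s : ℝ} (u : HZero a b s) : ‖u.val‖ ≤ ‖u‖ := by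
  have h := enorm_le_sobolevENorm a b s u.val
  rw [← HZero.enorm_eq] at h
  exact enorm_le_iff_norm_le.1 h

/-- The element of `H₀^s(Ω)` given by a member of the subspace `sobolevZero`. -/
def HZero.mk {a b s : ℝ} (u : L2 a b) (hu : u ∈ sobolevZero a b s) : HZero a b s :=
  (⟨u, hu⟩ : sobolevZero a b s)

theorem HZero.val_mk {a b s : ℝ} (u : L2 a b) (hu : u ∈ sobolevZero a b s) :
    (HZero.mk u hu).val = u := rfl

theorem HZero.val_mem {a b s : ℝ} (u : HZero a b s) : u.val ∈ sobolevZero a b s :=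
  (show ↥(sobolevZero a b s) from u).2

theorem HZero.val_injective {a b s : ℝ} : Function.Injective (HZero.val (a := a) (b := b) (s := s)) :=
  Subtype.val_injective

/-- The `L²` limit of a Cauchy sequence is the candidate. The infimum seminorm is dominated by the
Fourier seminorm of the zero extension, which is lower semicontinuous in `L²`, and on differences of
members of the sequence the latter is at most `C` times the former. The lost factor does not affect
convergence. -/
theorem HZero.completeSpace {s : ℝ} (hs0 : 0 ≤ s) (hs1 : s ≤ 1) (hs : s ≠ 1 / 2) {a b : ℝ}
    (hab : a < b) : CompleteSpace (HZero a b s) := by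
  obtain ⟨C, hC⟩ := exists_zeroExt_le hs0 hs1 hs hab
  refine Metric.complete_of_cauchySeq_tendsto fun u hu => ?_
  have hval : LipschitzWith 1 (fun x : HZero a b s => x.val) := LipschitzWith.of_dist_le_mul
    fun x y => by
      rw [dist_eq_norm, dist_eq_norm, ← map_sub]; simpa using HZero.norm_val_le (x - y)
  obtain ⟨v, hv⟩ := cauchySeq_tendsto_of_complete (hval.uniformContinuous.comp_cauchySeq hu)
  have key : ∀ ε : ℝ, 0 < ε → ∃ N, ∀ n ≥ N,
      sobolevENorm a b s ((u n).val - v) ≤ ENNReal.ofReal ε + C * ENNReal.ofReal ε := by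
    intro ε hε
    obtain ⟨N, hN⟩ := Metric.cauchySeq_iff.1 hu ε hε
    refine ⟨N, fun n hn => (sobolevENorm_le_add a b s _).trans ?_⟩
    have hlim : Tendsto (fun k => (u n).val - (u k).val) atTop (𝓝 ((u n).val - v)) :=
      tendsto_const_nhds.sub hv
    have hk : ∀ k ≥ N, sobolevENorm a b s ((u n).val - (u k).val) ≤ ENNReal.ofReal ε := fun k hk => by
      have h1 := (hN n hn k hk).le
      rw [dist_eq_norm] at h1
      rw [← map_sub, ← HZero.enorm_eq, ← ofReal_norm]
      exact ENNReal.ofReal_le_ofReal h1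
    refine add_le_add ?_ ?_
    · refine le_of_tendsto hlim.enorm (eventually_atTop.2 ⟨N, fun k hk' => ?_⟩)
      exact (enorm_le_sobolevENorm a b s _).trans (hk k hk')
    · refine (sobolevSeminorm_le_zeroExt s _).trans ?_
      have hcl := (isClosed_sobolevSeminormR_le s (C * ENNReal.ofReal ε)).preimage
        (zeroExt a b).continuous
      refine hcl.mem_of_tendsto hlim (eventually_atTop.2 ⟨N, fun k hk' => ?_⟩)
      refine (hC _ ?_).trans ?_
      · rw [← map_sub]; exact HZero.val_mem _
      · gcongr
        exact (sobolevSeminorm_le_sobolevENorm a b s _).trans (hk k hk')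
  have key' : ∀ ε : ℝ≥0∞, 0 < ε → ∃ N, ∀ n ≥ N, sobolevENorm a b s ((u n).val - v) < ε := by
    intro ε hε
    obtain ⟨r, hr0, hr⟩ := ENNReal.lt_iff_exists_nnreal_btwn.1 hε
    have hr0' : (0 : ℝ) < r := by exact_mod_cast hr0
    have hC0 : (0 : ℝ) ≤ C := C.2
    -- This value makes `ε + C ε` equal to `r`.
    obtain ⟨N, hN⟩ := key (r / (1 + C)) (by positivity)
    refine ⟨N, fun n hn => (hN n hn).trans_lt (lt_of_le_of_lt (le_of_eq ?_) hr)⟩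
    have : (C : ℝ≥0∞) = ENNReal.ofReal C := by simp
    rw [this, ← ENNReal.ofReal_mul hC0, ← ENNReal.ofReal_add (by positivity) (by positivity)]
    have : (r : ℝ) / (1 + C) + C * (r / (1 + C)) = r := by field_simp
    rw [this]; simp
  have hvmem : v ∈ sobolevZero a b s := by
    have hsplit : ∀ n (w : L2 a b), sobolevENorm a b s (v - w) ≤
        sobolevENorm a b s ((u n).val - v) + sobolevENorm a b s ((u n).val - w) := fun n w => by
      have h1 : v - w = (-1 : ℝ) • ((u n).val - v) + ((u n).val - w) := by simp
      rw [h1]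
      refine (sobolevENorm_add_le a b s _ _).trans ?_
      gcongr
      simpa using sobolevENorm_smul_le a b s (-1) ((u n).val - v)
    constructor
    · obtain ⟨N, hN⟩ := key' 1 (by simp)
      have h1 := hsplit N 0
      rw [sub_zero, sub_zero] at h1
      exact h1.trans_lt (ENNReal.add_lt_top.2
        ⟨(hN N le_rfl).trans ENNReal.one_lt_top, (HZero.val_mem (u N)).1⟩)
    · intro ε hε
      obtain ⟨N, hN⟩ := key' (ε / 2) (ENNReal.half_pos hε.ne')
      obtain ⟨φ, hφ⟩ := (HZero.val_mem (u N)).2 (ε / 2) (ENNReal.half_pos hε.ne')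
      refine ⟨φ, (hsplit N _).trans_lt ?_⟩
      calc _ < ε / 2 + ε / 2 := ENNReal.add_lt_add (hN N le_rfl) hφ
        _ = ε := ENNReal.add_halves ε
  refine ⟨HZero.mk v hvmem, Metric.tendsto_atTop.2 fun ε hε => ?_⟩
  obtain ⟨N, hN⟩ := key' (ENNReal.ofReal ε) (by simpa using hε)
  refine ⟨N, fun n hn => ?_⟩
  have h1 := hN n hn
  rw [← HZero.val_mk v hvmem, ← map_sub, ← HZero.enorm_eq, ← ofReal_norm] at h1
  rw [dist_eq_norm]
  exact (ENNReal.ofReal_lt_ofReal_iff hε).1 h1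

end TemperedFractional
end

noncomputable section
namespace TemperedFractional
open MeasureTheory Set Filter Topology
open scoped FourierTransform Distributions

/-! ### The Laplace transform of a power -/

theorem integrableOn_rpow_mul_exp_neg {s c : ℝ} (hs : -1 < s) (hc : 0 < c) :
    IntegrableOn (fun t : ℝ => t ^ s * Real.exp (-c * t)) (Ioi 0) := by
  have := integrableOn_rpow_mul_exp_neg_mul_rpow (p := 1) hs one_pos hc
  simpa using this

theorem norm_rpow_mul_cexp {s t : ℝ} (ht : 0 < t) (r : ℂ) :
    ‖((t ^ s : ℝ) : ℂ) * Complex.exp (-(r * t))‖ = t ^ s * Real.exp (-r.re * t) := by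
  rw [norm_mul, Complex.norm_real, Real.norm_of_nonneg (by positivity), Complex.norm_exp]
  simp

theorem hasDerivAt_laplace_rpow {s : ℝ} (hs : -1 < s) {r : ℂ} (hr : 0 < r.re) :
    HasDerivAt (fun r : ℂ => ∫ t in Ioi (0 : ℝ), ((t ^ s : ℝ) : ℂ) * Complex.exp (-(r * t)))
      (∫ t in Ioi (0 : ℝ), -(t : ℂ) * (((t ^ s : ℝ) : ℂ) * Complex.exp (-(r * t)))) r := by
  have hr2 : 0 < r.re / 2 := by linarith
  have hm : ∀ z : ℂ, AEStronglyMeasurable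
      (fun t : ℝ => ((t ^ s : ℝ) : ℂ) * Complex.exp (-(z * t))) (volume.restrict (Ioi 0)) :=
    fun z => Measurable.aestronglyMeasurable (by fun_prop)
  refine (hasDerivAt_integral_of_dominated_loc_of_deriv_le (s := Metric.ball r (r.re / 2))
    (F' := fun (r : ℂ) (t : ℝ) => -(t : ℂ) * (((t ^ s : ℝ) : ℂ) * Complex.exp (-(r * t))))
    (Metric.ball_mem_nhds r hr2) (bound := fun t => t ^ (s + 1) * Real.exp (-(r.re / 2) * t))
    (.of_forall hm) ?_ ?_ ?_ (integrableOn_rpow_mul_exp_neg (by linarith) hr2) ?_).2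
  · refine (integrableOn_rpow_mul_exp_neg hs hr).mono' (hm r) ?_
    filter_upwards [ae_restrict_mem measurableSet_Ioi] with t ht
    exact (norm_rpow_mul_cexp ht r).le
  · exact Measurable.aestronglyMeasurable (by fun_prop)
  · filter_upwards [ae_restrict_mem measurableSet_Ioi] with t ht z hz
    have ht0 : (0 : ℝ) < t := ht
    rw [norm_mul, norm_rpow_mul_cexp ht, norm_neg, Complex.norm_real, Real.norm_of_nonneg ht0.le,
      ← mul_assoc, Real.rpow_add_one ht0.ne', mul_comm t]
    gcongr
    have h1 := (Complex.abs_re_le_norm (z - r)).trans_lt (by simpa [dist_eq_norm] using hz)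
    rw [Complex.sub_re] at h1
    linarith [(abs_lt.1 h1).1]
  · filter_upwards with t z _
    have h1 : HasDerivAt (fun z : ℂ => -(z * t)) (-(t : ℂ)) z := by
      simpa using! ((hasDerivAt_id z).mul_const (t : ℂ)).neg
    refine (h1.cexp.const_mul (((t ^ s : ℝ) : ℂ))).congr_deriv ?_
    ring

/-- For real `r > 0` this is the Gamma integral. Both sides are analytic on the right half plane, so
the identity theorem extends it. -/
theorem laplace_rpow {μ : ℝ} (hμ : μ < 1) {r : ℂ} (hr : 0 < r.re) :
    ∫ t in Ioi (0 : ℝ), ((t ^ (-μ) : ℝ) : ℂ) * Complex.exp (-(r * t))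
      = r ^ ((μ : ℂ) - 1) * Real.Gamma (1 - μ) := by
  set U : Set ℂ := {z | 0 < z.re}
  have hU : IsOpen U := isOpen_lt continuous_const Complex.continuous_re
  have hUc : IsPreconnected U := (convex_halfSpace_re_gt 0).isPreconnected
  have hF : AnalyticOnNhd ℂ (fun r : ℂ => ∫ t in Ioi (0 : ℝ),
      ((t ^ (-μ) : ℝ) : ℂ) * Complex.exp (-(r * t))) U :=
    DifferentiableOn.analyticOnNhd (fun z hz =>
      (hasDerivAt_laplace_rpow (by linarith) hz).differentiableAt.differentiableWithinAt) hU
  have hG : AnalyticOnNhd ℂ (fun r : ℂ => r ^ ((μ : ℂ) - 1) * Real.Gamma (1 - μ)) U := by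
    refine DifferentiableOn.analyticOnNhd (fun z hz => ?_) hU
    have hz' : z ∈ Complex.slitPlane := Or.inl hz
    exact (((differentiableAt_id.cpow_const hz')).mul_const _).differentiableWithinAt
  have hreal : ∀ x : ℝ, 0 < x → ∫ t in Ioi (0 : ℝ), ((t ^ (-μ) : ℝ) : ℂ) *
      Complex.exp (-((x : ℂ) * t)) = (x : ℂ) ^ ((μ : ℂ) - 1) * Real.Gamma (1 - μ) := by
    intro x hx
    have h := Real.integral_rpow_mul_exp_neg_mul_Ioi (a := 1 - μ) (by linarith) hx
    have e1 : ∫ t in Ioi (0 : ℝ), ((t ^ (-μ) : ℝ) : ℂ) * Complex.exp (-((x : ℂ) * t))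
        = ((∫ t in Ioi (0 : ℝ), t ^ (1 - μ - 1) * Real.exp (-(x * t)) : ℝ) : ℂ) := by
      rw [← integral_complex_ofReal]
      refine integral_congr_ae (.of_forall fun t => ?_)
      have : 1 - μ - 1 = -μ := by ring
      simp only [this]
      push_cast; rfl
    rw [e1, h, Complex.ofReal_mul]
    congr 1
    rw [one_div, Real.inv_rpow hx.le, ← Real.rpow_neg hx.le, Complex.ofReal_cpow hx.le]
    congr 1; push_cast; ring
  refine hF.eqOn_of_preconnected_of_frequently_eq hG hUc (z₀ := 1) (by simp [U]) ?_ hr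
  -- Real points accumulating at 1 without reaching it, where the two analytic functions agree.
  have htend : Tendsto (fun n : ℕ => ((1 + 1 / ((n : ℝ) + 1) : ℝ) : ℂ)) atTop (𝓝[≠] 1) := by
    refine tendsto_nhdsWithin_iff.2 ⟨?_, .of_forall fun n => ?_⟩
    · have h1 : Tendsto (fun n : ℕ => (1 + 1 / ((n : ℝ) + 1) : ℝ)) atTop (𝓝 (1 + 0)) :=
        tendsto_const_nhds.add tendsto_one_div_add_atTop_nhds_zero_nat
      have h2 := (Complex.continuous_ofReal.tendsto _).comp h1
      rw [add_zero, Complex.ofReal_one] at h2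
      exact h2
    · have h1 : (1 + 1 / ((n : ℝ) + 1) : ℝ) ≠ 1 := by
        have : 0 < 1 / ((n : ℝ) + 1) := by positivity
        linarith
      exact Complex.ofReal_ne_one.2 h1
  exact htend.frequently (Eventually.frequently (.of_forall fun n => hreal _ (by positivity)))

/-! ### The Fourier transform of a test function -/

/-- The derivative of a test function. -/
def testDeriv {a b : ℝ} (φ : Test a b) : Test a b where
  toFun := deriv φ
  contDiff' := (contDiff_infty_iff_deriv.1 φ.contDiff).2
  hasCompactSupport' := φ.hasCompactSupport.deriv
  tsupport_subset' := (closure_mono support_deriv_subset).trans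
    ((isClosed_tsupport _).closure_subset.trans φ.tsupport_subset)

theorem testDeriv_apply {a b : ℝ} (φ : Test a b) (x : ℝ) : testDeriv φ x = deriv φ x := rfl

theorem hasDerivAt_test {a b : ℝ} (φ : Test a b) (x : ℝ) : HasDerivAt φ (testDeriv φ x) x :=
  ((φ.contDiff.differentiable (by simp)) x).hasDerivAt

/-- The Schwartz function with the values of a test function. -/
def testSchwartz {a b : ℝ} (φ : Test a b) : SchwartzMap ℝ ℂ :=
  schwartzOf (fun x => (φ x : ℂ)) (Complex.ofRealCLM.contDiff.comp φ.contDiff)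
    (φ.hasCompactSupport.comp_left (g := Complex.ofReal) rfl)

theorem testSchwartz_apply {a b : ℝ} (φ : Test a b) (x : ℝ) : testSchwartz φ x = φ x := rfl

/-- The Fourier transform of a test function. -/
def ft {a b : ℝ} (φ : Test a b) : ℝ → ℂ := (𝓕 (testSchwartz φ) : SchwartzMap ℝ ℂ)

theorem ft_eq {a b : ℝ} (φ : Test a b) : ft φ = 𝓕 (fun x => (φ x : ℂ)) := rfl

theorem continuous_ft {a b : ℝ} (φ : Test a b) : Continuous (ft φ) :=
  (𝓕 (testSchwartz φ)).continuous

theorem integrable_ft {a b : ℝ} (φ : Test a b) : Integrable (ft φ) :=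
  (𝓕 (testSchwartz φ)).integrable

theorem memLp_ft {a b : ℝ} (φ : Test a b) : MemLp (ft φ) 2 :=
  (𝓕 (testSchwartz φ)).memLp 2 volume

theorem fourierInv_ft {a b : ℝ} (φ : Test a b) (x : ℝ) : 𝓕⁻ (ft φ) x = φ x := by
  have h : 𝓕⁻ (𝓕 (testSchwartz φ)) = testSchwartz φ := FourierTransform.fourierInv_fourier_eq _
  have h2 := DFunLike.congr_fun h x
  rw [SchwartzMap.fourierInv_coe] at h2
  exact h2

theorem ft_testDeriv {a b : ℝ} (φ : Test a b) (ξ : ℝ) :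
    ft (testDeriv φ) ξ = (2 * Real.pi * Complex.I * ξ) * ft φ ξ := by
  have hd : deriv (fun x => (φ x : ℂ)) = fun x => ((testDeriv φ x : ℝ) : ℂ) := by
    ext x
    exact (hasDerivAt_test φ x).ofReal_comp.deriv
  have h := Real.fourier_deriv (f := fun x => (φ x : ℂ)) (testSchwartz φ).integrable
    (fun x => (hasDerivAt_test φ x).ofReal_comp.differentiableAt)
    (by rw [hd]; exact (testSchwartz (testDeriv φ)).integrable)
  rw [hd] at h
  exact congrFun h ξ

theorem ft_add {a b : ℝ} (φ ψ : Test a b) (ξ : ℝ) : ft (φ + ψ) ξ = ft φ ξ + ft ψ ξ := by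
  have h : testSchwartz (φ + ψ) = testSchwartz φ + testSchwartz ψ := by
    ext x
    simp [testSchwartz_apply]
  unfold ft
  rw [h, FourierTransform.fourier_add, _root_.add_apply]

theorem ft_smul {a b : ℝ} (r : ℝ) (φ : Test a b) (ξ : ℝ) : ft (r • φ) ξ = r * ft φ ξ := by
  have h : testSchwartz (r • φ) = (r : ℂ) • testSchwartz φ := by
    ext x
    simp [testSchwartz_apply]
  unfold ft
  rw [h, FourierTransform.fourier_smul, _root_.smul_apply, smul_eq_mul]

theorem cF_zeroExt_test {a b : ℝ} (φ : Test a b) :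
    cF (zeroExt a b (toL2 a b φ)) =ᵐ[volume] ft φ := by
  have h : (Complex.ofRealCLM.compLp (zeroExt a b (toL2 a b φ)) : L2C) = (testSchwartz φ).toLp 2 := by
    apply Lp.ext
    filter_upwards [Complex.ofRealCLM.coeFn_compLp (zeroExt a b (toL2 a b φ)), zeroExt_test_ae_eq φ,
      (testSchwartz φ).coeFn_toLp 2 volume] with x h1 h2 h3
    rw [h1, h2, h3]; rfl
  unfold cF
  rw [h, SchwartzMap.toLp_fourier_eq]
  exact (𝓕 (testSchwartz φ)).coeFn_toLp 2 volume

/-! ### The symbol of the tempered fractional derivative -/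

/-- The symbol `(λ + 2πiξ)^μ`. -/
def sym (lam μ ξ : ℝ) : ℂ := ((lam : ℂ) + (2 * Real.pi * ξ : ℝ) * Complex.I) ^ (μ : ℂ)

theorem measurable_sym (lam μ : ℝ) : Measurable (sym lam μ) := by
  unfold sym; fun_prop

theorem sym_mem_slitPlane {lam ξ : ℝ} (hlam : 0 ≤ lam) (h : lam ≠ 0 ∨ ξ ≠ 0) :
    (lam : ℂ) + (2 * Real.pi * ξ : ℝ) * Complex.I ∈ Complex.slitPlane := by
  rw [Complex.mem_slitPlane_iff]
  rcases h with h | h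
  · left; simp; exact lt_of_le_of_ne hlam h.symm
  · right; simp [h, Real.pi_ne_zero]

theorem norm_sym_base_le {lam : ℝ} (hlam : 0 ≤ lam) (ξ : ℝ) :
    ‖(lam : ℂ) + (2 * Real.pi * ξ : ℝ) * Complex.I‖ ≤ lam + |2 * Real.pi * ξ| := by
  refine (norm_add_le _ _).trans ?_
  rw [Complex.norm_real, norm_mul, Complex.norm_I, mul_one, Complex.norm_real,
    Real.norm_of_nonneg hlam, Real.norm_eq_abs]

theorem norm_sym (lam ξ : ℝ) {μ : ℝ} (hμ : 0 ≤ μ) :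
    ‖sym lam μ ξ‖ = ‖(lam : ℂ) + (2 * Real.pi * ξ : ℝ) * Complex.I‖ ^ μ := by
  unfold sym
  rcases hμ.eq_or_lt with rfl | h
  · simp
  · exact Complex.norm_cpow_real _ _

theorem norm_sym_le {lam μ : ℝ} (hlam : 0 ≤ lam) (hμ0 : 0 ≤ μ) (hμ1 : μ ≤ 1) (ξ : ℝ) :
    ‖sym lam μ ξ‖ ≤ 1 + lam + |2 * Real.pi * ξ| := by
  rw [norm_sym _ _ hμ0]
  have h0 := norm_sym_base_le hlam ξ
  have h2 : 0 ≤ |2 * Real.pi * ξ| := abs_nonneg _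
  calc _ ≤ (1 + lam + |2 * Real.pi * ξ|) ^ μ :=
        Real.rpow_le_rpow (norm_nonneg _) (by linarith) hμ0
    _ ≤ (1 + lam + |2 * Real.pi * ξ|) ^ (1 : ℝ) :=
        Real.rpow_le_rpow_of_exponent_le (by linarith) hμ1
    _ = _ := Real.rpow_one _

/-- Up to order 1 the symbol grows at most linearly, and `ξ φ̂` is, up to a constant, the transform
of `φ'`. So `φ̂` and the transform of `φ'` give one majorant for both `L¹` and `L²`. -/
theorem norm_sym_mul_ft_le {lam μ : ℝ} (hlam : 0 ≤ lam) (hμ0 : 0 ≤ μ) (hμ1 : μ ≤ 1) {a b : ℝ}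
    (φ : Test a b) (ξ : ℝ) :
    ‖sym lam μ ξ * ft φ ξ‖ ≤ ‖(1 + lam) * ‖ft φ ξ‖ + ‖ft (testDeriv φ) ξ‖‖ := by
  rw [Real.norm_of_nonneg (by positivity), norm_mul, ft_testDeriv, norm_mul]
  have : ‖(2 * Real.pi * Complex.I * ξ : ℂ)‖ = |2 * Real.pi * ξ| := by
    simp [abs_mul]
  rw [this, ← add_mul]
  gcongr
  exact norm_sym_le hlam hμ0 hμ1 ξ

theorem integrable_sym_mul_ft {lam μ : ℝ} (hlam : 0 ≤ lam) (hμ0 : 0 ≤ μ) (hμ1 : μ ≤ 1) {a b : ℝ}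
    (φ : Test a b) : Integrable fun ξ => sym lam μ ξ * ft φ ξ :=
  Integrable.mono (((integrable_ft φ).norm.const_mul (1 + lam)).add (integrable_ft (testDeriv φ)).norm)
    ((measurable_sym lam μ).aestronglyMeasurable.mul (continuous_ft φ).aestronglyMeasurable)
    (.of_forall (norm_sym_mul_ft_le hlam hμ0 hμ1 φ))

theorem memLp_sym_mul_ft {lam μ : ℝ} (hlam : 0 ≤ lam) (hμ0 : 0 ≤ μ) (hμ1 : μ ≤ 1) {a b : ℝ}
    (φ : Test a b) : MemLp (fun ξ => sym lam μ ξ * ft φ ξ) 2 :=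
  MemLp.of_le (((memLp_ft φ).norm.const_mul (1 + lam)).add (memLp_ft (testDeriv φ)).norm)
    ((measurable_sym lam μ).aestronglyMeasurable.mul (continuous_ft φ).aestronglyMeasurable)
    (.of_forall (norm_sym_mul_ft_le hlam hμ0 hμ1 φ))

end TemperedFractional
end

noncomputable section
namespace TemperedFractional
open MeasureTheory Set Filter Topology
open scoped FourierTransform Distributions Convolution

/-! ### The Fourier representation of the left derivative -/

/-- The kernel `t ^ (-μ)` on the half line `t > 0`. -/
def fracKernel (μ : ℝ) : ℝ → ℝ := (Ioi 0).indicator fun t => t ^ (-μ)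

theorem measurable_fracKernel (μ : ℝ) : Measurable (fracKernel μ) :=
  Measurable.indicator (by fun_prop) measurableSet_Ioi

theorem fracKernel_of_pos {μ t : ℝ} (ht : 0 < t) : fracKernel μ t = t ^ (-μ) :=
  indicator_of_mem (by exact ht) _

theorem fracKernel_of_nonpos {μ t : ℝ} (ht : t ≤ 0) : fracKernel μ t = 0 :=
  indicator_of_notMem (by simpa using ht) _

theorem locallyIntegrable_fracKernel {μ : ℝ} (hμ : μ < 1) :
    LocallyIntegrable (fracKernel μ) volume := by
  rw [locallyIntegrable_iff]
  intro K hK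
  obtain ⟨R, hR⟩ := hK.isBounded.subset_closedBall 0
  have hsub : K ⊆ Icc (-R) R := by rwa [Real.closedBall_eq_Icc, zero_sub, zero_add] at hR
  refine IntegrableOn.mono_set ?_ hsub
  unfold fracKernel
  rw [IntegrableOn, integrable_indicator_iff measurableSet_Ioi, IntegrableOn,
    Measure.restrict_restrict measurableSet_Ioi]
  have h1 : IntegrableOn (fun t : ℝ => t ^ (-μ)) (Ioc 0 (max R 0)) :=
    (intervalIntegrable_iff_integrableOn_Ioc_of_le (le_max_right _ _)).1
      (intervalIntegral.intervalIntegrable_rpow' (by linarith))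
  exact h1.mono_set fun t ht => ⟨ht.1, ht.2.2.trans (le_max_left _ _)⟩

/-- The test function `e^{λx} φ(x)`. -/
def expTest {a b : ℝ} (lam : ℝ) (φ : Test a b) : Test a b where
  toFun x := Real.exp (lam * x) * φ x
  contDiff' := ContDiff.mul (by fun_prop) φ.contDiff
  hasCompactSupport' := φ.hasCompactSupport.mul_left
  tsupport_subset' := (tsupport_mul_subset_right).trans φ.tsupport_subset

theorem testDeriv_expTest {a b : ℝ} (lam : ℝ) (φ : Test a b) (x : ℝ) :
    testDeriv (expTest lam φ) x = Real.exp (lam * x) * (testDeriv φ + lam • φ : Test a b) x := by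
  have h1 : HasDerivAt (fun x : ℝ => Real.exp (lam * x)) (Real.exp (lam * x) * lam) x := by
    simpa using ((hasDerivAt_id x).const_mul lam).exp
  have h2 := (h1.mul (hasDerivAt_test φ x)).deriv
  change deriv (fun x : ℝ => Real.exp (lam * x) * φ x) x = _
  refine h2.trans ?_
  simp
  ring

theorem integral_fracKernel_eq {a b μ : ℝ} (ψ : Test a b) (y : ℝ) :
    ∫ ξ in a..y, ψ ξ * (y - ξ) ^ (-μ) = (fracKernel μ ⋆[ContinuousLinearMap.mul ℝ ℝ] ψ) y := by
  rw [convolution_def, ← integral_sub_left_eq_self _ _ y]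
  simp only [ContinuousLinearMap.mul_apply', sub_sub_cancel]
  rcases le_or_gt a y with hy | hy
  · rw [intervalIntegral.integral_of_le hy, integral_Ioc_eq_integral_Ioo,
      ← integral_indicator measurableSet_Ioo]
    refine integral_congr_ae ?_
    filter_upwards with ξ
    by_cases hξ : ξ ∈ Ioo a y
    · rw [indicator_of_mem hξ, fracKernel_of_pos (sub_pos.2 hξ.2), mul_comm]
    · rw [indicator_of_notMem hξ]
      rcases le_or_gt ξ a with h | h
      · rw [test_eq_zero_of_notMem ψ fun h' => absurd h'.1 (not_lt.2 h), mul_zero]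
      · rw [fracKernel_of_nonpos (by
          have : ¬ ξ < y := fun h2 => hξ ⟨h, h2⟩
          linarith), zero_mul]
  · rw [intervalIntegral.integral_of_ge hy.le]
    have h1 : ∫ ξ in Ioc y a, ψ ξ * (y - ξ) ^ (-μ) = 0 := by
      refine setIntegral_eq_zero_of_forall_eq_zero fun ξ hξ => ?_
      rw [test_eq_zero_of_notMem ψ fun h' => absurd h'.1 (not_lt.2 hξ.2), zero_mul]
    rw [h1, neg_zero]
    symm
    refine integral_eq_zero_of_ae (.of_forall fun ξ => ?_)
    rcases le_or_gt ξ y with h | h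
    · simp [test_eq_zero_of_notMem ψ fun h' => absurd h'.1 (not_lt.2 (h.trans hy.le))]
    · simp [fracKernel_of_nonpos (μ := μ) (sub_nonpos.2 h.le)]

/-- For `μ < 1` there is one outer derivative. The singular integral is a convolution of `t^(-μ)` on
`t > 0` with `e^(λx) φ`, so the derivative falls on the smooth factor; the exponentials then combine
into `e^(-λt)` and the operator `φ' + λφ`. -/
theorem leftDeriv_eq_integral {a b μ lam : ℝ} (hμ1 : μ < 1) (φ : Test a b) (x : ℝ) :
    leftDeriv a μ lam φ x = (Real.Gamma (1 - μ))⁻¹ * ∫ t, fracKernel μ t * Real.exp (-lam * t) *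
      (testDeriv φ + lam • φ : Test a b) (x - t) := by
  have hn : ⌊μ⌋₊ = 0 := Nat.floor_eq_zero.2 hμ1
  unfold leftDeriv
  simp only [hn, zero_add, iteratedDeriv_one, Nat.cast_one]
  have h1 : (fun y => ∫ ξ in a..y, Real.exp (lam * ξ) * φ ξ * (y - ξ) ^ (1 - μ - 1))
      = fracKernel μ ⋆[ContinuousLinearMap.mul ℝ ℝ] expTest lam φ := by
    ext y
    rw [← integral_fracKernel_eq]
    have : 1 - μ - 1 = -μ := by ring
    rw [this]; rfl
  rw [h1, (HasCompactSupport.hasDerivAt_convolution_right _ (locallyIntegrable_fracKernel hμ1)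
    (expTest lam φ).hasCompactSupport ((expTest lam φ).contDiff.of_le (by simp)) x).deriv,
    convolution_def]
  rw [div_mul_eq_mul_div, div_eq_inv_mul, ← integral_const_mul]
  congr 1
  refine integral_congr_ae (.of_forall fun t => ?_)
  simp only [ContinuousLinearMap.mul_apply']
  rw [← testDeriv_apply, testDeriv_expTest]
  have : Real.exp (-lam * t) = Real.exp (-lam * x) * Real.exp (lam * (x - t)) := by
    rw [← Real.exp_add]; congr 1; ring
  rw [this]; ring

/-- At `μ = 1` the definition has `n = 2`, kernel exponent 0 and Gamma factor 1: two derivatives of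
a primitive. -/
theorem leftDeriv_one {a b lam : ℝ} (φ : Test a b) (x : ℝ) :
    leftDeriv a 1 lam φ x = (testDeriv φ + lam • φ : Test a b) x := by
  unfold leftDeriv
  have hn : ⌊(1 : ℝ)⌋₊ = 1 := by simp
  simp only [hn]
  have h1 : (fun y => ∫ ξ in a..y, Real.exp (lam * ξ) * φ ξ * (y - ξ) ^ (((1 + 1 : ℕ) : ℝ) - 1 - 1))
      = fun y => ∫ ξ in a..y, expTest lam φ ξ := by
    ext y
    refine intervalIntegral.integral_congr fun ξ _ => ?_
    norm_num
    rfl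
  have h2 : deriv (fun y => ∫ ξ in a..y, expTest lam φ ξ) = expTest lam φ := by
    ext y
    exact (expTest lam φ).continuous.deriv_integral _ a y
  rw [h1, iteratedDeriv_succ, iteratedDeriv_one, h2, ← testDeriv_apply, testDeriv_expTest]
  norm_num
  rw [← mul_assoc, ← Real.exp_add]
  simp

theorem ft_shift {a b lam : ℝ} (φ : Test a b) (ξ : ℝ) : ft (testDeriv φ + lam • φ : Test a b) ξ
    = ((lam : ℂ) + (2 * Real.pi * ξ : ℝ) * Complex.I) * ft φ ξ := by
  rw [ft_add, ft_smul, ft_testDeriv]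
  push_cast; ring

theorem fourier_fracKernel {μ lam : ℝ} (hμ : μ < 1) (hlam : 0 < lam) (ξ : ℝ) :
    𝓕 (fun t : ℝ => ((fracKernel μ t * Real.exp (-lam * t) : ℝ) : ℂ)) ξ
      = ((lam : ℂ) + (2 * Real.pi * ξ : ℝ) * Complex.I) ^ ((μ : ℂ) - 1) * Real.Gamma (1 - μ) := by
  rw [← laplace_rpow hμ (by simpa using hlam), Real.fourier_real_eq_integral_exp_smul,
    ← integral_indicator measurableSet_Ioi]
  refine integral_congr_ae (.of_forall fun t => ?_)
  simp only
  rcases le_or_gt t 0 with ht | ht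
  · rw [fracKernel_of_nonpos ht, indicator_of_notMem (by simpa using ht)]; simp
  · rw [fracKernel_of_pos ht, indicator_of_mem (by exact ht), smul_eq_mul]
    push_cast
    rw [mul_left_comm, ← Complex.exp_add]
    congr 2
    ring

theorem integrable_fracKernel_mul_exp {μ lam : ℝ} (hμ : μ < 1) (hlam : 0 < lam) :
    Integrable fun t : ℝ => fracKernel μ t * Real.exp (-lam * t) := by
  have h := (integrable_indicator_iff (measurableSet_Ioi (a := (0 : ℝ)))).2
    (integrableOn_rpow_mul_exp_neg (s := -μ) (by linarith) hlam)
  refine h.congr (.of_forall fun t => ?_)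
  rcases le_or_gt t 0 with ht | ht
  · simp [fracKernel_of_nonpos ht, ht]
  · simp [fracKernel_of_pos ht, ht]

/-- For `λ > 0` the tempered kernel is integrable, and its transform at `z = λ + 2πiξ` is `Γ(1-μ)
z^(μ-1)`. The shifted derivative `φ' + λφ` contributes the missing factor `z`. -/
theorem leftDeriv_eq_fourierInv_of_pos {a b μ lam : ℝ} (hμ1 : μ < 1) (hlam : 0 < lam)
    (φ : Test a b) (x : ℝ) :
    (leftDeriv a μ lam φ x : ℂ) = 𝓕⁻ (fun ξ => sym lam μ ξ * ft φ ξ) x := by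
  set g : Test a b := testDeriv φ + lam • φ with hg
  -- By Fourier inversion the transform of `h` is `t ↦ g (x - t)`, so the convolution at `x` becomes
  -- a pairing to which self-duality of the transform applies.
  set h : ℝ → ℂ := fun ξ => Complex.exp ((2 * Real.pi * (x * ξ) : ℝ) * Complex.I) * ft g ξ with hh
  have hhi : Integrable h := by
    refine (integrable_ft g).mono (Continuous.aestronglyMeasurable ?_) (.of_forall fun ξ => ?_)
    · exact Continuous.mul (by fun_prop) (continuous_ft g)
    · rw [norm_mul, Complex.norm_exp_ofReal_mul_I, one_mul]
  have hF : ∀ t, 𝓕 h t = g (x - t) := fun t => by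
    rw [← fourierInv_ft g, Real.fourier_real_eq_integral_exp_smul, Real.fourierInv_eq']
    refine integral_congr_ae (.of_forall fun ξ => ?_)
    simp only [hh, smul_eq_mul]
    rw [← mul_assoc, ← Complex.exp_add]
    congr 2
    simp
    ring
  have hK := (integrable_fracKernel_mul_exp hμ1 hlam).ofReal (𝕜 := ℂ)
  have hfl := integral_fourier_mul_eq_flip hK hhi
  rw [leftDeriv_eq_integral hμ1, Complex.ofReal_mul, ← integral_complex_ofReal]
  have e1 : ∫ t, ((fracKernel μ t * Real.exp (-lam * t) * g (x - t) : ℝ) : ℂ)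
      = ∫ t, ((fracKernel μ t * Real.exp (-lam * t) : ℝ) : ℂ) * 𝓕 h t := by
    refine integral_congr_ae (.of_forall fun t => ?_)
    simp only [hF]
    push_cast; rfl
  have hΓ : (Real.Gamma (1 - μ) : ℂ) ≠ 0 := by
    exact_mod_cast (Real.Gamma_pos_of_pos (by linarith)).ne'
  rw [e1]
  refine (congrArg _ hfl.symm).trans ?_
  rw [← integral_const_mul, Real.fourierInv_eq']
  refine integral_congr_ae (.of_forall fun ξ => ?_)
  simp only [hh]
  have hz := Complex.slitPlane_ne_zero (sym_mem_slitPlane (ξ := ξ) hlam.le (Or.inl hlam.ne'))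
  have hF2 := fourier_fracKernel hμ1 hlam ξ
  rw [show (fun t : ℝ => (RCLike.ofReal (fracKernel μ t * Real.exp (-lam * t)) : ℂ))
    = fun t : ℝ => ((fracKernel μ t * Real.exp (-lam * t) : ℝ) : ℂ) from rfl, hF2, hg, ft_shift]
  unfold sym
  rw [Complex.cpow_sub _ _ hz, Complex.cpow_one]
  simp only [smul_eq_mul]
  have e3 : (inner ℝ ξ x : ℝ) = x * ξ := by simp
  rw [e3]
  generalize (lam : ℂ) + (2 * Real.pi * ξ : ℝ) * Complex.I = z at hz
  rw [Complex.ofReal_inv]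
  field_simp

end TemperedFractional
end

/-! ### The Fourier representation for all orders in `[0, 1]` and all `λ ≥ 0` -/

noncomputable section
namespace TemperedFractional
open MeasureTheory Set Filter Topology
open scoped ENNReal FourierTransform Distributions NNReal SchwartzMap

theorem integrable_fracKernel_mul_test {μ : ℝ} (hμ : μ < 1) {a b : ℝ} (ψ : Test a b) (x : ℝ) :
    Integrable fun t => fracKernel μ t * ψ (x - t) :=
  HasCompactSupport.convolutionExists_right (ContinuousLinearMap.mul ℝ ℝ) ψ.hasCompactSupport
    (locallyIntegrable_fracKernel hμ) ψ.continuous x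

theorem tendsto_leftDeriv_zero {a b μ : ℝ} (hμ1 : μ < 1) (φ : Test a b) (x : ℝ) :
    Tendsto (fun lam => leftDeriv a μ lam φ x) (𝓝[>] 0) (𝓝 (leftDeriv a μ 0 φ x)) := by
  simp only [leftDeriv_eq_integral hμ1]
  refine Tendsto.const_mul _ ?_
  refine tendsto_integral_filter_of_dominated_convergence
    (fun t => ‖fracKernel μ t * testDeriv φ (x - t)‖ + ‖fracKernel μ t * φ (x - t)‖) ?_ ?_ ?_ ?_
  · refine .of_forall fun lam => Measurable.aestronglyMeasurable ?_
    have h1 : Measurable fun t => (testDeriv φ + lam • φ : Test a b) (x - t) :=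
      ((testDeriv φ + lam • φ : Test a b).continuous.comp (by fun_prop)).measurable
    exact ((measurable_fracKernel μ).mul (by fun_prop)).mul h1
  · filter_upwards [Ioc_mem_nhdsGT (zero_lt_one (α := ℝ))] with lam hlam
    refine .of_forall fun t => ?_
    rcases le_or_gt t 0 with ht | ht
    · simp [fracKernel_of_nonpos ht]
    have e : (testDeriv φ + lam • φ : Test a b) (x - t) = testDeriv φ (x - t) + lam * φ (x - t) := rfl
    have h1 : Real.exp (-lam * t) ≤ 1 := Real.exp_le_one_iff.2 (by nlinarith [hlam.1])
    rw [e, norm_mul, norm_mul, norm_mul, norm_mul, ← mul_add, Real.norm_of_nonneg (Real.exp_pos _).le]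
    calc _ ≤ ‖fracKernel μ t‖ * 1 * (‖testDeriv φ (x - t)‖ + ‖φ (x - t)‖) := by
          gcongr
          refine (norm_add_le _ _).trans ?_
          gcongr
          rw [norm_mul, Real.norm_of_nonneg hlam.1.le]
          exact mul_le_of_le_one_left (norm_nonneg _) hlam.2
      _ = _ := by ring
  · exact (integrable_fracKernel_mul_test hμ1 _ x).norm.add
      (integrable_fracKernel_mul_test hμ1 _ x).norm
  · refine .of_forall fun t => ?_
    have hc : Continuous fun lam : ℝ => fracKernel μ t * Real.exp (-lam * t) *
        (testDeriv φ (x - t) + lam * φ (x - t)) := by fun_prop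
    exact (hc.tendsto 0).mono_left nhdsWithin_le_nhds

/-- For `λ = 0` the kernel is no longer integrable at infinity. The formula is obtained as the limit
`λ → 0+` of both sides by dominated convergence; order 1 is treated directly. -/
theorem leftDeriv_eq_fourierInv {a b μ lam : ℝ} (hμ0 : 0 ≤ μ) (hμ1 : μ ≤ 1) (hlam : 0 ≤ lam)
    (φ : Test a b) (x : ℝ) :
    (leftDeriv a μ lam φ x : ℂ) = 𝓕⁻ (fun ξ => sym lam μ ξ * ft φ ξ) x := by
  rcases hμ1.eq_or_lt with rfl | hμ1'
  · have h : ft (testDeriv φ + lam • φ : Test a b) = fun ξ => sym lam 1 ξ * ft φ ξ := by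
      ext ξ
      rw [ft_shift]; simp [sym]
    rw [leftDeriv_one, ← fourierInv_ft, h]
  rcases hlam.eq_or_lt with rfl | hlam'
  swap
  · exact leftDeriv_eq_fourierInv_of_pos hμ1' hlam' φ x
  have h1 := (Complex.continuous_ofReal.tendsto _).comp (tendsto_leftDeriv_zero hμ1' φ x)
  refine tendsto_nhds_unique h1 ?_
  have h2 : Tendsto (fun lam : ℝ => 𝓕⁻ (fun ξ => sym lam μ ξ * ft φ ξ) x) (𝓝[>] 0)
      (𝓝 (𝓕⁻ (fun ξ => sym 0 μ ξ * ft φ ξ) x)) := by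
    simp only [Real.fourierInv_eq', smul_eq_mul]
    refine tendsto_integral_filter_of_dominated_convergence
      (fun ξ => ‖(1 + 1) * ‖ft φ ξ‖ + ‖ft (testDeriv φ) ξ‖‖) ?_ ?_ ?_ ?_
    · refine .of_forall fun lam => Measurable.aestronglyMeasurable ?_
      exact Measurable.mul (by fun_prop) ((measurable_sym lam μ).mul (continuous_ft φ).measurable)
    · filter_upwards [Ioc_mem_nhdsGT (zero_lt_one (α := ℝ))] with lam hlam
      refine .of_forall fun ξ => ?_
      rw [norm_mul, Complex.norm_exp_ofReal_mul_I, one_mul]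
      refine (norm_sym_mul_ft_le hlam.1.le hμ0 hμ1 φ ξ).trans ?_
      rw [Real.norm_of_nonneg (by have := hlam.1; positivity), Real.norm_of_nonneg (by positivity)]
      gcongr
      exact hlam.2
    · exact (((integrable_ft φ).norm.const_mul (1 + 1)).add (integrable_ft (testDeriv φ)).norm).norm
    · filter_upwards [compl_mem_ae_iff.2 (measure_singleton (0 : ℝ))] with ξ hξ
      refine Tendsto.const_mul _ (Tendsto.mul_const _ ?_)
      have hz := sym_mem_slitPlane (lam := 0) (ξ := ξ) le_rfl (Or.inr hξ)
      have hc : ContinuousAt (fun lam : ℝ => sym lam μ ξ) 0 := by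
        unfold sym
        exact ContinuousAt.cpow (by fun_prop) continuousAt_const hz
      exact hc.tendsto.mono_left nhdsWithin_le_nhds
  refine h2.congr' ?_
  filter_upwards [self_mem_nhdsWithin] with lam hlam
  exact (leftDeriv_eq_fourierInv_of_pos hμ1' hlam φ x).symm

/-- The kernel is causal: at `x ≤ a` it sees only values of `φ` and `φ'` to the left of `x`, where
they vanish. -/
theorem leftDeriv_eq_zero {a b μ lam x : ℝ} (hμ1 : μ ≤ 1) (φ : Test a b)
    (hx : x ≤ a) : leftDeriv a μ lam φ x = 0 := by
  have h0 : ∀ (ψ : Test a b) y, y ≤ a → ψ y = 0 := fun ψ y hy =>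
    test_eq_zero_of_notMem ψ fun h => absurd h.1 (not_lt.2 hy)
  rcases hμ1.eq_or_lt with rfl | hμ1'
  · rw [leftDeriv_one]; exact h0 _ _ hx
  · rw [leftDeriv_eq_integral hμ1', integral_eq_zero_of_ae, mul_zero]
    refine .of_forall fun t => ?_
    rcases le_or_gt t 0 with ht | ht
    · simp [fracKernel_of_nonpos ht]
    · have := h0 (testDeriv φ + lam • φ) (x - t) (by linarith)
      simp only [this, mul_zero, Pi.zero_apply]

/-! ### The right derivative -/

/-- The reflection of a test function. -/
def testNeg {a b : ℝ} (φ : Test a b) : Test (-b) (-a) where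
  toFun x := φ (-x)
  contDiff' := φ.contDiff.comp contDiff_neg
  hasCompactSupport' := φ.hasCompactSupport.comp_homeomorph (Homeomorph.neg ℝ)
  tsupport_subset' := by
    intro x hx
    have h1 : tsupport (fun x => φ (-x)) = (Homeomorph.neg ℝ) ⁻¹' tsupport φ :=
      tsupport_comp_eq_preimage φ (Homeomorph.neg ℝ)
    rw [h1] at hx
    have h2 : -x ∈ Ioo a b := φ.tsupport_subset hx
    exact ⟨by linarith [h2.2], by linarith [h2.1]⟩

theorem testNeg_apply {a b : ℝ} (φ : Test a b) (x : ℝ) : testNeg φ x = φ (-x) := rfl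

theorem ft_testNeg {a b : ℝ} (φ : Test a b) (ξ : ℝ) : ft (testNeg φ) ξ = ft φ (-ξ) := by
  rw [ft_eq, ft_eq, ← Real.fourierInv_eq_fourier_neg, Real.fourierInv_eq_fourier_comp_neg]
  rfl

/-- Reflection `x ↦ -x` exchanges the two one-sided integrals, and the sign `(-1)^n` cancels the one
produced by `n` derivatives. All facts about right derivatives come from here. -/
theorem rightDeriv_eq_leftDeriv {a b μ lam : ℝ} (φ : Test a b) (x : ℝ) :
    rightDeriv b μ lam φ x = leftDeriv (-b) μ lam (testNeg φ) (-x) := by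
  unfold rightDeriv leftDeriv
  set r : ℝ := ((⌊μ⌋₊ + 1 : ℕ) : ℝ) - μ - 1
  set g : ℝ → ℝ := fun z => ∫ ξ in (-b)..z, Real.exp (lam * ξ) * testNeg φ ξ * (z - ξ) ^ r with hg
  have h1 : (fun y => ∫ ξ in y..b, Real.exp (-lam * ξ) * φ ξ * (ξ - y) ^ r) = fun y => g (-y) := by
    ext y
    have e := intervalIntegral.integral_comp_neg (a := y) (b := b)
      (fun ξ => Real.exp (lam * ξ) * testNeg φ ξ * (-y - ξ) ^ r)
    simp only [hg]
    rw [← e]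
    refine intervalIntegral.integral_congr fun ξ _ => ?_
    have e1 : lam * -ξ = -lam * ξ := by ring
    have e2 : -y - -ξ = ξ - y := by ring
    simp only [testNeg_apply, neg_neg, e1, e2]
  change _ * (_ * iteratedDeriv (⌊μ⌋₊ + 1)
    (fun y => ∫ ξ in y..b, Real.exp (-lam * ξ) * φ ξ * (ξ - y) ^ r) x)
    = _ * iteratedDeriv (⌊μ⌋₊ + 1) g (-x)
  rw [h1, iteratedDeriv_comp_neg _ g x, smul_eq_mul, ← mul_assoc ((-1 : ℝ) ^ _), ← mul_pow]
  simp

theorem rightDeriv_eq_fourierInv {a b μ lam : ℝ} (hμ0 : 0 ≤ μ) (hμ1 : μ ≤ 1) (hlam : 0 ≤ lam)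
    (φ : Test a b) (x : ℝ) :
    (rightDeriv b μ lam φ x : ℂ) = 𝓕⁻ (fun ξ => sym lam μ (-ξ) * ft φ ξ) x := by
  rw [rightDeriv_eq_leftDeriv, leftDeriv_eq_fourierInv hμ0 hμ1 hlam, Real.fourierInv_eq',
    Real.fourierInv_eq', ← integral_neg_eq_self]
  refine integral_congr_ae (.of_forall fun ξ => ?_)
  simp only [ft_testNeg, neg_neg, inner_neg_neg]

theorem rightDeriv_eq_zero {a b μ lam x : ℝ} (hμ1 : μ ≤ 1) (φ : Test a b)
    (hx : b ≤ x) : rightDeriv b μ lam φ x = 0 := by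
  rw [rightDeriv_eq_leftDeriv]
  exact leftDeriv_eq_zero hμ1 _ (by linarith)

theorem memLp_sym_neg_mul_ft {lam μ : ℝ} (hlam : 0 ≤ lam) (hμ0 : 0 ≤ μ) (hμ1 : μ ≤ 1) {a b : ℝ}
    (φ : Test a b) : MemLp (fun ξ => sym lam μ (-ξ) * ft φ ξ) 2 := by
  have h := (memLp_sym_mul_ft hlam hμ0 hμ1 (testNeg φ)).comp_measurePreserving
    (Measure.measurePreserving_neg (volume : Measure ℝ))
  simpa [Function.comp_def, ft_testNeg] using! h

theorem integrable_sym_neg_mul_ft {lam μ : ℝ} (hlam : 0 ≤ lam) (hμ0 : 0 ≤ μ) (hμ1 : μ ≤ 1)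
    {a b : ℝ} (φ : Test a b) : Integrable fun ξ => sym lam μ (-ξ) * ft φ ξ := by
  have h := (integrable_sym_mul_ft hlam hμ0 hμ1 (testNeg φ)).comp_neg
  simpa [ft_testNeg] using! h

/-! ### Plancherel's identity for the fractional derivatives -/

theorem memLp_fourierInv {F : ℝ → ℂ} (h1 : Integrable F) (h2 : MemLp F 2) : MemLp (𝓕⁻ F) 2 :=
  (memLp_congr_ae (fourierInv_toLp_ae_eq h1 h2)).1 (Lp.memLp _)

theorem eLpNorm_fourierInv {F : ℝ → ℂ} (h1 : Integrable F) (h2 : MemLp F 2) :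
    eLpNorm (𝓕⁻ F) 2 = eLpNorm F 2 := by
  have h : ‖(𝓕⁻ (h2.toLp F) : L2C)‖ = ‖h2.toLp F‖ := (Lp.fourierTransformₗᵢ ℝ ℂ).symm.norm_map _
  rw [← eLpNorm_congr_ae (fourierInv_toLp_ae_eq h1 h2), ← Lp.enorm_def, ← ofReal_norm, h, ofReal_norm,
    Lp.enorm_toLp]

theorem integral_fourierInv_mul_conj {F G : ℝ → ℂ} (hF1 : Integrable F) (hF2 : MemLp F 2)
    (hG1 : Integrable G) (hG2 : MemLp G 2) :
    ∫ x, 𝓕⁻ F x * (starRingEnd ℂ) (𝓕⁻ G x) = ∫ ξ, F ξ * (starRingEnd ℂ) (G ξ) := by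
  have h : inner ℂ (𝓕⁻ (hG2.toLp G) : L2C) (𝓕⁻ (hF2.toLp F) : L2C)
      = inner ℂ (hG2.toLp G) (hF2.toLp F) := (Lp.fourierTransformₗᵢ ℝ ℂ).symm.inner_map_map _ _
  rw [L2.inner_def, L2.inner_def] at h
  have e1 : ∫ x, 𝓕⁻ F x * (starRingEnd ℂ) (𝓕⁻ G x)
      = ∫ x, inner ℂ ((𝓕⁻ (hG2.toLp G) : L2C) x) ((𝓕⁻ (hF2.toLp F) : L2C) x) := by
    refine integral_congr_ae ?_
    filter_upwards [fourierInv_toLp_ae_eq hF1 hF2, fourierInv_toLp_ae_eq hG1 hG2] with x a1 a2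
    rw [a1, a2]; simp
  rw [e1, h]
  refine integral_congr_ae ?_
  filter_upwards [hF2.coeFn_toLp, hG2.coeFn_toLp] with x a1 a2
  rw [a1, a2]; simp

theorem memLp_of_ofReal {f : ℝ → ℝ} (h : MemLp (fun x => (f x : ℂ)) 2 (volume : Measure ℝ)) :
    MemLp f 2 := by simpa using h.re

theorem eLpNorm_ofReal (f : ℝ → ℝ) (ν : Measure ℝ) :
    eLpNorm (fun x => (f x : ℂ)) 2 ν = eLpNorm f 2 ν :=
  eLpNorm_congr_norm_ae (.of_forall fun x => by simp)

theorem memLp_leftDeriv {a b μ lam : ℝ} (hμ0 : 0 ≤ μ) (hμ1 : μ ≤ 1) (hlam : 0 ≤ lam)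
    (φ : Test a b) : MemLp (leftDeriv a μ lam φ) 2 := by
  apply memLp_of_ofReal
  simp only [leftDeriv_eq_fourierInv hμ0 hμ1 hlam]
  exact memLp_fourierInv (integrable_sym_mul_ft hlam hμ0 hμ1 φ) (memLp_sym_mul_ft hlam hμ0 hμ1 φ)

theorem memLp_rightDeriv {a b μ lam : ℝ} (hμ0 : 0 ≤ μ) (hμ1 : μ ≤ 1) (hlam : 0 ≤ lam)
    (φ : Test a b) : MemLp (rightDeriv b μ lam φ) 2 := by
  apply memLp_of_ofReal
  simp only [rightDeriv_eq_fourierInv hμ0 hμ1 hlam]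
  exact memLp_fourierInv (integrable_sym_neg_mul_ft hlam hμ0 hμ1 φ)
    (memLp_sym_neg_mul_ft hlam hμ0 hμ1 φ)

theorem toL2_ae_eq {a b : ℝ} {f : ℝ → ℝ} (hf : MemLp f 2 ((volume : Measure ℝ).restrict (Ioo a b))) :
    ∀ᵐ x ∂((volume : Measure ℝ).restrict (Ioo a b)), toL2 a b f x = f x := by
  unfold toL2
  rw [dif_pos hf]
  exact hf.coeFn_toLp

theorem enorm_toL2_le {a b : ℝ} {f : ℝ → ℝ} (hf : MemLp f 2) :
    ‖toL2 a b f‖ₑ ≤ eLpNorm f 2 := by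
  rw [Lp.enorm_def, eLpNorm_congr_ae (toL2_ae_eq (hf.mono_measure Measure.restrict_le_self))]
  exact eLpNorm_mono_measure _ Measure.restrict_le_self

theorem enorm_leftDeriv_le {a b μ lam : ℝ} (hμ0 : 0 ≤ μ) (hμ1 : μ ≤ 1) (hlam : 0 ≤ lam)
    (φ : Test a b) : ‖toL2 a b (leftDeriv a μ lam φ)‖ₑ ≤ eLpNorm (fun ξ => sym lam μ ξ * ft φ ξ) 2 := by
  refine (enorm_toL2_le (memLp_leftDeriv hμ0 hμ1 hlam φ)).trans (le_of_eq ?_)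
  rw [← eLpNorm_ofReal]
  simp only [leftDeriv_eq_fourierInv hμ0 hμ1 hlam]
  exact eLpNorm_fourierInv (integrable_sym_mul_ft hlam hμ0 hμ1 φ) (memLp_sym_mul_ft hlam hμ0 hμ1 φ)

theorem enorm_rightDeriv_le {a b μ lam : ℝ} (hμ0 : 0 ≤ μ) (hμ1 : μ ≤ 1) (hlam : 0 ≤ lam)
    (φ : Test a b) :
    ‖toL2 a b (rightDeriv b μ lam φ)‖ₑ ≤ eLpNorm (fun ξ => sym lam μ (-ξ) * ft φ ξ) 2 := by
  refine (enorm_toL2_le (memLp_rightDeriv hμ0 hμ1 hlam φ)).trans (le_of_eq ?_)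
  rw [← eLpNorm_ofReal]
  simp only [rightDeriv_eq_fourierInv hμ0 hμ1 hlam]
  exact eLpNorm_fourierInv (integrable_sym_neg_mul_ft hlam hμ0 hμ1 φ)
    (memLp_sym_neg_mul_ft hlam hμ0 hμ1 φ)

theorem conj_sym_neg {lam μ ξ : ℝ} (hlam : 0 ≤ lam) (hξ : ξ ≠ 0) :
    (starRingEnd ℂ) (sym lam μ (-ξ)) = sym lam μ ξ := by
  unfold sym
  have hz := sym_mem_slitPlane (ξ := -ξ) hlam (Or.inr (neg_ne_zero.2 hξ))
  have h := Complex.conj_cpow _ (μ : ℂ) (Complex.mem_slitPlane_iff_arg.1 hz).1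
  rw [Complex.conj_ofReal] at h
  rw [← h]
  simp [show (starRingEnd ℂ) 2 = 2 from Complex.conj_ofNat 2]

/-- The pairing of a left and a right derivative in `L²(a, b)`. -/
theorem inner_leftDeriv_rightDeriv {a b μ ν lam : ℝ} (hμ0 : 0 ≤ μ) (hμ1 : μ ≤ 1) (hν0 : 0 ≤ ν)
    (hν1 : ν ≤ 1) (hlam : 0 ≤ lam) (φ ψ : Test a b) :
    ((inner ℝ (toL2 a b (leftDeriv a μ lam φ)) (toL2 a b (rightDeriv b ν lam ψ)) : ℝ) : ℂ)
      = ∫ ξ, sym lam (μ + ν) ξ * (ft φ ξ * (starRingEnd ℂ) (ft ψ ξ)) := by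
  have hL := memLp_leftDeriv hμ0 hμ1 hlam φ
  have hR := memLp_rightDeriv hν0 hν1 hlam ψ
  have e1 : (inner ℝ (toL2 a b (leftDeriv a μ lam φ)) (toL2 a b (rightDeriv b ν lam ψ)) : ℝ)
      = ∫ x, leftDeriv a μ lam φ x * rightDeriv b ν lam ψ x := by
    -- Each factor alone may be nonzero outside `(a, b)`, but on opposite sides, so the product
    -- vanishes there and Plancherel on the whole line applies.
    have e := setIntegral_eq_integral_of_forall_compl_eq_zero (s := Ioo a b)
      (μ := (volume : Measure ℝ))
      (f := fun x => leftDeriv a μ lam φ x * rightDeriv b ν lam ψ x) fun x hx => by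
        rcases le_or_gt x a with h | h
        · rw [leftDeriv_eq_zero hμ1 φ h, zero_mul]
        · rw [rightDeriv_eq_zero hν1 ψ (by by_contra h'; exact hx ⟨h, not_le.1 h'⟩), mul_zero]
    rw [L2.inner_def, ← e]
    refine integral_congr_ae ?_
    filter_upwards [toL2_ae_eq (hL.mono_measure Measure.restrict_le_self),
      toL2_ae_eq (hR.mono_measure Measure.restrict_le_self)] with x a1 a2
    rw [a1, a2]
    simp [mul_comm]
  rw [e1, ← integral_complex_ofReal]
  have e2 : ∫ x, ((leftDeriv a μ lam φ x * rightDeriv b ν lam ψ x : ℝ) : ℂ)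
      = ∫ x, 𝓕⁻ (fun ξ => sym lam μ ξ * ft φ ξ) x *
        (starRingEnd ℂ) (𝓕⁻ (fun ξ => sym lam ν (-ξ) * ft ψ ξ) x) := by
    refine integral_congr_ae (.of_forall fun x => ?_)
    simp only
    rw [← leftDeriv_eq_fourierInv hμ0 hμ1 hlam, ← rightDeriv_eq_fourierInv hν0 hν1 hlam,
      Complex.conj_ofReal, Complex.ofReal_mul]
  rw [e2, integral_fourierInv_mul_conj (integrable_sym_mul_ft hlam hμ0 hμ1 φ)
    (memLp_sym_mul_ft hlam hμ0 hμ1 φ) (integrable_sym_neg_mul_ft hlam hν0 hν1 ψ)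
    (memLp_sym_neg_mul_ft hlam hν0 hν1 ψ)]
  refine integral_congr_ae ?_
  -- Off `ξ = 0` the base of the powers is nonzero, so exponents add; conjugation turns the right
  -- symbol at `-ξ` into the left symbol at `ξ`.
  filter_upwards [compl_mem_ae_iff.2 (measure_singleton (0 : ℝ))] with ξ hξ
  have hξ0 : ξ ≠ 0 := hξ
  have hz := Complex.slitPlane_ne_zero (sym_mem_slitPlane (ξ := ξ) hlam (Or.inr hξ0))
  have e3 : sym lam (μ + ν) ξ = sym lam μ ξ * sym lam ν ξ := by
    unfold sym
    rw [Complex.ofReal_add, Complex.cpow_add _ _ hz]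
  rw [map_mul, conj_sym_neg hlam hξ0, e3]
  ring

/-! ### Bounds on test functions -/

theorem enorm_zeroExt {a b : ℝ} (u : L2 a b) : ‖zeroExt a b u‖ₑ = ‖u‖ₑ := by
  rw [← ofReal_norm, ← ofReal_norm, LinearIsometry.norm_map]

theorem eLpNorm_ft {a b : ℝ} (φ : Test a b) : eLpNorm (ft φ) 2 = ‖toL2 a b φ‖ₑ := by
  rw [← enorm_zeroExt, ← ofReal_norm, ← norm_cF, ofReal_norm, Lp.enorm_def,
    eLpNorm_congr_ae (cF_zeroExt_test φ)]

theorem norm_sym_zero {μ : ℝ} (hμ : 0 ≤ μ) (ξ : ℝ) : ‖sym 0 μ ξ‖ = |2 * Real.pi * ξ| ^ μ := by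
  rw [norm_sym 0 ξ hμ]
  congr 1
  simp [abs_mul]

/-- Subadditivity of `t ↦ t^μ` for `0 ≤ μ ≤ 1` separates the tempering parameter from the frequency.
-/
theorem norm_sym_le_add {lam μ : ℝ} (hlam : 0 ≤ lam) (hμ0 : 0 ≤ μ) (hμ1 : μ ≤ 1) (ξ : ℝ) :
    ‖sym lam μ ξ‖ ≤ lam ^ μ + ‖sym 0 μ ξ‖ := by
  rw [norm_sym _ _ hμ0, norm_sym_zero hμ0]
  exact (Real.rpow_le_rpow (norm_nonneg _) (norm_sym_base_le hlam ξ) hμ0).trans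
    (Real.rpow_add_le_add_rpow hlam (abs_nonneg _) hμ0 hμ1)

theorem norm_sym_neg {lam μ : ℝ} (hμ0 : 0 ≤ μ) (ξ : ℝ) : ‖sym lam μ (-ξ)‖ = ‖sym lam μ ξ‖ := by
  rw [norm_sym _ _ hμ0, norm_sym _ _ hμ0]
  congr 1
  rw [Complex.norm_add_mul_I, Complex.norm_add_mul_I]
  congr 1; ring

theorem eLpNorm_sym_zero_mul_ft_sq {μ : ℝ} (hμ0 : 0 ≤ μ) {a b : ℝ} (φ : Test a b) :
    eLpNorm (fun ξ => sym 0 μ ξ * ft φ ξ) 2 ^ 2 = energy μ (zeroExt a b (toL2 a b φ)) := by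
  rw [eLpNorm_two_sq, energy]
  refine lintegral_congr_ae ?_
  filter_upwards [cF_zeroExt_test φ] with ξ h
  rw [h, enorm_mul, mul_pow, ← ofReal_norm, norm_sym_zero hμ0, ← ENNReal.ofReal_pow (by positivity),
    ← Real.rpow_mul_natCast (abs_nonneg _)]
  congr 3
  push_cast; ring

theorem eLpNorm_sym_zero_mul_ft_le {μ : ℝ} (hμ0 : 0 ≤ μ) {a b : ℝ} (φ : Test a b) :
    eLpNorm (fun ξ => sym 0 μ ξ * ft φ ξ) 2 ≤ sobolevSeminormR μ (zeroExt a b (toL2 a b φ)) := by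
  rw [← ENNReal.pow_le_pow_left_iff two_ne_zero, sobolevSeminormR_sq, eLpNorm_sym_zero_mul_ft_sq hμ0]
  refine le_mul_of_one_le_left zero_le ?_
  rw [← ENNReal.ofReal_one]
  exact ENNReal.ofReal_le_ofReal (by linarith [Real.pi_gt_three])

theorem eLpNorm_sym_mul_ft_le {lam μ : ℝ} (hlam : 0 ≤ lam) (hμ0 : 0 ≤ μ) (hμ1 : μ ≤ 1) {a b : ℝ}
    (φ : Test a b) : eLpNorm (fun ξ => sym lam μ ξ * ft φ ξ) 2
      ≤ ENNReal.ofReal (lam ^ μ) * ‖toL2 a b φ‖ₑ + eLpNorm (fun ξ => sym 0 μ ξ * ft φ ξ) 2 := by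
  have hm1 : AEStronglyMeasurable ((lam ^ μ) • ft φ) :=
    ((continuous_ft φ).const_smul (lam ^ μ)).aestronglyMeasurable
  have hm2 := (memLp_sym_mul_ft le_rfl hμ0 hμ1 φ).aestronglyMeasurable
  have h1 : eLpNorm (fun ξ => sym lam μ ξ * ft φ ξ) 2 (volume : Measure ℝ)
      ≤ eLpNorm (fun ξ => ‖((lam ^ μ) • ft φ) ξ‖ + ‖sym 0 μ ξ * ft φ ξ‖) 2 volume := by
    refine eLpNorm_mono fun ξ => ?_
    rw [Real.norm_of_nonneg (by positivity), norm_mul, norm_mul, Pi.smul_apply, norm_smul,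
      ← add_mul, Real.norm_of_nonneg (by positivity)]
    gcongr
    exact norm_sym_le_add hlam hμ0 hμ1 ξ
  have h2 := eLpNorm_add_le (p := 2) hm1.norm hm2.norm (by norm_num)
  rw [eLpNorm_norm, eLpNorm_norm, eLpNorm_const_smul, eLpNorm_ft φ,
    Real.enorm_of_nonneg (by positivity)] at h2
  exact h1.trans h2

theorem eLpNorm_sym_neg_mul_ft {lam μ : ℝ} (hμ0 : 0 ≤ μ) {a b : ℝ} (φ : Test a b) :
    eLpNorm (fun ξ => sym lam μ (-ξ) * ft φ ξ) 2 = eLpNorm (fun ξ => sym lam μ ξ * ft φ ξ) 2 :=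
  eLpNorm_congr_norm_ae (.of_forall fun ξ => by rw [norm_mul, norm_mul, norm_sym_neg hμ0])

/-- The symbol sees the zero extension on the whole line, while the norm on the right is that of
`H^μ(Ω)`. The zero extension bound bridges them, hence `μ ≠ 1/2`. -/
theorem exists_eLpNorm_sym_mul_ft_le {lam μ : ℝ} (hlam : 0 ≤ lam) (hμ0 : 0 ≤ μ) (hμ1 : μ ≤ 1)
    (hμ : μ ≠ 1 / 2) {a b : ℝ} (hab : a < b) : ∃ C : ℝ≥0, ∀ φ : Test a b,
      eLpNorm (fun ξ => sym lam μ ξ * ft φ ξ) 2 ≤ C * sobolevENorm a b μ (toL2 a b φ) := by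
  obtain ⟨D, hD⟩ := exists_zeroExt_test_le hμ0 hμ1 hμ hab
  refine ⟨Real.toNNReal (lam ^ μ) + D, fun φ => (eLpNorm_sym_mul_ft_le hlam hμ0 hμ1 φ).trans ?_⟩
  rw [ENNReal.coe_add, add_mul]
  refine add_le_add (mul_le_mul_right (enorm_le_sobolevENorm a b μ _) _) ?_
  refine (eLpNorm_sym_zero_mul_ft_le hμ0 φ).trans ((hD φ).trans ?_)
  gcongr
  exact sobolevSeminorm_le_sobolevENorm a b μ _

theorem energy_test_lt_top {μ : ℝ} (hμ0 : 0 ≤ μ) (hμ1 : μ ≤ 1) {a b : ℝ} (φ : Test a b) :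
    energy μ (zeroExt a b (toL2 a b φ)) < ∞ := by
  rw [← eLpNorm_sym_zero_mul_ft_sq hμ0]
  exact ENNReal.pow_lt_top (memLp_sym_mul_ft le_rfl hμ0 hμ1 φ).2

theorem sobolevENorm_lt_top {μ : ℝ} {a b : ℝ} (u : L2 a b)
    (h : energy μ (zeroExt a b u) < ∞) : sobolevENorm a b μ u < ∞ := by
  refine (sobolevENorm_le_add a b μ _).trans_lt (ENNReal.add_lt_top.2 ⟨enorm_lt_top, ?_⟩)
  refine (sobolevSeminorm_le_zeroExt μ _).trans_lt ?_
  have := ENNReal.mul_lt_top (ENNReal.ofReal_lt_top (r := 2 * Real.pi)) h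
  rw [← sobolevSeminormR_sq] at this
  by_contra h'
  rw [not_lt, top_le_iff] at h'
  simp [h'] at this

theorem toL2_test_mem_sobolevZero {μ : ℝ} (hμ0 : 0 ≤ μ) (hμ1 : μ ≤ 1) {a b : ℝ} (φ : Test a b) :
    toL2 a b φ ∈ sobolevZero a b μ := by
  refine ⟨sobolevENorm_lt_top _ (energy_test_lt_top hμ0 hμ1 φ), fun ε hε => ⟨φ, ?_⟩⟩
  rw [sub_self, sobolevENorm_zero]
  exact hε

/-! ### Linearity on test functions -/

theorem leftDeriv_add {a b μ lam : ℝ} (hμ0 : 0 ≤ μ) (hμ1 : μ ≤ 1) (hlam : 0 ≤ lam)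
    (φ ψ : Test a b) (x : ℝ) :
    leftDeriv a μ lam (φ + ψ : Test a b) x = leftDeriv a μ lam φ x + leftDeriv a μ lam ψ x := by
  have h : ∀ χ : Test a b, Integrable fun ξ : ℝ => Complex.exp (↑(2 * Real.pi * inner ℝ ξ x) * Complex.I) •
      (sym lam μ ξ * ft χ ξ) := fun χ =>
    (integrable_sym_mul_ft hlam hμ0 hμ1 χ).bdd_mul (c := 1)
      (Continuous.aestronglyMeasurable (by fun_prop))
      (.of_forall fun ξ => by rw [Complex.norm_exp_ofReal_mul_I])
  apply Complex.ofReal_injective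
  rw [Complex.ofReal_add, leftDeriv_eq_fourierInv hμ0 hμ1 hlam, leftDeriv_eq_fourierInv hμ0 hμ1 hlam,
    leftDeriv_eq_fourierInv hμ0 hμ1 hlam, Real.fourierInv_eq', Real.fourierInv_eq',
    Real.fourierInv_eq', ← integral_add (h φ) (h ψ)]
  refine integral_congr_ae (.of_forall fun ξ => ?_)
  simp only [ft_add, mul_add, smul_eq_mul]

theorem leftDeriv_smul {a b μ lam : ℝ} (hμ0 : 0 ≤ μ) (hμ1 : μ ≤ 1) (hlam : 0 ≤ lam)
    (r : ℝ) (φ : Test a b) (x : ℝ) :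
    leftDeriv a μ lam (r • φ : Test a b) x = r * leftDeriv a μ lam φ x := by
  apply Complex.ofReal_injective
  rw [Complex.ofReal_mul, leftDeriv_eq_fourierInv hμ0 hμ1 hlam, leftDeriv_eq_fourierInv hμ0 hμ1 hlam,
    Real.fourierInv_eq', Real.fourierInv_eq', ← integral_const_mul]
  refine integral_congr_ae (.of_forall fun ξ => ?_)
  simp only [ft_smul, smul_eq_mul]
  ring

theorem rightDeriv_add {a b μ lam : ℝ} (hμ0 : 0 ≤ μ) (hμ1 : μ ≤ 1) (hlam : 0 ≤ lam)
    (φ ψ : Test a b) (x : ℝ) :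
    rightDeriv b μ lam (φ + ψ : Test a b) x = rightDeriv b μ lam φ x + rightDeriv b μ lam ψ x := by
  simp only [rightDeriv_eq_leftDeriv]
  exact leftDeriv_add hμ0 hμ1 hlam (testNeg φ) (testNeg ψ) (-x)

theorem rightDeriv_smul {a b μ lam : ℝ} (hμ0 : 0 ≤ μ) (hμ1 : μ ≤ 1) (hlam : 0 ≤ lam)
    (r : ℝ) (φ : Test a b) (x : ℝ) :
    rightDeriv b μ lam (r • φ : Test a b) x = r * rightDeriv b μ lam φ x := by
  simp only [rightDeriv_eq_leftDeriv]
  exact leftDeriv_smul hμ0 hμ1 hlam r (testNeg φ) (-x)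

theorem toL2_add {a b : ℝ} {f g : ℝ → ℝ} (hf : MemLp f 2 ((volume : Measure ℝ).restrict (Ioo a b)))
    (hg : MemLp g 2 ((volume : Measure ℝ).restrict (Ioo a b))) :
    toL2 a b (f + g) = toL2 a b f + toL2 a b g := by
  unfold toL2
  rw [dif_pos hf, dif_pos hg, dif_pos (hf.add hg), ← MemLp.toLp_add]

theorem toL2_smul {a b : ℝ} (r : ℝ) {f : ℝ → ℝ}
    (hf : MemLp f 2 ((volume : Measure ℝ).restrict (Ioo a b))) :
    toL2 a b (r • f) = r • toL2 a b f := by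
  unfold toL2
  rw [dif_pos hf, dif_pos (hf.const_smul r), ← MemLp.toLp_const_smul]

/-- The left derivative on test functions as a linear map into `L²(a, b)`. -/
def leftDerivₗ (a b : ℝ) {μ lam : ℝ} (hμ0 : 0 ≤ μ) (hμ1 : μ ≤ 1) (hlam : 0 ≤ lam) :
    Test a b →ₗ[ℝ] L2 a b where
  toFun φ := toL2 a b (leftDeriv a μ lam φ)
  map_add' φ ψ := by
    rw [← toL2_add ((memLp_leftDeriv hμ0 hμ1 hlam φ).mono_measure Measure.restrict_le_self)
      ((memLp_leftDeriv hμ0 hμ1 hlam ψ).mono_measure Measure.restrict_le_self)]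
    congr 1
    ext x
    exact leftDeriv_add hμ0 hμ1 hlam φ ψ x
  map_smul' r φ := by
    rw [RingHom.id_apply,
      ← toL2_smul r ((memLp_leftDeriv hμ0 hμ1 hlam φ).mono_measure Measure.restrict_le_self)]
    congr 1
    ext x
    exact leftDeriv_smul hμ0 hμ1 hlam r φ x

/-- The right derivative on test functions as a linear map into `L²(a, b)`. -/
def rightDerivₗ (a b : ℝ) {μ lam : ℝ} (hμ0 : 0 ≤ μ) (hμ1 : μ ≤ 1) (hlam : 0 ≤ lam) :
    Test a b →ₗ[ℝ] L2 a b where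
  toFun φ := toL2 a b (rightDeriv b μ lam φ)
  map_add' φ ψ := by
    rw [← toL2_add ((memLp_rightDeriv hμ0 hμ1 hlam φ).mono_measure Measure.restrict_le_self)
      ((memLp_rightDeriv hμ0 hμ1 hlam ψ).mono_measure Measure.restrict_le_self)]
    congr 1
    ext x
    exact rightDeriv_add hμ0 hμ1 hlam φ ψ x
  map_smul' r φ := by
    rw [RingHom.id_apply,
      ← toL2_smul r ((memLp_rightDeriv hμ0 hμ1 hlam φ).mono_measure Measure.restrict_le_self)]
    congr 1
    ext x
    exact rightDeriv_smul hμ0 hμ1 hlam r φ x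

/-! ### Extension by continuity -/

/-- A test function as an element of `H₀^μ(Ω)`. -/
def HZero.ofTest {a b μ : ℝ} (hμ0 : 0 ≤ μ) (hμ1 : μ ≤ 1) : Test a b →ₗ[ℝ] HZero a b μ where
  toFun φ := HZero.mk (toL2 a b φ) (toL2_test_mem_sobolevZero hμ0 hμ1 φ)
  map_add' φ ψ := HZero.val_injective (toL2_add_test a b φ ψ)
  map_smul' r φ := HZero.val_injective (toL2_smul_test a b r φ)

theorem HZero.val_ofTest {a b μ : ℝ} (hμ0 : 0 ≤ μ) (hμ1 : μ ≤ 1) (φ : Test a b) :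
    (HZero.ofTest hμ0 hμ1 φ).val = toL2 a b φ := rfl

theorem HZero.denseRange_ofTest {a b μ : ℝ} (hμ0 : 0 ≤ μ) (hμ1 : μ ≤ 1) :
    DenseRange (HZero.ofTest (a := a) (b := b) hμ0 hμ1) := by
  refine Metric.denseRange_iff.2 fun u r hr => ?_
  obtain ⟨φ, hφ⟩ := (HZero.val_mem u).2 (ENNReal.ofReal r) (by simpa using hr)
  refine ⟨φ, ?_⟩
  rw [← HZero.val_ofTest hμ0 hμ1, ← map_sub, ← HZero.enorm_eq, ← ofReal_norm] at hφ
  rw [dist_eq_norm]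
  exact (ENNReal.ofReal_lt_ofReal_iff hr).1 hφ

theorem approx_neBot {a b μ : ℝ} (u : HZero a b μ) : NeBot (approx a b μ u.val) := by
  refine comap_neBot_iff.2 fun t ht => ?_
  obtain ⟨ε, hε, h⟩ := (nhds_bot_basis (α := ℝ≥0∞)).mem_iff.1 ht
  obtain ⟨φ, hφ⟩ := (HZero.val_mem u).2 ε hε
  exact ⟨φ, h hφ⟩

theorem tendsto_ofTest_approx {a b μ : ℝ} (hμ0 : 0 ≤ μ) (hμ1 : μ ≤ 1) (u : HZero a b μ) :
    Tendsto (HZero.ofTest hμ0 hμ1) (approx a b μ u.val) (𝓝 u) := by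
  rw [tendsto_iff_edist_tendsto_0]
  refine Tendsto.congr (fun φ => ?_)
    (tendsto_comap (f := fun φ : Test a b => sobolevENorm a b μ (u.val - toL2 a b φ)))
  rw [edist_comm, edist_eq_enorm_sub, HZero.enorm_eq, map_sub, HZero.val_ofTest]

/-- The filter `approx` is nontrivial by density and is sent to the neighbourhoods of `u`, so the
`limUnder` defining the operator is a genuine limit, namely the value of the bounded extension. The
linear structure of the operators comes from this identification. -/
theorem exists_extension {a b μ : ℝ} (hμ0 : 0 ≤ μ) (hμ1 : μ ≤ 1) (T : Test a b →ₗ[ℝ] L2 a b)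
    (hT : ∃ C : ℝ≥0, ∀ φ, ‖T φ‖ₑ ≤ C * sobolevENorm a b μ (toL2 a b φ)) :
    ∃ S : HZero a b μ →L[ℝ] L2 a b, (∀ u : HZero a b μ, limUnder (approx a b μ u.val) T = S u) ∧
      ∀ φ, S (HZero.ofTest hμ0 hμ1 φ) = T φ := by
  obtain ⟨C, hC⟩ := hT
  have hd := HZero.denseRange_ofTest (a := a) (b := b) hμ0 hμ1
  have hn : ∀ φ, ‖T φ‖ ≤ C * ‖HZero.ofTest hμ0 hμ1 φ‖ := fun φ => by
    have h := hC φ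
    rw [← HZero.val_ofTest hμ0 hμ1, ← HZero.enorm_eq] at h
    rw [enorm_eq_nnnorm, enorm_eq_nnnorm] at h
    exact_mod_cast h
  have he := LinearMap.extendOfNorm_eq (f := T) hd ⟨C, hn⟩
  refine ⟨T.extendOfNorm (HZero.ofTest hμ0 hμ1), fun u => ?_, he⟩
  have := approx_neBot u
  refine Tendsto.limUnder_eq ?_
  exact (((T.extendOfNorm (HZero.ofTest hμ0 hμ1)).continuous.tendsto u).comp
    (tendsto_ofTest_approx hμ0 hμ1 u)).congr he

theorem exists_leftOp_eq {a b μ lam : ℝ} (hμ0 : 0 ≤ μ) (hμ1 : μ ≤ 1) (hμ : μ ≠ 1 / 2)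
    (hlam : 0 ≤ lam) (hab : a < b) :
    ∃ S : HZero a b μ →L[ℝ] L2 a b, (∀ u : HZero a b μ, leftOp a b μ lam u.val = S u) ∧
      ∀ φ, S (HZero.ofTest hμ0 hμ1 φ) = toL2 a b (leftDeriv a μ lam φ) := by
  obtain ⟨C, hC⟩ := exists_eLpNorm_sym_mul_ft_le hlam hμ0 hμ1 hμ hab
  exact exists_extension hμ0 hμ1 (leftDerivₗ a b hμ0 hμ1 hlam)
    ⟨C, fun φ => (enorm_leftDeriv_le hμ0 hμ1 hlam φ).trans (hC φ)⟩

theorem exists_rightOp_eq {a b μ lam : ℝ} (hμ0 : 0 ≤ μ) (hμ1 : μ ≤ 1) (hμ : μ ≠ 1 / 2)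
    (hlam : 0 ≤ lam) (hab : a < b) :
    ∃ S : HZero a b μ →L[ℝ] L2 a b, (∀ u : HZero a b μ, rightOp a b μ lam u.val = S u) ∧
      ∀ φ, S (HZero.ofTest hμ0 hμ1 φ) = toL2 a b (rightDeriv b μ lam φ) := by
  obtain ⟨C, hC⟩ := exists_eLpNorm_sym_mul_ft_le hlam hμ0 hμ1 hμ hab
  exact exists_extension hμ0 hμ1 (rightDerivₗ a b hμ0 hμ1 hlam)
    ⟨C, fun φ => (enorm_rightDeriv_le hμ0 hμ1 hlam φ).trans
      ((eLpNorm_sym_neg_mul_ft hμ0 φ).trans_le (hC φ))⟩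

/-! ### Multiplication by a Lipschitz function -/

/-- Split `g(x)w(x) - g(y)w(y)` as `g(y)(w(x) - w(y)) + (g(x) - g(y))w(x)`. In the second term
`|g(x) - g(y)| ≤ K min(|x - y|, 2)`, so integrating the kernel in `y` leaves a constant times
`|w(x)|²`. -/
theorem gagliardo_mul_le {μ : ℝ} {g w : ℝ → ℝ} (hw : Measurable w) {K : ℝ≥0}
    (hg : ∀ x, |g x| ≤ K) (hL : ∀ x y, |g x - g y| ≤ K * |x - y|) :
    gagliardo μ (fun x => g x * w x) ≤ 2 * K ^ 2 * (gagliardo μ w +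
      (∫⁻ h : ℝ, ENNReal.ofReal (|h| ^ (-1 - 2 * μ)) * ENNReal.ofReal (min |h| 2) ^ 2) *
        ∫⁻ x, ‖w x‖ₑ ^ 2) := by
  have hmin : ∀ x y, |g x - g y| ≤ K * min |x - y| 2 := fun x y => by
    rw [mul_min_of_nonneg _ _ K.coe_nonneg]
    refine le_min (hL x y) ((abs_sub _ _).trans ?_)
    linarith [hg x, hg y]
  have hpt : ∀ x y, ‖g x * w x - g y * w y‖ₑ ^ 2 ≤ 2 * (K ^ 2 * ‖w x - w y‖ₑ ^ 2
      + K ^ 2 * (ENNReal.ofReal (min |x - y| 2) ^ 2 * ‖w x‖ₑ ^ 2)) := fun x y => by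
    have hm0 : 0 ≤ min |x - y| 2 := le_min (abs_nonneg _) zero_le_two
    have h1 : (g x * w x - g y * w y) ^ 2 ≤ 2 * (K ^ 2 * |w x - w y| ^ 2
        + K ^ 2 * ((min |x - y| 2) ^ 2 * |w x| ^ 2)) := by
      have e1 : |g y * (w x - w y)| ≤ K * |w x - w y| := by
        rw [abs_mul]; gcongr; exact hg y
      have e2 : |(g x - g y) * w x| ≤ K * min |x - y| 2 * |w x| := by
        rw [abs_mul]; gcongr; exact hmin x y
      have e3 := sq_le_sq' (by linarith [neg_abs_le (g y * (w x - w y)), abs_nonneg (w x - w y)])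
        ((le_abs_self _).trans e1)
      have e4 := sq_le_sq' (by linarith [neg_abs_le ((g x - g y) * w x)]) ((le_abs_self _).trans e2)
      have e5 : g x * w x - g y * w y = g y * (w x - w y) + (g x - g y) * w x := by ring
      rw [e5]
      nlinarith [sq_nonneg (g y * (w x - w y) - (g x - g y) * w x)]
    have h2 := ENNReal.ofReal_le_ofReal h1
    rw [ENNReal.ofReal_mul zero_le_two, ENNReal.ofReal_add (by positivity) (by positivity),
      ENNReal.ofReal_mul (by positivity), ENNReal.ofReal_mul (by positivity),
      ENNReal.ofReal_mul (by positivity), ← sq_abs (g x * w x - g y * w y),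
      ENNReal.ofReal_pow (abs_nonneg _), ENNReal.ofReal_pow (abs_nonneg _),
      ENNReal.ofReal_pow (abs_nonneg _), ENNReal.ofReal_pow hm0, ENNReal.ofReal_pow K.coe_nonneg] at h2
    simpa [← Real.enorm_eq_ofReal_abs] using h2
  set k : ℝ → ℝ≥0∞ := fun h => ENNReal.ofReal (|h| ^ (-1 - 2 * μ)) with hk
  have hkm : Measurable k := by fun_prop
  have hinner : ∀ x, ∫⁻ y, k (x - y) * ENNReal.ofReal (min |x - y| 2) ^ 2
      = ∫⁻ h : ℝ, k h * ENNReal.ofReal (min |h| 2) ^ 2 := fun x =>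
    lintegral_sub_left_eq_self (fun h => k h * ENNReal.ofReal (min |h| 2) ^ 2) x
  set J := ∫⁻ h : ℝ, k h * ENNReal.ofReal (min |h| 2) ^ 2
  have hin : ∀ x, ∫⁻ y, k (x - y) * ‖g x * w x - g y * w y‖ₑ ^ 2
      ≤ 2 * K ^ 2 * ((∫⁻ y, k (x - y) * ‖w x - w y‖ₑ ^ 2) + J * ‖w x‖ₑ ^ 2) := fun x => by
    calc _ ≤ ∫⁻ y, 2 * K ^ 2 * (k (x - y) * ‖w x - w y‖ₑ ^ 2
            + k (x - y) * ENNReal.ofReal (min |x - y| 2) ^ 2 * ‖w x‖ₑ ^ 2) := by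
          refine lintegral_mono fun y => ?_
          refine (mul_le_mul_right (hpt x y) _).trans (le_of_eq (by ring))
      _ = _ := by
          rw [lintegral_const_mul _ (by fun_prop), lintegral_add_left (by fun_prop),
            lintegral_mul_const _ (by fun_prop), hinner]
  calc gagliardo μ (fun x => g x * w x)
      ≤ ∫⁻ x, 2 * K ^ 2 * ((∫⁻ y, k (x - y) * ‖w x - w y‖ₑ ^ 2) + J * ‖w x‖ₑ ^ 2) :=
        lintegral_mono hin
    _ = _ := by
        have hm : Measurable fun x => ∫⁻ y, k (x - y) * ‖w x - w y‖ₑ ^ 2 :=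
          Measurable.lintegral_prod_right' (f := fun p : ℝ × ℝ => k (p.1 - p.2) * ‖w p.1 - w p.2‖ₑ ^ 2)
            (by fun_prop)
        rw [lintegral_const_mul _ (by fun_prop), lintegral_add_left hm,
          lintegral_const_mul _ (by fun_prop)]
        rfl

theorem exists_energy_mul_le {μ : ℝ} (hμ0 : 0 ≤ μ) (hμ1 : μ < 1) : ∃ C : ℝ≥0,
    ∀ (g : ℝ → ℝ) (K : ℝ≥0), (∀ x, |g x| ≤ K) → (∀ x y, |g x - g y| ≤ K * |x - y|) →
    ∀ w w' : Lp ℝ 2 (volume : Measure ℝ), (w' =ᵐ[volume] fun x => g x * w x) →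
      energy μ w' ≤ C * K ^ 2 * (energy μ w + ‖w‖ₑ ^ 2) := by
  rcases hμ0.eq_or_lt with rfl | hμ0
  · refine ⟨1, fun g K hg hL w w' h => ?_⟩
    rw [energy_zero, ENNReal.coe_one, one_mul]
    refine le_trans ?_ (mul_le_mul_right le_add_self _)
    rw [← mul_pow]
    gcongr
    rw [Lp.enorm_def, Lp.enorm_def, eLpNorm_congr_ae h]
    refine (eLpNorm_le_nnreal_smul_eLpNorm_of_ae_le_mul (c := K) (.of_forall fun x => ?_) 2)
    rw [← NNReal.coe_le_coe, nnnorm_mul]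
    push_cast
    gcongr
    exact hg x
  · have hJ := (lintegral_rpow_mul_min_lt_top hμ0 hμ1).ne
    set J := ∫⁻ h : ℝ, ENNReal.ofReal (|h| ^ (-1 - 2 * μ)) * ENNReal.ofReal (min |h| 2) ^ 2
    have hκ0 := gagliardoConst_ne_zero μ
    have hκ := gagliardoConst_ne_top hμ0 hμ1
    set κ := gagliardoConst μ
    -- After division by the Gagliardo constant `κ`, the error `J ‖w‖²` becomes `(J / κ) ‖w‖²`; the
    -- 2 comes from squaring a sum.
    have hC : 2 * (1 + J / κ) ≠ ∞ :=
      ENNReal.mul_ne_top (by simp) (ENNReal.add_ne_top.2 ⟨by simp, ENNReal.div_ne_top hJ hκ0⟩)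
    refine ⟨(2 * (1 + J / κ)).toNNReal, fun g K hg hL w w' h => ?_⟩
    rw [ENNReal.coe_toNNReal hC]
    have h1 := gagliardo_mul_le (μ := μ) (Lp.stronglyMeasurable w).measurable hg hL
    rw [gagliardo_congr_ae h.symm, gagliardo_eq_energy, gagliardo_eq_energy, ← eLpNorm_two_sq,
      ← Lp.enorm_def] at h1
    refine (ENNReal.mul_le_mul_iff_right hκ0 hκ).1 (h1.trans ?_)
    have h2 : κ * energy μ w + J * ‖w‖ₑ ^ 2 ≤ κ * ((1 + J / κ) * (energy μ w + ‖w‖ₑ ^ 2)) := by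
      have e : κ * ((1 + J / κ) * (energy μ w + ‖w‖ₑ ^ 2))
          = κ * energy μ w + κ * ‖w‖ₑ ^ 2 + (κ * (J / κ)) * (energy μ w + ‖w‖ₑ ^ 2) := by ring
      rw [e, ENNReal.mul_div_cancel hκ0 hκ, mul_add J]
      exact add_le_add le_self_add le_add_self
    calc _ ≤ 2 * (K : ℝ≥0∞) ^ 2 * (κ * ((1 + J / κ) * (energy μ w + ‖w‖ₑ ^ 2))) := by gcongr
      _ = _ := by ring

/-- Pointwise in frequency, `t^(2μ) ≤ 1 + t^(2s)`: compare with 1 for `t ≤ 1` and with `t^(2s)` for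
`t ≥ 1`. -/
theorem energy_le_add {μ s : ℝ} (hμ0 : 0 ≤ μ) (hμs : μ ≤ s) (w : Lp ℝ 2 (volume : Measure ℝ)) :
    energy μ w ≤ ‖w‖ₑ ^ 2 + energy s w := by
  rw [← energy_zero]
  unfold energy
  rw [← lintegral_add_left
    (by have := (Lp.stronglyMeasurable (cF w)).measurable; fun_prop)]
  refine lintegral_mono fun ξ => ?_
  rw [← add_mul]
  gcongr
  rw [← ENNReal.ofReal_add (by positivity) (by positivity)]
  refine ENNReal.ofReal_le_ofReal ?_
  rcases le_total |2 * Real.pi * ξ| 1 with h | h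
  · have : |2 * Real.pi * ξ| ^ (2 * μ) ≤ 1 := Real.rpow_le_one (abs_nonneg _) h (by linarith)
    have h2 : 0 ≤ |2 * Real.pi * ξ| ^ (2 * s) := by positivity
    simp only [mul_zero, Real.rpow_zero]
    linarith
  · have := Real.rpow_le_rpow_of_exponent_le h (by linarith : 2 * μ ≤ 2 * s)
    simp only [mul_zero, Real.rpow_zero]
    linarith

/-! ### The operator `mulL2` -/

section mul
variable {a b : ℝ} {g : ℝ → ℝ}

theorem exists_abs_le_of_continuousOn (hg : ContinuousOn g (Icc a b)) :
    ∃ K : ℝ≥0, ∀ x ∈ Icc a b, |g x| ≤ K := by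
  obtain ⟨K, hK⟩ := isCompact_Icc.exists_bound_of_continuousOn hg
  exact ⟨K.toNNReal, fun x hx => (hK x hx).trans (Real.le_coe_toNNReal K)⟩

theorem memLp_mul (hg : ContinuousOn g (Icc a b)) (u : L2 a b) :
    MemLp (fun x => g x * u x) 2 ((volume : Measure ℝ).restrict (Ioo a b)) := by
  obtain ⟨K, hK⟩ := exists_abs_le_of_continuousOn hg
  refine MemLp.of_le_mul (c := K) (Lp.memLp u) (AEStronglyMeasurable.mul
    ((hg.mono Ioo_subset_Icc_self).aestronglyMeasurable measurableSet_Ioo)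
    (Lp.aestronglyMeasurable u)) ?_
  filter_upwards [ae_restrict_mem measurableSet_Ioo] with x hx
  rw [norm_mul]
  gcongr
  exact hK x (Ioo_subset_Icc_self hx)

theorem mulL2_ae_eq (hg : ContinuousOn g (Icc a b)) (u : L2 a b) :
    ∀ᵐ x ∂((volume : Measure ℝ).restrict (Ioo a b)), mulL2 g u x = g x * u x :=
  toL2_ae_eq (memLp_mul hg u)

theorem mulL2_add_left {g₁ g₂ : ℝ → ℝ} (hg₁ : ContinuousOn g₁ (Icc a b))
    (hg₂ : ContinuousOn g₂ (Icc a b)) (u : L2 a b) :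
    mulL2 (g₁ + g₂) u = mulL2 g₁ u + mulL2 g₂ u := by
  apply Lp.ext
  filter_upwards [mulL2_ae_eq hg₁ u, mulL2_ae_eq hg₂ u, mulL2_ae_eq (hg₁.add hg₂) u,
    Lp.coeFn_add (mulL2 g₁ u) (mulL2 g₂ u)] with x h1 h2 h3 h4
  rw [h4, Pi.add_apply, h1, h2, h3, Pi.add_apply, add_mul]

theorem norm_mulL2_le (hg : ContinuousOn g (Icc a b)) {K : ℝ≥0} (hK : ∀ x ∈ Icc a b, |g x| ≤ K)
    (u : L2 a b) : ‖mulL2 g u‖ ≤ K * ‖u‖ := by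
  refine Lp.norm_le_mul_norm_of_ae_le_mul ?_
  filter_upwards [mulL2_ae_eq hg u, ae_restrict_mem measurableSet_Ioo] with x h1 hx
  rw [h1, norm_mul]
  gcongr
  exact hK x (Ioo_subset_Icc_self hx)

/-- Multiplication by a continuous function as a bounded operator on `L²(a, b)`. -/
def mulCLM (hg : ContinuousOn g (Icc a b)) : L2 a b →L[ℝ] L2 a b :=
  LinearMap.mkContinuousOfExistsBound
    { toFun := mulL2 g
      map_add' := fun u v => by
        apply Lp.ext
        filter_upwards [mulL2_ae_eq hg u, mulL2_ae_eq hg v, mulL2_ae_eq hg (u + v),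
          Lp.coeFn_add (mulL2 g u) (mulL2 g v), Lp.coeFn_add u v] with x h1 h2 h3 h4 h5
        rw [h4, Pi.add_apply, h1, h2, h3, h5, Pi.add_apply, mul_add]
      map_smul' := fun r u => by
        apply Lp.ext
        filter_upwards [mulL2_ae_eq hg u, mulL2_ae_eq hg (r • u),
          Lp.coeFn_smul r (mulL2 g u), Lp.coeFn_smul r u] with x h1 h2 h3 h4
        rw [RingHom.id_apply, h3, Pi.smul_apply, h1, h2, h4, Pi.smul_apply, smul_eq_mul, smul_eq_mul]
        ring }
    (by
      obtain ⟨K, hK⟩ := exists_abs_le_of_continuousOn hg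
      exact ⟨K, norm_mulL2_le hg hK⟩)

theorem mulCLM_apply (hg : ContinuousOn g (Icc a b)) (u : L2 a b) : mulCLM hg u = mulL2 g u := rfl

theorem zeroExt_mulL2_ae_eq (hab : a < b) (hg : ContinuousOn g (Icc a b)) (u : L2 a b) :
    zeroExt a b (mulL2 g u) =ᵐ[volume] fun x => g (projIcc a b hab.le x) * zeroExt a b u x := by
  filter_upwards [zeroExt_ae_eq (mulL2 g u), zeroExt_ae_eq u,
    (ae_restrict_iff' measurableSet_Ioo).1 (mulL2_ae_eq hg u)] with x h1 h2 h3
  rw [h1, h2]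
  by_cases hx : x ∈ Ioo a b
  · rw [indicator_of_mem hx, indicator_of_mem hx, h3 hx,
      projIcc_of_mem hab.le (Ioo_subset_Icc_self hx)]
  · rw [indicator_of_notMem hx, indicator_of_notMem hx, mul_zero]

/-- Multiplication by a bounded Lipschitz function maps `H₀^s(Ω)` boundedly to `H^μ(Ω)` for
`μ ≤ s`. -/
theorem exists_sobolevENorm_mulL2_le {μ s : ℝ} (hμ0 : 0 ≤ μ) (hμ1 : μ < 1) (hμs : μ ≤ s)
    (hs1 : s ≤ 1) (hs : s ≠ 1 / 2) (hab : a < b) : ∃ C : ℝ≥0, ∀ (g : ℝ → ℝ) (K : ℝ≥0),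
      (∀ x ∈ Icc a b, |g x| ≤ K) → (∀ x ∈ Icc a b, ∀ y ∈ Icc a b, |g x - g y| ≤ K * |x - y|) →
      ∀ v ∈ sobolevZero a b s, sobolevENorm a b μ (mulL2 g v) ≤ C * K * sobolevENorm a b s v := by
  obtain ⟨C, hC⟩ := exists_energy_mul_le hμ0 hμ1
  obtain ⟨D, hD⟩ := exists_zeroExt_le (hμ0.trans hμs) hs1 hs hab
  -- The 1 is for the `L²` part. Under the root, 7 exceeds `2π`, `C` is the multiplier constant, and
  -- `2 + D²` collects two copies of `‖v‖²` and the energy of order `s`.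
  refine ⟨1 + NNReal.sqrt (7 * C * (2 + D ^ 2)), fun g K hK hL v hv => ?_⟩
  have hg : ContinuousOn g (Icc a b) := by
    refine LipschitzOnWith.continuousOn (K := K) (LipschitzOnWith.of_dist_le_mul fun x hx y hy => ?_)
    rw [Real.dist_eq, Real.dist_eq]
    exact hL x hx y hy
  -- Composing with the projection onto `[a, b]` makes `g` bounded and Lipschitz on the whole line
  -- without changing its product with a zero extension.
  have hE := hC (fun x => g (projIcc a b hab.le x)) K (fun x => hK _ (projIcc a b hab.le x).2)
    (fun x y => (hL _ (projIcc a b hab.le x).2 _ (projIcc a b hab.le y).2).trans 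
      (mul_le_mul_of_nonneg_left (abs_projIcc_sub_projIcc hab.le) K.coe_nonneg))
    (zeroExt a b v) (zeroExt a b (mulL2 g v)) (zeroExt_mulL2_ae_eq hab hg v)
  set N := sobolevENorm a b s v
  have hN : ‖v‖ₑ ≤ N := enorm_le_sobolevENorm a b s v
  have hEs : energy s (zeroExt a b v) ≤ (D * N) ^ 2 := by
    have h1 : energy s (zeroExt a b v) ≤ sobolevSeminormR s (zeroExt a b v) ^ 2 := by
      rw [sobolevSeminormR_sq]
      refine le_mul_of_one_le_left zero_le ?_
      rw [← ENNReal.ofReal_one]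
      exact ENNReal.ofReal_le_ofReal (by linarith [Real.pi_gt_three])
    refine h1.trans ?_
    gcongr
    exact (hD v hv).trans (by gcongr; exact sobolevSeminorm_le_sobolevENorm a b s v)
  have h2 : sobolevSeminormR μ (zeroExt a b (mulL2 g v)) ≤ NNReal.sqrt (7 * C * (2 + D ^ 2)) * K * N := by
    rw [← ENNReal.pow_le_pow_left_iff two_ne_zero, sobolevSeminormR_sq]
    have e1 : ((NNReal.sqrt (7 * C * (2 + D ^ 2)) : ℝ≥0∞)) ^ 2 = 7 * C * (2 + D ^ 2) := by
      rw [← ENNReal.coe_pow, NNReal.sq_sqrt]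
      push_cast; rfl
    have e2 : ENNReal.ofReal (2 * Real.pi) ≤ 7 := by
      rw [show (7 : ℝ≥0∞) = ENNReal.ofReal 7 by simp]
      exact ENNReal.ofReal_le_ofReal (by linarith [Real.pi_lt_d2])
    rw [mul_pow, mul_pow, e1]
    calc _ ≤ 7 * (C * K ^ 2 * ((N ^ 2 + (D * N) ^ 2) + N ^ 2)) := by
          gcongr
          refine hE.trans ?_
          gcongr
          · refine (energy_le_add hμ0 hμs _).trans ?_
            rw [enorm_zeroExt]
            gcongr
          · rw [enorm_zeroExt]; exact hN
      _ = _ := by ring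
  refine (sobolevENorm_le_add a b μ _).trans ?_
  push_cast
  rw [add_mul, add_mul, one_mul]
  refine add_le_add ?_ ((sobolevSeminorm_le_zeroExt μ _).trans h2)
  have h3 := norm_mulL2_le hg hK v
  refine le_trans ?_ (mul_le_mul_right hN (K : ℝ≥0∞))
  rw [enorm_eq_nnnorm, enorm_eq_nnnorm]
  exact_mod_cast h3

end mul

/-! ### Approximation in `C¹` by smooth functions -/

theorem exists_lipschitz_of_contDiffOn {a b : ℝ} (hab : a < b) {m : ℝ → ℝ}
    (hm : ContDiffOn ℝ 1 m (Icc a b)) : ∃ K : ℝ≥0, (∀ x ∈ Icc a b, |m x| ≤ K) ∧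
      ∀ x ∈ Icc a b, ∀ y ∈ Icc a b, |m x - m y| ≤ K * |x - y| := by
  have hu := uniqueDiffOn_Icc hab
  obtain ⟨K₁, h₁⟩ := exists_abs_le_of_continuousOn hm.continuousOn
  obtain ⟨K₂, h₂⟩ := exists_abs_le_of_continuousOn (hm.continuousOn_derivWithin hu le_rfl)
  refine ⟨max K₁ K₂, fun x hx => (h₁ x hx).trans (by simp), fun x hx y hy => ?_⟩
  have h := Convex.norm_image_sub_le_of_norm_derivWithin_le (f := m) (s := Icc a b)
    (C := K₂) (hm.differentiableOn one_ne_zero) h₂ (convex_Icc a b) hy hx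
  refine h.trans (mul_le_mul_of_nonneg_right ?_ (norm_nonneg _))
  simp

/-- Approximate the derivative of `m` uniformly by a polynomial and integrate from `a` with the
correct initial value. Closeness of derivatives gives the Lipschitz bound on the difference, and its
vanishing at `a` gives the uniform bound. -/
theorem exists_smooth_near {a b : ℝ} (hab : a < b) {m : ℝ → ℝ}
    (hm : ContDiffOn ℝ 1 m (Icc a b)) {ε : ℝ} (hε : 0 < ε) :
    ∃ q : ℝ → ℝ, ContDiff ℝ (⊤ : ℕ∞) q ∧ (∀ x ∈ Icc a b, |m x - q x| ≤ ε * (b - a)) ∧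
      (∀ x ∈ Icc a b, ∀ y ∈ Icc a b, |(m x - q x) - (m y - q y)| ≤ ε * |x - y|) ∧
      ∀ x ∈ Icc a b, |derivWithin m (Icc a b) x - deriv q x| ≤ ε := by
  have hu := uniqueDiffOn_Icc hab
  obtain ⟨p, hp⟩ := exists_polynomial_near_of_continuousOn a b _
    (hm.continuousOn_derivWithin hu le_rfl) ε hε
  set q : ℝ → ℝ := fun x => m a + ∫ t in a..x, p.eval t
  have hq : ∀ x, HasDerivAt q (p.eval x) x := fun x =>
    (intervalIntegral.integral_hasDerivAt_right (p.continuous.intervalIntegrable _ _)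
      p.continuous.aestronglyMeasurable.stronglyMeasurableAtFilter
      p.continuous.continuousAt).const_add (m a)
  have hqd : deriv q = fun x => p.eval x := funext fun x => (hq x).deriv
  have hd : ∀ x ∈ Icc a b, |derivWithin m (Icc a b) x - deriv q x| ≤ ε := fun x hx => by
    rw [hqd, abs_sub_comm]
    exact (hp x hx).le
  have hL : ∀ x ∈ Icc a b, ∀ y ∈ Icc a b, |(m x - q x) - (m y - q y)| ≤ ε * |x - y| := by
    intro x hx y hy
    refine Convex.norm_image_sub_le_of_norm_hasDerivWithin_le (f := fun x => m x - q x)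
      (f' := fun x => derivWithin m (Icc a b) x - deriv q x) (s := Icc a b)
      (fun z hz => ?_) (fun z hz => hd z hz) (convex_Icc a b) hy hx
    rw [hqd]
    exact ((hm.differentiableOn one_ne_zero z hz).hasDerivWithinAt).sub (hq z).hasDerivWithinAt
  refine ⟨q, ?_, fun x hx => ?_, hL, hd⟩
  · rw [contDiff_infty_iff_deriv, hqd]
    exact ⟨fun x => (hq x).differentiableAt, by simpa using p.contDiff_aeval (𝕜 := ℝ) (⊤ : ℕ∞)⟩
  · have ha : q a = m a := by simp [q]
    have h := hL x hx a (left_mem_Icc.2 hab.le)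
    rw [ha, sub_self, sub_zero] at h
    refine h.trans ?_
    gcongr
    rw [abs_of_nonneg (by linarith [hx.1])]
    linarith [hx.2]

/-- The product of a smooth function and a test function. -/
def testMul {a b : ℝ} (q : ℝ → ℝ) (hq : ContDiff ℝ (⊤ : ℕ∞) q) (φ : Test a b) : Test a b where
  toFun x := q x * φ x
  contDiff' := hq.mul φ.contDiff
  hasCompactSupport' := φ.hasCompactSupport.mul_left
  tsupport_subset' := (tsupport_mul_subset_right (f := q) (g := φ)).trans φ.tsupport_subset

theorem testMul_apply {a b : ℝ} {q : ℝ → ℝ} (hq : ContDiff ℝ (⊤ : ℕ∞) q) (φ : Test a b) (x : ℝ) :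
    testMul q hq φ x = q x * φ x := rfl

theorem toL2_testMul {a b : ℝ} {q : ℝ → ℝ} (hq : ContDiff ℝ (⊤ : ℕ∞) q) (φ : Test a b) :
    toL2 a b (testMul q hq φ) = mulL2 q (toL2 a b φ) := by
  apply Lp.ext
  filter_upwards [toL2_test_ae_eq φ, toL2_test_ae_eq (testMul q hq φ),
    mulL2_ae_eq hq.continuous.continuousOn (toL2 a b φ)] with x h1 h2 h3
  rw [h2, h3, h1, testMul_apply]

theorem mulL2_sub_left {a b : ℝ} {g₁ g₂ : ℝ → ℝ} (hg₁ : ContinuousOn g₁ (Icc a b))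
    (hg₂ : ContinuousOn g₂ (Icc a b)) (u : L2 a b) :
    mulL2 g₁ u - mulL2 g₂ u = mulL2 (g₁ - g₂) u := by
  rw [sub_eq_iff_eq_add, ← mulL2_add_left (hg₁.sub hg₂) hg₂, sub_add_cancel]

/-! ### Multiplication by a `C¹` function on `H₀^s(Ω)` -/

section mul
variable {a b μ s : ℝ} {m : ℝ → ℝ}

theorem exists_testMul_near (hμ0 : 0 ≤ μ) (hμ1 : μ < 1) (hμs : μ ≤ s)
    (hs1 : s ≤ 1) (hs : s ≠ 1 / 2) (hab : a < b) (hm : ContDiffOn ℝ 1 m (Icc a b)) {ε : ℝ≥0}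
    (hε : 0 < ε) : ∃ (q : ℝ → ℝ) (hq : ContDiff ℝ (⊤ : ℕ∞) q),
      (∀ x ∈ Icc a b, |derivWithin m (Icc a b) x - deriv q x| ≤ ε) ∧
      ∀ φ : Test a b, sobolevENorm a b μ (mulL2 m (toL2 a b φ) - toL2 a b (testMul q hq φ))
        ≤ ε * sobolevENorm a b s (toL2 a b φ) := by
  obtain ⟨C, hC⟩ := exists_sobolevENorm_mulL2_le hμ0 hμ1 hμs hs1 hs hab
  have hC0 : (0 : ℝ) ≤ C := C.coe_nonneg
  have hε' : (0 : ℝ) < ε := hε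
  have hba : 0 < b - a := sub_pos.2 hab
  -- With `δ = ε / D`, the number `δ (1 + (b - a))` bounds both the size and the Lipschitz constant
  -- of `m - q`, and `C` times it is at most `ε`.
  set D : ℝ := (1 + C) * (1 + (b - a)) with hD
  have hD1 : 1 ≤ D := by nlinarith
  set δ : ℝ := ε / D
  have hδ : 0 < δ := by positivity
  have hδε : δ ≤ ε := div_le_self hε'.le hD1
  obtain ⟨q, hq, h1, h2, h3⟩ := exists_smooth_near hab hm hδ
  refine ⟨q, hq, fun x hx => (h3 x hx).trans hδε, fun φ => ?_⟩
  rw [toL2_testMul, mulL2_sub_left hm.continuousOn hq.continuous.continuousOn]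
  set K : ℝ≥0 := (δ * (1 + (b - a))).toNNReal
  have hK : (K : ℝ) = δ * (1 + (b - a)) := Real.coe_toNNReal _ (by positivity)
  refine (hC (m - q) K (fun x hx => (h1 x hx).trans ?_) (fun x hx y hy => (h2 x hx y hy).trans ?_) _
    (toL2_test_mem_sobolevZero (hμ0.trans hμs) hs1 φ)).trans ?_
  · rw [hK]; nlinarith
  · rw [hK]
    gcongr
    nlinarith
  · gcongr
    norm_cast
    rw [← NNReal.coe_le_coe]
    push_cast
    rw [hK]
    calc C * (δ * (1 + (b - a))) ≤ (1 + C) * (δ * (1 + (b - a))) := by gcongr; linarith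
      _ = δ * D := by rw [hD]; ring
      _ = ε := div_mul_cancel₀ _ (by positivity)

/-- The product of `m` with a test function need not be smooth, so `v` is first replaced by a test
function and then `m` by a smooth function, each at a cost of half of `ε`. The second choice depends
on the first, since its error is proportional to the norm of the chosen test function. -/
theorem mulL2_mem_sobolevZero (hμ0 : 0 ≤ μ) (hμ1 : μ < 1) (hμs : μ ≤ s)
    (hs1 : s ≤ 1) (hs : s ≠ 1 / 2) (hab : a < b) (hm : ContDiffOn ℝ 1 m (Icc a b)) {v : L2 a b}
    (hv : v ∈ sobolevZero a b s) : mulL2 m v ∈ sobolevZero a b μ := by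
  obtain ⟨C, hC⟩ := exists_sobolevENorm_mulL2_le hμ0 hμ1 hμs hs1 hs hab
  obtain ⟨K, hK1, hK2⟩ := exists_lipschitz_of_contDiffOn hab hm
  have hC' := hC m K hK1 hK2
  refine ⟨(hC' v hv).trans_lt (ENNReal.mul_lt_top (by finiteness) hv.1), fun ε hε => ?_⟩
  obtain ⟨φ, hφ⟩ := hv.2 (ε / 2 / (C * K + 1))
    (ENNReal.div_pos (ENNReal.half_pos hε.ne').ne' (by finiteness))
  have hφm := toL2_test_mem_sobolevZero (a := a) (b := b) (hμ0.trans hμs) hs1 φ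
  set N := sobolevENorm a b s (toL2 a b φ)
  have hN : N ≠ ∞ := hφm.1.ne
  obtain ⟨δ, hδ0, hδ⟩ := ENNReal.lt_iff_exists_nnreal_btwn.1
    (ENNReal.div_pos (ENNReal.half_pos hε.ne').ne' (by finiteness : N + 1 ≠ ∞))
  obtain ⟨q, hq, -, h⟩ := exists_testMul_near hμ0 hμ1 hμs hs1 hs hab hm (by exact_mod_cast hδ0)
  refine ⟨testMul q hq φ, ?_⟩
  have e : mulL2 m v - toL2 a b (testMul q hq φ)
      = mulL2 m (v - toL2 a b φ) + (mulL2 m (toL2 a b φ) - toL2 a b (testMul q hq φ)) := by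
    have := (mulCLM hm.continuousOn).map_sub v (toL2 a b φ)
    rw [mulCLM_apply, mulCLM_apply, mulCLM_apply] at this
    rw [this]; abel
  rw [e]
  refine (sobolevENorm_add_le a b μ _ _).trans_lt ?_
  rw [← ENNReal.add_halves ε]
  refine ENNReal.add_lt_add_of_lt_of_le ?_ ?_ ((h φ).trans ?_)
  · exact ((h φ).trans_lt (ENNReal.mul_lt_top (by finiteness) hN.lt_top)).ne
  · refine (hC' _ ((sobolevZero a b s).sub_mem hv hφm)).trans_lt ?_
    have h1 := ENNReal.mul_lt_of_lt_div hφ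
    refine lt_of_le_of_lt ?_ h1
    rw [mul_comm]
    gcongr
    exact le_self_add
  · calc _ ≤ (δ : ℝ≥0∞) * (N + 1) := by gcongr; exact le_self_add
      _ ≤ _ := (ENNReal.mul_lt_of_lt_div hδ).le

/-- Multiplication by a `C¹` function as a bounded operator `H₀^s(Ω) → H₀^μ(Ω)`, `μ ≤ s`. -/
theorem exists_mulHZero (hμ0 : 0 ≤ μ) (hμ1 : μ < 1) (hμs : μ ≤ s)
    (hs1 : s ≤ 1) (hs : s ≠ 1 / 2) (hab : a < b) (hm : ContDiffOn ℝ 1 m (Icc a b)) :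
    ∃ S : HZero a b s →L[ℝ] HZero a b μ, ∀ v, (S v).val = mulL2 m v.val := by
  obtain ⟨C, hC⟩ := exists_sobolevENorm_mulL2_le hμ0 hμ1 hμs hs1 hs hab
  obtain ⟨K, hK1, hK2⟩ := exists_lipschitz_of_contDiffOn hab hm
  refine ⟨LinearMap.mkContinuousOfExistsBound
    { toFun := fun v => HZero.mk (mulL2 m v.val)
        (mulL2_mem_sobolevZero hμ0 hμ1 hμs hs1 hs hab hm v.val_mem)
      map_add' := fun u v => HZero.val_injective ((mulCLM hm.continuousOn).map_add u.val v.val)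
      map_smul' := fun r u => HZero.val_injective ((mulCLM hm.continuousOn).map_smul r u.val) }
    ⟨C * K, fun v => ?_⟩, fun v => rfl⟩
  have h := hC m K hK1 hK2 v.val v.val_mem
  rw [← HZero.enorm_eq, ← HZero.val_mk (mulL2 m v.val)
    (mulL2_mem_sobolevZero hμ0 hμ1 hμs hs1 hs hab hm v.val_mem), ← HZero.enorm_eq,
    enorm_eq_nnnorm, enorm_eq_nnnorm] at h
  exact_mod_cast h

end mul

/-! ### Lower bounds for the symbol -/

theorem mul_sin_le_sin_mul {t θ : ℝ} (ht0 : 0 ≤ t) (ht1 : t ≤ 1) (hθ0 : 0 ≤ θ) (hθ : θ ≤ Real.pi) :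
    t * Real.sin θ ≤ Real.sin (t * θ) := by
  have h := strictConcaveOn_sin_Icc.concaveOn.2 (x := θ) ⟨hθ0, hθ⟩ (y := 0) ⟨le_rfl, Real.pi_pos.le⟩
    ht0 (sub_nonneg.2 ht1) (by ring)
  simpa using h

/-- The imaginary part is `|z|^(α-1) sin((α-1) arg z)`. Concavity of the sine on `[0, π]` with `0 ≤
α - 1 ≤ 1` extracts the factor `α - 1`, and `sin (arg z) = ω / |z|`. Then `|z| ≤ λ + ω` is used with
the nonpositive exponent `α - 2`. -/
theorem le_im_cpow {lam α ω : ℝ} (hlam : 0 ≤ lam) (hα₁ : 1 < α) (hα₂ : α ≤ 2) (hω : 0 < ω) :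
    (α - 1) * (lam + ω) ^ (α - 2) * ω
      ≤ (((lam : ℂ) + (ω : ℝ) * Complex.I) ^ ((α - 1 : ℝ) : ℂ)).im := by
  set z : ℂ := (lam : ℂ) + (ω : ℝ) * Complex.I
  have hzim : z.im = ω := by simp [z]
  have hzre : z.re = lam := by simp [z]
  have hz0 : z ≠ 0 := fun h => hω.ne' (by rw [← hzim, h, Complex.zero_im])
  have hr : 0 < ‖z‖ := norm_pos_iff.2 hz0
  have harg0 : 0 ≤ z.arg := Complex.arg_nonneg_iff.2 (by rw [hzim]; exact hω.le)
  have him : (z ^ ((α - 1 : ℝ) : ℂ)).im = ‖z‖ ^ (α - 1) * Real.sin ((α - 1) * z.arg) := by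
    rw [Complex.cpow_ofReal_im, mul_comm z.arg]
  have hsin : (α - 1) * (ω / ‖z‖) ≤ Real.sin ((α - 1) * z.arg) := by
    have h := mul_sin_le_sin_mul (by linarith) (by linarith : α - 1 ≤ 1) harg0 (Complex.arg_le_pi z)
    rwa [Complex.sin_arg, hzim] at h
  have hle : ‖z‖ ≤ lam + ω := by
    refine (norm_add_le _ _).trans ?_
    rw [Complex.norm_real, norm_mul, Complex.norm_I, mul_one, Complex.norm_real,
      Real.norm_of_nonneg hlam, Real.norm_of_nonneg hω.le]
  rw [him]
  calc (α - 1) * (lam + ω) ^ (α - 2) * ω ≤ (α - 1) * ‖z‖ ^ (α - 2) * ω := by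
        have hα : 0 ≤ α - 1 := by linarith
        gcongr (α - 1) * ?_ * ω
        exact Real.rpow_le_rpow_of_nonpos hr hle (by linarith)
    _ = ‖z‖ ^ (α - 1) * ((α - 1) * (ω / ‖z‖)) := by
        rw [show α - 1 = (α - 2) + 1 by ring, Real.rpow_add hr, Real.rpow_one]
        field_simp
    _ ≤ _ := by gcongr

theorem hasDerivAt_cpow_re {lam α ω : ℝ} (hω : 0 < ω) :
    HasDerivAt (fun ω : ℝ => (((lam : ℂ) + (ω : ℝ) * Complex.I) ^ (α : ℂ)).re)
      (-(α * (((lam : ℂ) + (ω : ℝ) * Complex.I) ^ ((α - 1 : ℝ) : ℂ)).im)) ω := by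
  have hz : (lam : ℂ) + (ω : ℝ) * Complex.I ∈ Complex.slitPlane :=
    Complex.mem_slitPlane_iff.2 (Or.inr (by simpa using hω.ne'))
  have h1 : HasDerivAt (fun ω : ℝ => (lam : ℂ) + (ω : ℝ) * Complex.I) Complex.I ω := by
    have h := (((hasDerivAt_id (ω : ℂ)).comp_ofReal).mul_const Complex.I).const_add (lam : ℂ)
    simpa using h
  have h2 := HasDerivAt.comp ω ((hasDerivAt_id ((lam : ℂ) + (ω : ℝ) * Complex.I)).cpow_const (c := (α : ℂ)) hz) h1
  have h3 := Complex.reCLM.hasFDerivAt.comp_hasDerivAt ω h2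
  refine h3.congr_deriv ?_
  rw [Complex.reCLM_apply]
  have : (α : ℂ) - 1 = ((α - 1 : ℝ) : ℂ) := by push_cast; rfl
  rw [this]
  simp [Complex.mul_re, Complex.mul_im]

theorem continuousOn_cpow_re {lam α : ℝ} (hlam : 0 ≤ lam) (hα : 0 < α) :
    Continuous (fun ω : ℝ => (((lam : ℂ) + (ω : ℝ) * Complex.I) ^ (α : ℂ)).re) := by
  refine Complex.continuous_re.comp (continuous_iff_continuousAt.2 fun ω => ?_)
  have h := Complex.continuousAt_cpow_const_of_re_pos (z := (lam : ℂ) + (ω : ℝ) * Complex.I)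
    (w := (α : ℂ)) (Or.inl (by simpa using hlam)) (by simpa using hα)
  exact ContinuousAt.comp (f := fun ω : ℝ => (lam : ℂ) + (ω : ℝ) * Complex.I) h
    (by fun_prop)

theorem cpow_re_zero {lam α : ℝ} (hlam : 0 ≤ lam) :
    (((lam : ℂ) + ((0 : ℝ) : ℂ) * Complex.I) ^ (α : ℂ)).re = lam ^ α := by
  rw [Complex.ofReal_zero, zero_mul, add_zero, ← Complex.ofReal_cpow hlam, Complex.ofReal_re]

/-- The real part has derivative `-α Im z^(α-1) ≤ 0` for `ω > 0`, and its value at `ω = 0` is `λ^α`.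
-/
theorem cpow_re_le {lam α ω : ℝ} (hlam : 0 ≤ lam) (hα₁ : 1 < α) (hα₂ : α ≤ 2) (hω : 0 ≤ ω) :
    (((lam : ℂ) + (ω : ℝ) * Complex.I) ^ (α : ℂ)).re ≤ lam ^ α := by
  have h : AntitoneOn (fun ω : ℝ => (((lam : ℂ) + (ω : ℝ) * Complex.I) ^ (α : ℂ)).re) (Ici 0) := by
    refine antitoneOn_of_deriv_nonpos (convex_Ici 0)
      (continuousOn_cpow_re hlam (by linarith)).continuousOn ?_ ?_
    · intro x hx
      rw [interior_Ici] at hx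
      exact (hasDerivAt_cpow_re hx).differentiableAt.differentiableWithinAt
    · intro x hx
      rw [interior_Ici] at hx
      have hx' : 0 < x := hx
      rw [(hasDerivAt_cpow_re hx).deriv]
      have h := le_im_cpow hlam hα₁ hα₂ hx'
      have h2 : 0 ≤ (α - 1) * (lam + x) ^ (α - 2) * x :=
        mul_nonneg (mul_nonneg (by linarith) (by positivity)) hx'.le
      nlinarith
  have h' := h (mem_Ici.2 le_rfl) (mem_Ici.2 hω) hω
  simp only at h'
  rwa [cpow_re_zero hlam] at h'

/-- The derivative bound is strong enough for the real part plus `κ ω^α` to remain decreasing on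
`[δ, ∞)`. The cutoff is unavoidable: for `λ > 0` the gap is only quadratic near 0, which is weaker
than `ω^α` when `α < 2`. -/
theorem exists_cpow_re_le {lam α δ : ℝ} (hlam : 0 ≤ lam) (hα₁ : 1 < α) (hα₂ : α ≤ 2) (hδ : 0 < δ) :
    ∃ κ > 0, ∀ ω, 2 * δ ≤ ω →
      κ * ω ^ α ≤ lam ^ α - (((lam : ℂ) + (ω : ℝ) * Complex.I) ^ (α : ℂ)).re := by
  -- For `x ≥ δ` one has `λ + x ≤ (1 + λ/δ) x`, which turns the lower bound for the imaginary part
  -- into a multiple of `x^(α-1)`.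
  set κ : ℝ := (α - 1) * (1 + lam / δ) ^ (α - 2) with hκ
  have hκ0 : 0 < κ := mul_pos (by linarith) (by positivity)
  have h : AntitoneOn (fun ω : ℝ => (((lam : ℂ) + (ω : ℝ) * Complex.I) ^ (α : ℂ)).re + κ * ω ^ α)
      (Ici δ) := by
    refine antitoneOn_of_deriv_nonpos (convex_Ici δ)
      ((continuousOn_cpow_re hlam (by linarith)).add (continuous_const.mul
        (Real.continuous_rpow_const (by linarith)))).continuousOn ?_ ?_
    · intro x hx
      rw [interior_Ici] at hx
      have hx0 : 0 < x := hδ.trans hx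
      exact ((hasDerivAt_cpow_re hx0).add ((Real.hasDerivAt_rpow_const
        (Or.inl hx0.ne')).const_mul κ)).differentiableAt.differentiableWithinAt
    · intro x hx
      rw [interior_Ici] at hx
      have hx1 : δ < x := hx
      have hx0 : 0 < x := hδ.trans hx
      have hd := ((hasDerivAt_cpow_re (lam := lam) (α := α) hx0).add ((Real.hasDerivAt_rpow_const
        (p := α) (Or.inl hx0.ne')).const_mul κ)).deriv
      refine hd.trans_le ?_
      have h := le_im_cpow hlam hα₁ hα₂ hx0
      have h2 : κ * x ^ (α - 1) ≤ (α - 1) * (lam + x) ^ (α - 2) * x := by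
        have e1 : lam + x ≤ (1 + lam / δ) * x := by
          have : lam ≤ lam / δ * x := by
            rw [div_mul_eq_mul_div, le_div_iff₀ hδ]; nlinarith
          nlinarith
        have e2 : ((1 + lam / δ) * x) ^ (α - 2) ≤ (lam + x) ^ (α - 2) :=
          Real.rpow_le_rpow_of_nonpos (by positivity) e1 (by linarith)
        rw [Real.mul_rpow (by positivity) hx0.le] at e2
        calc κ * x ^ (α - 1) = (α - 1) * ((1 + lam / δ) ^ (α - 2) * x ^ (α - 2)) * x := by
              rw [hκ, show x ^ (α - 1) = x ^ (α - 2) * x by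
                rw [show α - 1 = (α - 2) + 1 by ring, Real.rpow_add hx0, Real.rpow_one]]
              ring
          _ ≤ _ := by
              gcongr
      nlinarith
  -- Half of `κ` pays for the term `κ δ^α` at the starting point: `ω ≥ 2δ` and `α > 1` give `δ^α ≤
  -- ω^α / 2`.
  refine ⟨κ / 2, by positivity, fun ω hω => ?_⟩
  have hδω : δ ≤ ω := by linarith
  have h1 := h (mem_Ici.2 le_rfl) (mem_Ici.2 hδω) hδω
  simp only at h1
  have h2 := cpow_re_le hlam hα₁ hα₂ hδ.le
  have h3 : δ ^ α ≤ ω ^ α / 2 := by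
    calc δ ^ α ≤ (ω / 2) ^ α := Real.rpow_le_rpow hδ.le (by linarith) (by linarith)
      _ = ω ^ α * (1 / 2) ^ α := by
          rw [← Real.mul_rpow (by linarith) (by norm_num)]; congr 1; ring
      _ ≤ ω ^ α * (1 / 2) ^ (1 : ℝ) := by
          have := Real.rpow_nonneg (hδ.le.trans hδω) α
          gcongr ω ^ α * ?_
          exact Real.rpow_le_rpow_of_exponent_ge (by norm_num) (by norm_num) hα₁.le
      _ = _ := by rw [Real.rpow_one]; ring
  nlinarith

theorem sym_re_abs {lam α : ℝ} (hlam : 0 ≤ lam) (ξ : ℝ) :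
    (sym lam α ξ).re = (((lam : ℂ) + (|2 * Real.pi * ξ| : ℝ) * Complex.I) ^ (α : ℂ)).re := by
  rcases le_or_gt 0 ξ with h | h
  · rw [abs_of_nonneg (by positivity)]; rfl
  · rw [← conj_sym_neg hlam h.ne, Complex.conj_re]
    unfold sym
    rw [abs_of_nonpos (by nlinarith [Real.pi_pos])]
    congr 5
    ring

theorem sym_re_le {lam α : ℝ} (hlam : 0 ≤ lam) (hα₁ : 1 < α) (hα₂ : α ≤ 2) (ξ : ℝ) :
    (sym lam α ξ).re ≤ lam ^ α := by
  rw [sym_re_abs hlam]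
  exact cpow_re_le hlam hα₁ hα₂ (abs_nonneg _)

/-! ### Coercivity on test functions -/

/-- The transform is bounded by the `L¹` norm, hence by Cauchy–Schwarz on an interval of length `b -
a`. This is the substitute for a Poincaré inequality. -/
theorem norm_ft_sq_le {a b : ℝ} (hab : a < b) (φ : Test a b) (ξ : ℝ) :
    ‖ft φ ξ‖ ^ 2 ≤ (b - a) * ‖toL2 a b φ‖ ^ 2 := by
  have h1 : ‖ft φ ξ‖ₑ ≤ eLpNorm φ 1 ((volume : Measure ℝ).restrict (Ioo a b)) := by
    rw [ft_eq, Real.fourier_eq', eLpNorm_one_eq_lintegral_enorm]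
    refine (enorm_integral_le_lintegral_enorm _).trans (le_of_eq ?_)
    rw [← lintegral_indicator measurableSet_Ioo]
    refine lintegral_congr fun x => ?_
    rw [enorm_smul, ← ofReal_norm (Complex.exp _), Complex.norm_exp_ofReal_mul_I, ENNReal.ofReal_one,
      one_mul, enorm_complex_ofReal]
    by_cases hx : x ∈ Ioo a b
    · rw [indicator_of_mem hx]
    · rw [indicator_of_notMem hx, test_eq_zero_of_notMem φ hx, enorm_zero]
  have h2 := eLpNorm_le_eLpNorm_mul_rpow_measure_univ (p := 1) (q := 2) (by norm_num)
    (memLp_test a b φ).aestronglyMeasurable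
  have h3 : ‖toL2 a b φ‖ₑ = eLpNorm φ 2 ((volume : Measure ℝ).restrict (Ioo a b)) := by
    rw [Lp.enorm_def, eLpNorm_congr_ae (toL2_test_ae_eq φ)]
  rw [← h3, Measure.restrict_apply_univ, Real.volume_Ioo] at h2
  have h4 : ‖ft φ ξ‖ ≤ ‖toL2 a b φ‖ * (b - a) ^ (1 / 2 : ℝ) := by
    have h := h1.trans h2
    rw [ENNReal.ofReal_rpow_of_pos (sub_pos.2 hab), ← ofReal_norm, ← ofReal_norm,
      ← ENNReal.ofReal_mul (norm_nonneg _)] at h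
    have := (ENNReal.ofReal_le_ofReal_iff
      (mul_nonneg (norm_nonneg _) (Real.rpow_nonneg (sub_pos.2 hab).le _))).1 h
    refine this.trans (le_of_eq ?_)
    norm_num
  calc ‖ft φ ξ‖ ^ 2 ≤ (‖toL2 a b φ‖ * (b - a) ^ (1 / 2 : ℝ)) ^ 2 := by gcongr
    _ = _ := by
        rw [mul_pow, ← Real.sqrt_eq_rpow, Real.sq_sqrt (sub_pos.2 hab).le, mul_comm]

theorem eLpNorm_sq_eq_ofReal_integral {f : ℝ → ℂ} (hf : MemLp f 2) :
    eLpNorm f 2 ^ 2 = ENNReal.ofReal (∫ x, ‖f x‖ ^ 2) := by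
  rw [eLpNorm_two_sq, ofReal_integral_eq_lintegral_ofReal]
  · refine lintegral_congr fun x => ?_
    rw [ENNReal.ofReal_pow (norm_nonneg _), ofReal_norm]
  · exact hf.integrable_norm_pow two_ne_zero
  · exact .of_forall fun x => by positivity

theorem integral_norm_ft_sq {a b : ℝ} (φ : Test a b) :
    ∫ ξ, ‖ft φ ξ‖ ^ 2 = ‖toL2 a b φ‖ ^ 2 := by
  have h := eLpNorm_sq_eq_ofReal_integral (memLp_ft φ)
  rw [eLpNorm_ft, ← ofReal_norm, ← ENNReal.ofReal_pow (norm_nonneg _)] at h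
  exact ((ENNReal.ofReal_eq_ofReal_iff (by positivity)
    (integral_nonneg fun ξ => by positivity)).1 h).symm

theorem norm_sym_zero_mul_ft_sq {μ : ℝ} (hμ0 : 0 ≤ μ) {a b : ℝ} (φ : Test a b) (ξ : ℝ) :
    ‖sym 0 μ ξ * ft φ ξ‖ ^ 2 = |2 * Real.pi * ξ| ^ (2 * μ) * ‖ft φ ξ‖ ^ 2 := by
  rw [norm_mul, mul_pow, norm_sym_zero hμ0, ← Real.rpow_mul_natCast (abs_nonneg _)]
  congr 2
  push_cast; ring

theorem sobolevENorm_sq (a b s : ℝ) (u : L2 a b) :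
    sobolevENorm a b s u ^ 2 = ‖u‖ₑ ^ 2 + sobolevSeminorm a b s u ^ 2 := by
  unfold sobolevENorm
  rw [← ENNReal.rpow_natCast, ← ENNReal.rpow_mul]
  norm_num

/-- The zero extension competes in the infimum; 7 exceeds the factor `2π` between the two Fourier
normalisations. -/
theorem sobolevENorm_test_sq_le {μ : ℝ} (hμ0 : 0 ≤ μ) (hμ1 : μ ≤ 1) {a b : ℝ} (φ : Test a b) :
    ‖HZero.ofTest (a := a) (b := b) hμ0 hμ1 φ‖ ^ 2
      ≤ 7 * ∫ ξ, (1 + |2 * Real.pi * ξ| ^ (2 * μ)) * ‖ft φ ξ‖ ^ 2 := by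
  have hi1 := (memLp_ft φ).integrable_norm_pow two_ne_zero
  have hi2 := (memLp_sym_mul_ft le_rfl hμ0 hμ1 φ).integrable_norm_pow two_ne_zero
  have h0 : sobolevSeminorm a b μ (toL2 a b φ) ^ 2
      ≤ ENNReal.ofReal (2 * Real.pi * ∫ ξ, ‖sym 0 μ ξ * ft φ ξ‖ ^ 2) := by
    rw [ENNReal.ofReal_mul (by positivity), ← eLpNorm_sq_eq_ofReal_integral
      (memLp_sym_mul_ft le_rfl hμ0 hμ1 φ), eLpNorm_sym_zero_mul_ft_sq hμ0, ← sobolevSeminormR_sq]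
    gcongr
    exact sobolevSeminorm_le_zeroExt μ _
  have h1 : ENNReal.ofReal (‖HZero.ofTest (a := a) (b := b) hμ0 hμ1 φ‖ ^ 2)
      ≤ ENNReal.ofReal (‖toL2 a b φ‖ ^ 2 + 2 * Real.pi * ∫ ξ, ‖sym 0 μ ξ * ft φ ξ‖ ^ 2) := by
    rw [ENNReal.ofReal_pow (norm_nonneg _), ofReal_norm, HZero.enorm_eq, HZero.val_ofTest,
      sobolevENorm_sq, ENNReal.ofReal_add (by positivity) (by positivity),
      ENNReal.ofReal_pow (norm_nonneg _), ofReal_norm]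
    gcongr
  have hI : 0 ≤ ∫ ξ, ‖sym 0 μ ξ * ft φ ξ‖ ^ 2 := integral_nonneg fun ξ => by positivity
  have h2 := (ENNReal.ofReal_le_ofReal_iff (by positivity)).1 h1
  refine h2.trans ?_
  have e : ∫ ξ, (1 + |2 * Real.pi * ξ| ^ (2 * μ)) * ‖ft φ ξ‖ ^ 2
      = ‖toL2 a b φ‖ ^ 2 + ∫ ξ, ‖sym 0 μ ξ * ft φ ξ‖ ^ 2 := by
    rw [← integral_norm_ft_sq, ← integral_add hi1 hi2]
    refine integral_congr_ae (.of_forall fun ξ => ?_)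
    simp only [norm_sym_zero_mul_ft_sq hμ0]
    ring
  rw [e]
  nlinarith [Real.pi_lt_d2, sq_nonneg ‖toL2 a b φ‖]

theorem integrable_sym_mul_norm_ft_sq {lam s : ℝ} (hlam : 0 ≤ lam) (hs0 : 0 ≤ s) (hs1 : s ≤ 1)
    {a b : ℝ} (φ : Test a b) :
    Integrable fun ξ => sym lam (s + s) ξ * (ft φ ξ * (starRingEnd ℂ) (ft φ ξ)) := by
  refine ((memLp_sym_mul_ft hlam hs0 hs1 φ).integrable_norm_pow two_ne_zero).mono
    ((measurable_sym _ _).aestronglyMeasurable.mul ?_) (.of_forall fun ξ => ?_)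
  · exact ((continuous_ft φ).mul (Complex.continuous_conj.comp (continuous_ft φ))).aestronglyMeasurable
  · rw [Real.norm_of_nonneg (by positivity), norm_mul, norm_mul, norm_mul, RCLike.norm_conj,
      norm_sym _ _ (add_nonneg hs0 hs0), norm_sym _ _ hs0, mul_pow, ← Real.rpow_mul_natCast (norm_nonneg _)]
    refine le_of_eq ?_
    rw [pow_two ‖ft φ ξ‖]
    congr 2
    push_cast; ring

theorem inner_leftDeriv_rightDeriv_self {lam s : ℝ} (hlam : 0 ≤ lam) (hs0 : 0 ≤ s) (hs1 : s ≤ 1)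
    {a b : ℝ} (φ : Test a b) :
    (inner ℝ (toL2 a b (leftDeriv a s lam φ)) (toL2 a b (rightDeriv b s lam φ)) : ℝ)
      = ∫ ξ, (sym lam (s + s) ξ).re * ‖ft φ ξ‖ ^ 2 := by
  have h := congrArg Complex.re (inner_leftDeriv_rightDeriv hs0 hs1 hs0 hs1 hlam φ φ)
  rw [Complex.ofReal_re] at h
  rw [h]
  have h2 := integral_re (integrable_sym_mul_norm_ft_sq hlam hs0 hs1 φ)
  refine Eq.trans ?_ (h2.symm.trans ?_)
  · rfl
  · refine integral_congr_ae (.of_forall fun ξ => ?_)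
    simp only [RCLike.re_to_complex]
    rw [Complex.mul_conj, Complex.re_mul_ofReal, Complex.normSq_eq_norm_sq]

/-- Coercivity of the tempered fractional diffusion term on test functions. -/
theorem exists_coercive_test {α lam : ℝ} (hα₁ : 1 < α) (hα₂ : α ≤ 2) (hlam : 0 ≤ lam) {a b : ℝ}
    (hab : a < b) (hs0 : 0 ≤ α / 2) (hs1 : α / 2 ≤ 1) : ∃ k > 0, ∀ φ : Test a b,
      k * ‖HZero.ofTest (a := a) (b := b) hs0 hs1 φ‖ ^ 2 ≤ lam ^ α * ‖toL2 a b φ‖ ^ 2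
        - inner ℝ (toL2 a b (leftDeriv a (α / 2) lam φ)) (toL2 a b (rightDeriv b (α / 2) lam φ)) := by
  have hba : 0 < b - a := sub_pos.2 hab
  -- The first bound makes `|ω|^α ≤ 1` on the low band `|ω| < 2δ`; the second makes the contribution
  -- of that band at most `½ ‖φ‖²`.
  set δ : ℝ := min (1 / 2) (1 / (4 * (b - a))) with hδdef
  have hδ : 0 < δ := by positivity
  have hδ1 : 2 * δ ≤ 1 := by have := min_le_left (1 / 2) (1 / (4 * (b - a))); linarith
  have hδ2 : 4 * δ * (b - a) ≤ 1 := by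
    have h := min_le_right (1 / 2) (1 / (4 * (b - a)))
    rw [← hδdef, le_div_iff₀ (by positivity)] at h
    linarith
  obtain ⟨κ, hκ, hκ'⟩ := exists_cpow_re_le hlam hα₁ hα₂ hδ
  -- For `|ω| ≥ 2δ`, `1 + |ω|^α ≤ (1 + (2δ)^(-α)) |ω|^α`, which is at most `B` times the gap `λ^α -
  -- Re (λ + iω)^α`.
  set B : ℝ := (1 + (2 * δ) ^ (-α)) / κ with hB
  have hB0 : 0 < B := by positivity
  -- With `E = ∫ (1 + |ω|^α) |φ̂|²`, the squared norm is at most `7 E`, and `E ≤ B ∫ G + ½ ‖φ‖² ≤ B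
  -- ∫ G + ½ E` gives `E ≤ 2 B ∫ G`.
  refine ⟨1 / (14 * B), by positivity, fun φ => ?_⟩
  set G : ℝ → ℝ := fun ξ => (lam ^ α - (sym lam α ξ).re) * ‖ft φ ξ‖ ^ 2 with hG
  set low : Set ℝ := Ioo (-(δ / Real.pi)) (δ / Real.pi) with hlow
  have hss : α / 2 + α / 2 = α := by ring
  have hi1 := (memLp_ft φ).integrable_norm_pow two_ne_zero
  have hi2 := (memLp_sym_mul_ft le_rfl hs0 hs1 φ).integrable_norm_pow two_ne_zero
  have hi3 : Integrable fun ξ => (sym lam α ξ).re * ‖ft φ ξ‖ ^ 2 := by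
    have h := (integrable_sym_mul_norm_ft_sq hlam hs0 hs1 φ).re
    refine h.congr (.of_forall fun ξ => ?_)
    simp only [RCLike.re_to_complex]
    rw [Complex.mul_conj, Complex.re_mul_ofReal, Complex.normSq_eq_norm_sq, hss]
  have hiG : Integrable G := by
    refine ((hi1.const_mul (lam ^ α)).sub hi3).congr (.of_forall fun ξ => ?_)
    simp only [hG, Pi.sub_apply]; ring
  have hIG : ∫ ξ, G ξ = lam ^ α * ‖toL2 a b φ‖ ^ 2
      - inner ℝ (toL2 a b (leftDeriv a (α / 2) lam φ)) (toL2 a b (rightDeriv b (α / 2) lam φ)) := by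
    rw [inner_leftDeriv_rightDeriv_self hlam hs0 hs1, hss, ← integral_norm_ft_sq, ← integral_const_mul,
      ← integral_sub (hi1.const_mul _) hi3]
    refine integral_congr_ae (.of_forall fun ξ => ?_)
    simp only [hG]; ring
  have hpt : ∀ ξ, (1 + |2 * Real.pi * ξ| ^ (2 * (α / 2))) * ‖ft φ ξ‖ ^ 2
      ≤ B * G ξ + low.indicator (fun _ => 2 * ((b - a) * ‖toL2 a b φ‖ ^ 2)) ξ := fun ξ => by
    have hω : 2 * (α / 2) = α := by ring
    rw [hω]
    have hG0 : 0 ≤ G ξ := mul_nonneg (sub_nonneg.2 (sym_re_le hlam hα₁ hα₂ ξ)) (by positivity)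
    by_cases hξ : ξ ∈ low
    · rw [indicator_of_mem hξ]
      have h1 : |2 * Real.pi * ξ| ≤ 1 := by
        have h2 : |ξ| < δ / Real.pi := abs_lt.2 hξ
        rw [lt_div_iff₀ Real.pi_pos] at h2
        rw [abs_mul, abs_of_pos (by positivity)]
        linarith
      have h2 : |2 * Real.pi * ξ| ^ α ≤ 1 := Real.rpow_le_one (abs_nonneg _) h1 (by linarith)
      have h3 := norm_ft_sq_le hab φ ξ
      have h4 : (1 + |2 * Real.pi * ξ| ^ α) * ‖ft φ ξ‖ ^ 2 ≤ 2 * ((b - a) * ‖toL2 a b φ‖ ^ 2) := by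
        gcongr
        linarith
      nlinarith [mul_nonneg hB0.le hG0]
    · rw [indicator_of_notMem hξ, add_zero]
      have h1 : 2 * δ ≤ |2 * Real.pi * ξ| := by
        have h2 : δ / Real.pi ≤ |ξ| := not_lt.1 fun h => hξ (abs_lt.1 h)
        rw [div_le_iff₀ Real.pi_pos] at h2
        rw [abs_mul, abs_of_pos (by positivity)]
        linarith
      have h2 := hκ' _ h1
      rw [← sym_re_abs hlam] at h2
      have h3 : 1 ≤ (2 * δ) ^ (-α) * |2 * Real.pi * ξ| ^ α := by
        rw [Real.rpow_neg (by positivity), ← div_eq_inv_mul, one_le_div (by positivity)]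
        exact Real.rpow_le_rpow (by positivity) h1 (by linarith)
      have h4 : 1 + |2 * Real.pi * ξ| ^ α ≤ B * (lam ^ α - (sym lam α ξ).re) := by
        calc _ ≤ (1 + (2 * δ) ^ (-α)) * |2 * Real.pi * ξ| ^ α := by linarith
          _ = B * (κ * |2 * Real.pi * ξ| ^ α) := by rw [hB]; field_simp
          _ ≤ _ := by gcongr
      simp only [hG, ← mul_assoc]
      gcongr
  have hil : Integrable (low.indicator fun _ => 2 * ((b - a) * ‖toL2 a b φ‖ ^ 2)) :=
    (integrable_indicator_iff measurableSet_Ioo).2 (integrableOn_const (by simp))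
  have hil' : ∫ ξ, low.indicator (fun _ => 2 * ((b - a) * ‖toL2 a b φ‖ ^ 2)) ξ
      ≤ 1 / 2 * ‖toL2 a b φ‖ ^ 2 := by
    rw [integral_indicator measurableSet_Ioo, setIntegral_const, measureReal_def, Real.volume_Ioo,
      ENNReal.toReal_ofReal (by have : 0 < δ / Real.pi := by positivity
                                linarith), smul_eq_mul]
    have h1 : δ / Real.pi ≤ δ / 2 := by gcongr; linarith [Real.pi_gt_three]
    have h2 : (δ / Real.pi - -(δ / Real.pi)) ≤ δ := by linarith
    calc _ ≤ δ * (2 * ((b - a) * ‖toL2 a b φ‖ ^ 2)) := by gcongr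
      _ = (4 * δ * (b - a)) * (1 / 2 * ‖toL2 a b φ‖ ^ 2) := by ring
      _ ≤ 1 * (1 / 2 * ‖toL2 a b φ‖ ^ 2) := by gcongr
      _ = _ := one_mul _
  set E := ∫ ξ, (1 + |2 * Real.pi * ξ| ^ (2 * (α / 2))) * ‖ft φ ξ‖ ^ 2
  have hiE : Integrable fun ξ => (1 + |2 * Real.pi * ξ| ^ (2 * (α / 2))) * ‖ft φ ξ‖ ^ 2 := by
    refine (hi1.add hi2).congr (.of_forall fun ξ => ?_)
    simp only [Pi.add_apply, norm_sym_zero_mul_ft_sq hs0]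
    ring
  have h1 : E ≤ B * (∫ ξ, G ξ) + 1 / 2 * ‖toL2 a b φ‖ ^ 2 := by
    refine (integral_mono hiE ((hiG.const_mul B).add hil) hpt).trans ?_
    have := integral_add (hiG.const_mul B) hil
    simp only [Pi.add_apply] at this ⊢
    rw [this, integral_const_mul]
    gcongr
  have h2 : ‖toL2 a b φ‖ ^ 2 ≤ E := by
    rw [← integral_norm_ft_sq]
    refine integral_mono hi1 hiE fun ξ => ?_
    have : 0 ≤ |2 * Real.pi * ξ| ^ (2 * (α / 2)) := by positivity
    simp only
    nlinarith [sq_nonneg ‖ft φ ξ‖]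
  have h3 := sobolevENorm_test_sq_le hs0 hs1 φ
  rw [← hIG, div_mul_eq_mul_div, one_mul, div_le_iff₀ (by positivity)]
  linarith

/-! ### The first-order terms -/

/-- Complementary fractional orders add up to a full derivative. -/
theorem inner_leftDeriv_rightDeriv_complementary {a b s : ℝ} (hs0 : 0 ≤ s) (hs1 : s ≤ 1)
    (φ ψ : Test a b) :
    (inner ℝ (toL2 a b (leftDeriv a s 0 φ)) (toL2 a b (rightDeriv b (1 - s) 0 ψ)) : ℝ)
      = ∫ x, testDeriv φ x * ψ x := by
  apply Complex.ofReal_injective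
  rw [inner_leftDeriv_rightDeriv hs0 hs1 (by linarith) (by linarith) le_rfl, ← integral_complex_ofReal]
  have h := integral_fourierInv_mul_conj (integrable_ft (testDeriv φ)) (memLp_ft (testDeriv φ))
    (integrable_ft ψ) (memLp_ft ψ)
  simp only [fourierInv_ft, Complex.conj_ofReal] at h
  push_cast
  rw [h]
  refine integral_congr_ae (.of_forall fun ξ => ?_)
  simp only [ft_testDeriv, sym]
  rw [add_sub_cancel]
  simp only [Complex.ofReal_zero, zero_add, Complex.ofReal_one, Complex.cpow_one]
  push_cast
  ring

/-- Integration by parts, with `2 φ φ'` read as the derivative of `φ²`; no boundary terms arise from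
compact support. -/
theorem integral_testDeriv_mul {a b : ℝ} {q : ℝ → ℝ} (hq : ContDiff ℝ (⊤ : ℕ∞) q) (φ : Test a b) :
    ∫ x, testDeriv φ x * (q x * φ x) = -(1 / 2) * ∫ x, deriv q x * φ x ^ 2 := by
  have hqd : ∀ x, HasDerivAt q (deriv q x) x := fun x =>
    (hq.differentiable (by simp) x).hasDerivAt
  have hqc : Continuous (deriv q) := hq.continuous_deriv (by simp)
  have hs : ∀ f : ℝ → ℝ, Continuous f → Integrable fun x => f x * φ x := fun f hf =>
    (hf.mul φ.continuous).integrable_of_hasCompactSupport φ.hasCompactSupport.mul_left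
  have h := integral_mul_deriv_eq_deriv_mul_of_integrable (u := q) (v := fun x => φ x ^ 2)
    (u' := deriv q) (v' := fun x => 2 * φ x * testDeriv φ x) (fun x _ => hqd x)
    (fun x _ => by simpa using! (hasDerivAt_test φ x).pow 2) ?_ ?_ ?_
  · have e : ∫ x, q x * (2 * φ x * testDeriv φ x) = 2 * ∫ x, testDeriv φ x * (q x * φ x) := by
      rw [← integral_const_mul]
      exact integral_congr_ae (.of_forall fun x => by ring)
    linarith
  · refine (hs (fun x => q x * 2 * testDeriv φ x) (by
      have := hq.continuous; have := (testDeriv φ).continuous; fun_prop)).congr (.of_forall fun x => ?_)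
    simp only [Pi.mul_apply]; ring
  · refine (hs (fun x => deriv q x * φ x) (by have := φ.continuous; fun_prop)).congr
      (.of_forall fun x => ?_)
    simp only [Pi.mul_apply]; ring
  · refine (hs (fun x => q x * φ x) (by have := φ.continuous; have := hq.continuous; fun_prop)).congr
      (.of_forall fun x => ?_)
    simp only [Pi.mul_apply]; ring

theorem integral_testDeriv_mul_self {a b : ℝ} (φ : Test a b) :
    ∫ x, testDeriv φ x * φ x = 0 := by
  have h := integral_testDeriv_mul (q := fun _ => 1) contDiff_const φ
  simpa using h

theorem inner_mulL2_test {a b : ℝ} {g : ℝ → ℝ} (hg : ContinuousOn g (Icc a b)) (φ : Test a b) :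
    (inner ℝ (mulL2 g (toL2 a b φ)) (toL2 a b φ) : ℝ) = ∫ x in Ioo a b, g x * φ x ^ 2 := by
  rw [L2.inner_def]
  refine integral_congr_ae ?_
  filter_upwards [mulL2_ae_eq hg (toL2 a b φ), toL2_test_ae_eq φ] with x h1 h2
  rw [h1, h2]
  simp only [RCLike.inner_apply, conj_trivial]
  ring

theorem integrableOn_mul_test_sq {a b : ℝ} {g : ℝ → ℝ} (hg : ContinuousOn g (Icc a b))
    (φ : Test a b) : IntegrableOn (fun x => g x * φ x ^ 2) (Ioo a b) :=
  ((hg.mul ((φ.continuous.pow 2).continuousOn)).integrableOn_Icc).mono_set Ioo_subset_Icc_self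

/-- The advection and reaction terms together are nonnegative on test functions. -/
theorem advection_add_reaction_nonneg {a b s : ℝ} (hab : a < b) (hs0 : 0 ≤ s) (hs1 : s ≤ 1)
    (hs : s ≠ 1 / 2) (hs' : 1 - s ≤ s) {m c : ℝ → ℝ} (hm : ContDiffOn ℝ 1 m (Icc a b))
    (hc : ContinuousOn c (Icc a b)) (hmc : ∀ x ∈ Ioo a b, 0 < c x - deriv m x / 2) (hs0' : 0 < s)
    {L : HZero a b s →L[ℝ] L2 a b} {R : HZero a b (1 - s) →L[ℝ] L2 a b}
    {S : HZero a b s →L[ℝ] HZero a b (1 - s)} (hs2 : 0 ≤ 1 - s) (hs3 : 1 - s ≤ 1)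
    (hL : ∀ φ, L (HZero.ofTest hs0 hs1 φ) = toL2 a b (leftDeriv a s 0 φ))
    (hR : ∀ φ, R (HZero.ofTest hs2 hs3 φ) = toL2 a b (rightDeriv b (1 - s) 0 φ))
    (hS : ∀ v, (S v).val = mulL2 m v.val) (φ : Test a b) :
    0 ≤ inner ℝ (L (HZero.ofTest hs0 hs1 φ)) (R (S (HZero.ofTest hs0 hs1 φ)))
      + inner ℝ (mulL2 c (toL2 a b φ)) (toL2 a b φ) := by
  set v := HZero.ofTest (a := a) (b := b) hs0 hs1 φ with hv
  set N := ‖L v‖ * (‖R‖ * ‖v‖) + ‖toL2 a b φ‖ ^ 2 with hN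
  have hN0 : 0 ≤ N := by positivity
  set T : ℝ := inner ℝ (L v) (R (S v)) + inner ℝ (mulL2 c (toL2 a b φ)) (toL2 a b φ) with hT
  -- Replacing `m` by a smooth `q` that is `ε`-close makes the product a test function, for which
  -- the term is `-½ ∫ q' φ²`. The two parts of `N` account for the change in the product and for
  -- the change of `m'` to `q'`.
  have key : ∀ ε : ℝ≥0, 0 < ε → -(ε * N) ≤ T := by
    intro ε hε
    obtain ⟨q, hq, hq1, hq2⟩ := exists_testMul_near hs2 (by linarith) hs' hs1 hs hab hm hε
    set w := HZero.ofTest (a := a) (b := b) hs2 hs3 (testMul q hq φ) with hw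
    have h1 : ‖S v - w‖ ≤ ε * ‖v‖ := by
      have h := hq2 φ
      rw [← HZero.val_ofTest hs0 hs1, ← hS, ← HZero.val_ofTest hs2 hs3 (testMul q hq φ), ← map_sub,
        ← HZero.enorm_eq, ← HZero.enorm_eq, enorm_eq_nnnorm, enorm_eq_nnnorm] at h
      exact_mod_cast h
    have h2 : |(inner ℝ (L v) (R (S v - w)) : ℝ)| ≤ ε * (‖L v‖ * (‖R‖ * ‖v‖)) := by
      refine (abs_real_inner_le_norm _ _).trans ?_
      calc ‖L v‖ * ‖R (S v - w)‖ ≤ ‖L v‖ * (‖R‖ * (ε * ‖v‖)) := by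
            gcongr
            exact (R.le_opNorm _).trans (by gcongr)
        _ = _ := by ring
    have h3 : (inner ℝ (L v) (R w) : ℝ) = -(1 / 2) * ∫ x in Ioo a b, deriv q x * φ x ^ 2 := by
      rw [hL, hR, inner_leftDeriv_rightDeriv_complementary hs0 hs1,
        setIntegral_eq_integral_of_forall_compl_eq_zero (s := Ioo a b)
          (f := fun x => deriv q x * φ x ^ 2)
          (fun x hx => by rw [test_eq_zero_of_notMem φ hx]; ring)]
      exact integral_testDeriv_mul hq φ
    have hqc : ContinuousOn (deriv q) (Icc a b) := (hq.continuous_deriv (by simp)).continuousOn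
    have h4 : -(ε * ‖toL2 a b φ‖ ^ 2) ≤ (inner ℝ (L v) (R w) : ℝ)
        + inner ℝ (mulL2 c (toL2 a b φ)) (toL2 a b φ) := by
      have e1 : ‖toL2 a b φ‖ ^ 2 = ∫ x in Ioo a b, φ x ^ 2 := by
        rw [← real_inner_self_eq_norm_sq, L2.inner_def]
        refine integral_congr_ae ?_
        filter_upwards [toL2_test_ae_eq φ] with x h2
        rw [h2]
        simp only [RCLike.inner_apply, conj_trivial]
        ring
      have i1 := integrableOn_mul_test_sq hqc φ
      have i2 := integrableOn_mul_test_sq hc φ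
      have i3 : IntegrableOn (fun x => φ x ^ 2) (Ioo a b) := by
        simpa using integrableOn_mul_test_sq (g := fun _ => 1) continuousOn_const φ
      rw [h3, inner_mulL2_test hc, e1, ← integral_const_mul, ← integral_const_mul, ← integral_neg,
        ← integral_add (i1.const_mul _) i2]
      refine setIntegral_mono_on (i3.const_mul _).neg ((i1.const_mul _).add i2) measurableSet_Ioo ?_
      intro x hx
      have hd : derivWithin m (Icc a b) x = deriv m x :=
        derivWithin_of_mem_nhds (Icc_mem_nhds hx.1 hx.2)
      have h5 := hq1 x (Ioo_subset_Icc_self hx)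
      rw [hd] at h5
      have h6 := neg_le_of_abs_le h5
      have h7 := hmc x hx
      have h8 : 0 ≤ c x - deriv q x / 2 + ε := by
        have := ε.coe_nonneg
        linarith
      nlinarith [mul_nonneg h8 (sq_nonneg (φ x))]
    have h5 : T = inner ℝ (L v) (R (S v - w)) + ((inner ℝ (L v) (R w) : ℝ)
        + inner ℝ (mulL2 c (toL2 a b φ)) (toL2 a b φ)) := by
      rw [hT, map_sub, inner_sub_right]; ring
    rw [h5]
    have := neg_le_of_abs_le h2
    rw [hN]
    linarith
  refine le_of_forall_pos_le_add fun η hη => ?_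
  -- Since `N` does not depend on `ε`, this choice makes the error at most an arbitrary `η`.
  have h := key (η / (N + 1)).toNNReal (by simpa using by positivity)
  rw [Real.coe_toNNReal _ (by positivity)] at h
  have h2 : η / (N + 1) * N ≤ η := by
    rw [div_mul_eq_mul_div, div_le_iff₀ (by positivity)]
    nlinarith
  linarith

/-! ### The Lax–Milgram theorem -/

/-- Lax–Milgram for a complete normed space that embeds into a Hilbert space. -/
theorem exists_eq_of_coercive {H E : Type*} [NormedAddCommGroup H] [NormedSpace ℝ H]
    [CompleteSpace H] [NormedAddCommGroup E] [InnerProductSpace ℝ E] [CompleteSpace E]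
    (J : H →L[ℝ] E) {κ : ℝ≥0} (hJ : AntilipschitzWith κ J) (B : H →L[ℝ] H →L[ℝ] ℝ) {k : ℝ}
    (hk : 0 < k) (hB : ∀ u, k * ‖u‖ ^ 2 ≤ B u u) (f : StrongDual ℝ H) :
    ∃ u, ∀ v, B u v = f v := by
  -- The range of `J` is closed, hence a Hilbert space, and linearly homeomorphic to `H`; the form
  -- is transported there along the inverse `g`.
  have hcl := hJ.isClosed_range J.uniformContinuous
  set e := J.equivRange hJ.injective hcl
  have : CompleteSpace (LinearMap.range J.toLinearMap) :=
    hcl.isComplete.completeSpace_coe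
  set g : LinearMap.range J.toLinearMap →L[ℝ] H := e.symm.toContinuousLinearMap
  set B' := B.bilinearComp g g
  have hB' : IsCoercive B' := by
    -- From `‖w‖ = ‖J (g w)‖ ≤ ‖J‖ ‖g w‖`; adding 1 keeps the denominator positive.
    refine ⟨k / (‖J‖ + 1) ^ 2, by positivity, fun w => ?_⟩
    have h1 : ‖w‖ ≤ (‖J‖ + 1) * ‖g w‖ := by
      have h2 : (w : E) = J (g w) := by
        have := congrArg Subtype.val (e.apply_symm_apply w)
        exact this.symm
      have h3 := J.le_opNorm (g w)
      rw [← h2] at h3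
      change ‖(w : E)‖ ≤ _
      nlinarith [norm_nonneg (g w)]
    refine le_trans ?_ (hB (g w))
    rw [div_mul_eq_mul_div, div_mul_eq_mul_div, div_le_iff₀ (by positivity)]
    have h4 : ‖w‖ ^ 2 ≤ ((‖J‖ + 1) * ‖g w‖) ^ 2 := by gcongr
    nlinarith
  set z := (InnerProductSpace.toDual ℝ (LinearMap.range J.toLinearMap)).symm (f.comp g)
  set A := hB'.continuousLinearEquivOfBilin
  refine ⟨g (A.symm z), fun v => ?_⟩
  have h1 : B' (A.symm z) (e v) = inner ℝ (A (A.symm z)) (e v) :=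
    (hB'.continuousLinearEquivOfBilin_apply _ _).symm
  have h2 : inner ℝ z (e v) = f (g (e v)) := InnerProductSpace.toDual_symm_apply
  have h3 : g (e v) = v := e.symm_apply_apply v
  rw [A.apply_symm_apply, h2, h3] at h1
  rw [← h1]
  change _ = B (g _) (g (e v))
  rw [h3]

/-- Uniqueness and the norm bound follow by testing with the difference of two solutions and with
the solution itself. The constant `1 / k` therefore does not involve the embedding `J`. -/
theorem existsUnique_of_coercive {H E : Type*} [NormedAddCommGroup H] [NormedSpace ℝ H]
    [CompleteSpace H] [NormedAddCommGroup E] [InnerProductSpace ℝ E] [CompleteSpace E]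
    (J : H →L[ℝ] E) {κ : ℝ≥0} (hJ : AntilipschitzWith κ J) (B : H →L[ℝ] H →L[ℝ] ℝ) {k : ℝ}
    (hk : 0 < k) (hB : ∀ u, k * ‖u‖ ^ 2 ≤ B u u) (f : StrongDual ℝ H) :
    ∃ u, (∀ v, B u v = f v) ∧ (∀ w, (∀ v, B w v = f v) → w = u) ∧ ‖u‖ ≤ 1 / k * ‖f‖ := by
  obtain ⟨u, hu⟩ := exists_eq_of_coercive J hJ B hk hB f
  refine ⟨u, hu, fun w hw => ?_, ?_⟩
  · have h := hB (w - u)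
    have h2 : B (w - u) (w - u) = 0 := by
      have h3 : B (w - u) = 0 := ContinuousLinearMap.ext fun v => by
        rw [map_sub, sub_apply, hw, hu, sub_self, zero_apply]
      rw [h3, zero_apply]
    rw [h2] at h
    have h3 : ‖w - u‖ ^ 2 ≤ 0 := nonpos_of_mul_nonpos_right h hk
    have h4 : ‖w - u‖ = 0 := by
      have := sq_nonneg ‖w - u‖
      exact pow_eq_zero_iff two_ne_zero |>.1 (le_antisymm h3 this)
    exact sub_eq_zero.1 (norm_eq_zero.1 h4)
  · have h := hB u
    rw [hu] at h
    have h2 : f u ≤ ‖f‖ * ‖u‖ := (le_abs_self _).trans (f.le_opNorm u)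
    rw [div_mul_eq_mul_div, one_mul, le_div_iff₀ hk]
    rcases (norm_nonneg u).eq_or_lt with h0 | h0
    · rw [← h0, zero_mul]; exact norm_nonneg _
    · refine le_of_mul_le_mul_right ?_ h0
      nlinarith

/-! ### The Galerkin form -/

/-- The inclusion `H₀^s(Ω) → L²(Ω)` as a continuous map. -/
def HZero.valL (a b s : ℝ) : HZero a b s →L[ℝ] L2 a b :=
  HZero.val.mkContinuous 1 fun u => by simpa using HZero.norm_val_le u

theorem HZero.valL_apply {a b s : ℝ} (u : HZero a b s) : HZero.valL a b s u = u.val := rfl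

/-- The bounded bilinear form `(P u, Q v)`. -/
def innerComp {H E : Type*} [NormedAddCommGroup H] [NormedSpace ℝ H] [NormedAddCommGroup E]
    [InnerProductSpace ℝ E] (P Q : H →L[ℝ] E) : H →L[ℝ] H →L[ℝ] ℝ :=
  (innerSL ℝ : E →L[ℝ] E →L[ℝ] ℝ).bilinearComp P Q

theorem innerComp_apply {H E : Type*} [NormedAddCommGroup H] [NormedSpace ℝ H]
    [NormedAddCommGroup E] [InnerProductSpace ℝ E] (P Q : H →L[ℝ] E) (u v : H) :
    innerComp P Q u v = inner ℝ (P u) (Q v) := rfl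

theorem exists_bilin {H E : Type*} [NormedAddCommGroup H] [NormedSpace ℝ H] [NormedAddCommGroup E]
    [InnerProductSpace ℝ E] (r₁ r₂ r₃ r₄ r₅ : ℝ) (L R V L₀ R₁ R₂ W : H →L[ℝ] E) :
    ∃ B : H →L[ℝ] H →L[ℝ] ℝ, ∀ u v, B u v = r₁ * inner ℝ (L u) (R v) - r₂ * inner ℝ (R u) (L v)
      + r₃ * inner ℝ (V u) (V v) + r₄ * inner ℝ (V u) (V v) + r₅ * inner ℝ (L₀ u) (R₁ v)
      + inner ℝ (L₀ u) (R₂ v) + inner ℝ (W u) (V v) :=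
  ⟨r₁ • innerComp L R - r₂ • innerComp R L + r₃ • innerComp V V + r₄ • innerComp V V
    + r₅ • innerComp L₀ R₁ + innerComp L₀ R₂ + innerComp W V, fun u v => by
    simp only [add_apply, sub_apply, smul_apply, innerComp_apply, smul_eq_mul]⟩

theorem exists_prod_map {H E : Type*} [NormedAddCommGroup H] [NormedSpace ℝ H]
    [NormedAddCommGroup E] [InnerProductSpace ℝ E] (V L : H →L[ℝ] E) :
    ∃ J : H →L[ℝ] WithLp 2 (E × E), ∀ u, ‖J u‖ ^ 2 = ‖V u‖ ^ 2 + ‖L u‖ ^ 2 :=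
  ⟨(WithLp.prodContinuousLinearEquiv 2 ℝ E E).symm.toContinuousLinearMap.comp (V.prod L), fun _ =>
    WithLp.prod_norm_sq_eq_of_L2 _⟩

/-- Besides writing the Galerkin form through bounded operators, this supplies the Hilbert space
embedding `J u = (u, L u)`. The diffusion estimate `k ‖u‖² ≤ λ^α ‖u‖²_{L²} - (L u, R u)` has
right-hand side at most `(λ^α + ‖R‖) ‖J u‖ ‖u‖`, so `J` is bounded below. -/
theorem exists_galerkinForm_eq {a b α lam p : ℝ} {m c : ℝ → ℝ} (hab : a < b) (hα₁ : 1 < α)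
    (hα₂ : α ≤ 2) (hlam : 0 ≤ lam) (hm : ContDiffOn ℝ 1 m (Icc a b))
    (hc : ContinuousOn c (Icc a b)) (hmc : ∀ x ∈ Ioo a b, 0 < c x - deriv m x / 2) :
    ∃ (B : HZero a b (α / 2) →L[ℝ] HZero a b (α / 2) →L[ℝ] ℝ)
      (J : HZero a b (α / 2) →L[ℝ] WithLp 2 (L2 a b × L2 a b)) (κ : ℝ≥0) (k : ℝ), 0 < k ∧
      (∀ u v, galerkinForm α lam p m c u.val v.val = B u v) ∧ (∀ u, k * ‖u‖ ^ 2 ≤ B u u) ∧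
      AntilipschitzWith κ J := by
  have hs0 : 0 ≤ α / 2 := by linarith
  have hs1 : α / 2 ≤ 1 := by linarith
  have hs : α / 2 ≠ 1 / 2 := fun h => by linarith
  have ht0 : 0 ≤ 1 - α / 2 := by linarith
  have ht1 : 1 - α / 2 ≤ 1 := by linarith
  have ht1' : 1 - α / 2 < 1 := by linarith
  have ht : 1 - α / 2 ≠ 1 / 2 := fun h => by linarith
  have hts : 1 - α / 2 ≤ α / 2 := by linarith
  obtain ⟨L, hL, hL'⟩ := exists_leftOp_eq hs0 hs1 hs hlam hab
  obtain ⟨R, hR, hR'⟩ := exists_rightOp_eq hs0 hs1 hs hlam hab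
  obtain ⟨L₀, hL₀, hL₀'⟩ := exists_leftOp_eq hs0 hs1 hs le_rfl hab
  obtain ⟨R₀, hR₀, hR₀'⟩ := exists_rightOp_eq ht0 ht1 ht le_rfl hab
  obtain ⟨S, hS⟩ := exists_mulHZero ht0 ht1' hts hs1 hs hab hm
  -- Multiplication by the constant 1 provides the bounded inclusion of `H₀^(α/2)` into
  -- `H₀^(1-α/2)`.
  obtain ⟨I, hI⟩ := exists_mulHZero (m := fun _ => 1) ht0 ht1' hts hs1 hs hab contDiffOn_const
  have hI' : ∀ v, (I v).val = v.val := fun v => by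
    rw [hI]
    apply Lp.ext
    filter_upwards [mulL2_ae_eq (g := fun _ => 1) continuousOn_const v.val] with x h
    rw [h, one_mul]
  set V := HZero.valL a b (α / 2)
  obtain ⟨B, hBuv⟩ := exists_bilin (-(1 - p)) p ((1 - p) * lam ^ α) (p * lam ^ α)
    (α * (1 - 2 * p) * lam ^ (α - 1)) L R V L₀ (R₀.comp I) (R₀.comp S) ((mulCLM hc).comp V)
  simp only [ContinuousLinearMap.comp_apply, mulCLM_apply, V, HZero.valL_apply] at hBuv
  obtain ⟨k, hk, hk'⟩ := exists_coercive_test hα₁ hα₂ hlam hab hs0 hs1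
  have hd := HZero.denseRange_ofTest (a := a) (b := b) hs0 hs1
  have hB : ∀ u, k * ‖u‖ ^ 2 ≤ B u u := by
    -- Both sides are continuous in `u`, so density reduces the inequality to test functions.
    refine fun u => hd.induction_on u (isClosed_le (by fun_prop) (by fun_prop)) fun φ => ?_
    have h1 := advection_add_reaction_nonneg hab hs0 hs1 hs hts hm hc hmc (by linarith) ht0 ht1
      hL₀' hR₀' hS φ
    -- The tempering drift is `∫ φ' φ = 0` on the diagonal, so its coefficient does not matter for
    -- coercivity.
    have h2 : (inner ℝ (L₀ (HZero.ofTest hs0 hs1 φ)) (R₀ (I (HZero.ofTest hs0 hs1 φ))) : ℝ) = 0 := by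
      have h3 : I (HZero.ofTest hs0 hs1 φ) = HZero.ofTest ht0 ht1 φ :=
        HZero.val_injective (by rw [hI', HZero.val_ofTest, HZero.val_ofTest])
      rw [h3, hL₀', hR₀', inner_leftDeriv_rightDeriv_complementary hs0 hs1,
        integral_testDeriv_mul_self]
    have h4 := hk' φ
    -- On the diagonal the two mixed products coincide by symmetry, and the weights `1 - p` and `p`
    -- sum to one.
    rw [hBuv, h2, real_inner_comm (L _) (R _), HZero.val_ofTest, real_inner_self_eq_norm_sq]
    rw [hL', hR']
    linarith
  obtain ⟨J, hJ2⟩ := exists_prod_map V L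
  have hJ : ∀ u, k * ‖u‖ ≤ (lam ^ α + ‖R‖) * ‖J u‖ := by
    have h0 : ∀ u : HZero a b (α / 2), k * ‖u‖ ^ 2
        ≤ lam ^ α * ‖u.val‖ ^ 2 - inner ℝ (L u) (R u) := by
      refine fun u => hd.induction_on u (isClosed_le (by fun_prop) ?_) fun φ => ?_
      · exact (continuous_const.mul (V.continuous.norm.pow 2)).sub (L.continuous.inner R.continuous)
      · rw [hL', hR']
        exact hk' φ
    intro u
    have hJ2 : ‖J u‖ ^ 2 = ‖u.val‖ ^ 2 + ‖L u‖ ^ 2 := by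
      rw [hJ2, HZero.valL_apply]
    have h1 : ‖u.val‖ ≤ ‖J u‖ := by
      refine (sq_le_sq₀ (norm_nonneg _) (norm_nonneg _)).1 ?_
      nlinarith [sq_nonneg ‖L u‖]
    have h2 : ‖L u‖ ≤ ‖J u‖ := by
      refine (sq_le_sq₀ (norm_nonneg _) (norm_nonneg _)).1 ?_
      nlinarith [sq_nonneg ‖u.val‖]
    have h3 : -(inner ℝ (L u) (R u) : ℝ) ≤ ‖J u‖ * (‖R‖ * ‖u‖) := by
      refine (neg_le_abs _).trans ((abs_real_inner_le_norm _ _).trans ?_)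
      gcongr
      exact R.le_opNorm u
    have h4 : lam ^ α * ‖u.val‖ ^ 2 ≤ lam ^ α * (‖J u‖ * ‖u‖) := by
      rw [pow_two]
      have := HZero.norm_val_le u
      gcongr
    rcases (norm_nonneg u).eq_or_lt with h | h
    · rw [← h, mul_zero]; positivity
    · refine le_of_mul_le_mul_right ?_ h
      have := h0 u
      nlinarith
  have hκ : 0 ≤ (lam ^ α + ‖R‖) / k := by positivity
  refine ⟨B, J, ((lam ^ α + ‖R‖) / k).toNNReal, k, hk, fun u v => ?_, hB, ?_⟩
  · rw [hBuv]
    unfold galerkinForm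
    have h : rightOp a b (1 - α / 2) 0 v.val = R₀ (I v) := by rw [← hI' v, hR₀]
    rw [hL, hR, hR, hL, hL₀, ← hS, hR₀, h]
  · refine AddMonoidHomClass.antilipschitz_of_bound J fun u => ?_
    rw [Real.coe_toNNReal _ hκ, div_mul_eq_mul_div, le_div_iff₀ hk]
    linarith [hJ u]

end TemperedFractional
end

/-! ### The well-posedness theorem -/

theorem mainTheorem3 (a b α lam p : ℝ) (m c : ℝ → ℝ)
    (hab : a < b) (hα₁ : 1 < α) (hα₂ : α ≤ 2) (hlam : 0 ≤ lam) (hp₀ : 0 ≤ p) (hp₁ : p ≤ 1)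
    (hm : ContDiffOn ℝ 1 m (Set.Icc a b)) (hc : ContinuousOn c (Set.Icc a b))
    (hmc : ∀ x ∈ Set.Ioo a b, 0 < c x - deriv m x / 2) :
    ∃ C : ℝ, ∀ f : TemperedFractional.HNeg a b (α / 2),
      ∃ u : TemperedFractional.HZero a b (α / 2),
        (∀ v : TemperedFractional.HZero a b (α / 2),
          TemperedFractional.galerkinForm α lam p m c u.val v.val = f v) ∧
        (∀ w : TemperedFractional.HZero a b (α / 2),
          (∀ v : TemperedFractional.HZero a b (α / 2),
            TemperedFractional.galerkinForm α lam p m c w.val v.val = f v) → w = u) ∧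
        ‖u‖ ≤ C * ‖f‖ := by
  obtain ⟨B, J, κ, k, hk, hB, hcoer, hJ⟩ :=
    TemperedFractional.exists_galerkinForm_eq (p := p) hab hα₁ hα₂ hlam hm hc hmc
  have : CompleteSpace (TemperedFractional.HZero a b (α / 2)) :=
    TemperedFractional.HZero.completeSpace (by linarith) (by linarith)
      (fun h => by linarith) hab
  refine ⟨1 / k, fun f => ?_⟩
  simp only [hB]
  exact TemperedFractional.existsUnique_of_coercive J hJ B hk hcoer f
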